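/- All systems are finite-dimensional, all logarithms are to base $2$, $\|X\|_1=\mathrm{tr}\sqrt{X^\dagger X}$, and real powers of positive operators are taken on their supports. A *$(M,\epsilon)$ code* $(f,\Lambda)$ for a channel $\mathcal T$ consists of input density operators $f(w)$, $w\in\{1,\dots,M\}$, and a POVM $\{\Lambda^w\}$ with $\frac1M\sum_w\mathrm{tr}(\Lambda^w\mathcal T(f(w)))\ge 1-\epsilon$; its *induced output state* is $\frac1M\sum_w\mathcal T(f(w))$. A *code with $\log K$ key bits* is a family $(f_s,\Lambda_s)$, $s\in\{1,\dots,K\}$, of density-operator encoders and POVMs, the success probability and the induced output state being averaged over uniform $s$ and $w$. Let $\mathcal M_{A\to A}$ and $\mathcal N_{A\to B}$ be quantum channels, $k,\ell\ge1$, and let $\mathcal P_{k,\ell}=\{\rho^1,\dots,\rho^\ell\}$ be a set of density operators on $\mathcal H_A^{\otimes k}$. An encoder $f$ into $\mathcal H_A^{\otimes n}$ has *product structure with respect to* $\mathcal P_{k,\ell}$ if $k\mid n$ and each $f(w)$ is of the form $\sigma^1\otimes\cdots\otimes\sigma^{n/k}$ with all $\sigma^i\in\mathcal P_{k,\ell}$.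 Let $H(\rho)=-\mathrm{tr}\,\rho\log\rho$, $H^a(\rho)=-\frac1a\log\mathrm{tr}\,\rho^{a+1}$, and let $\nu(X)$ be the number of distinct eigenvalues of $X$. For a classical-quantum (cq) state $\sigma_{XB}=\sum_xP(x)|x\rangle\langle x|\otimes\sigma^x$ with finite alphabet let $I(X;B)_\sigma=H(\sigma_X)+H(\sigma_B)-H(\sigma_{XB})$ and $$\overline I_a(\sigma)=-\tfrac1a\log\mathrm{tr}\big(\sigma_{XB}(\sigma_X\otimes\sigma_B)^{a/2}\sigma_{XB}^{-a}(\sigma_X\otimes\sigma_B)^{a/2}\big),\qquad \underline I_a(\sigma)=-\tfrac1a\log\sum_xP(x)\,\mathrm{tr}\big((\sigma^x)^{1-a}\sigma_B^a\big).$$ **(Noiseless channel, $\mathcal N=\mathrm{id}_A$.)** For all $\zeta,\delta>0$ there is an integer $m$ (depending only on $\mathcal M,\mathcal P_{k,\ell},\zeta,\delta$) such that the following holds whenever $n/k\ge m$, $M\ge1$, and the cover protocol $(f,\Lambda)$ is an $(M,\epsilon)$ code for $\mathcal M^{\otimes n}$ whose encoder has product structure with respect to $\mathcal P_{k,\ell}$.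 Put $R=\min_{\rho\in\mathcal P_{k,\ell}}H(\mathcal M^{\otimes k}(\rho))$ and let $\rho^c$ be the output state induced by the cover protocol. Then the number of cypher bits of the stego protocol satisfies $$\min_w\sup_{0<a<1}\Big(H^a(\mathcal M^{\otimes n}(f(w)))-\tfrac4a\log\tfrac2\zeta\Big)\ \ge\ \tfrac nk(R-\delta),$$ and there are a positive integer $\overline M$ with $\log\overline M\ge\frac nk(R-\delta)$ and an $(M\overline M,\ \zeta+2\sqrt{\zeta+\epsilon})$ code for $\mathrm{id}^{\otimes n}$, using no key, transmitting the cover message and a cypher message in $\{1,\dots,\overline M\}$, whose induced output state $\rho^s$ satisfies $\|\rho^s-\rho^c\|_1\le\zeta$. **(Noisy channel, arbitrary $\mathcal N$.)** For all $\zeta,\xi\in(0,1)$ and $\delta>0$ there is an integer $m$ (depending only on $\mathcal M,\mathcal N,\mathcal P_{k,\ell},\zeta,\xi,\delta$) such that the following holds whenever $n/k\ge m$, $M\ge1$, and the cover protocol $(f,\Lambda)$ is an $(M,\epsilon)$ code for $\mathcal N^{\otimes n}\circ\mathcal M^{\otimes n}$ whose encoder has product structure with respect to $\mathcal P_{k,\ell}$.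 Put $$R=\inf_{\rho\in\mathcal P_{k,\ell}}\ \sup_{\sigma_{XA^k}}\ I(X;B^k)_\sigma ,$$ where the supremum is over cq states $\sigma_{XA^k}$ with finite alphabet $X$ such that $\sigma_{XB^k}=(\mathrm{id}_X\otimes\mathcal N^{\otimes k})(\sigma_{XA^k})$ satisfies $\mathrm{tr}_X\sigma_{XB^k}=\mathcal N^{\otimes k}(\mathcal M^{\otimes k}(\rho))$. Let $\rho^c$ be the output state induced by the cover protocol. Then: (a) There are cq states $\sigma^w_{XA^n}$, $w\in\{1,\dots,M\}$, whose images $\sigma^w_{XB^n}$ under $\mathrm{id}_X\otimes\mathcal N^{\otimes n}$ satisfy $\mathrm{tr}_X\sigma^w_{XB^n}=\mathcal N^{\otimes n}(\mathcal M^{\otimes n}(f(w)))$ and for which, with $$\log\overline M_w=\sup_{0<a<1}\Big(\overline I_a(\sigma^w_{XB^n})-\tfrac1a\log\nu(\sigma^w_X\otimes\sigma^w_{B^n})-\tfrac4a\log\tfrac{12}\zeta\Big),$$ the number of cypher bits and the number of key bits of the stego protocol satisfy $$\min_w\log\overline M_w\ge\tfrac nk(R-\delta),\qquad \max_w\Big\{\inf_{a<0}\Big(\underline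 I_a(\sigma^w_{XB^n})+\log\nu(\sigma^w_{B^n})+\big(2-\tfrac2a\big)\log\tfrac{12}\xi\Big)-\log\overline M_w+1\Big\}\le\delta n .$$ (b) There are positive integers $\overline M,K$ with $\log\overline M\ge\frac nk(R-\delta)$ and $\log K\le\delta n$, and an $(M\overline M,\ \zeta+2\sqrt{\xi+\epsilon})$ code for $\mathcal N^{\otimes n}$ with $\log K$ key bits, transmitting the cover message and a cypher message in $\{1,\dots,\overline M\}$, whose induced output state $\rho^s$ satisfies $\|\rho^s-\rho^c\|_1\le\xi$. -/

import Mathlib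

open scoped Kronecker ComplexOrder

namespace QuantumStego

noncomputable section

/-! Finite-dimensional systems are described by finite index types: the Hilbert space of a system
`A` is `ℂ^A`, operators on it are matrices in `Matrix A A ℂ`, and the `n`-fold tensor power is
indexed by `Fin n → A`. All logarithms are to base two. -/

section States

variable {A : Type*} [Fintype A] [DecidableEq A]

/-- Density operators. -/
structure IsDensity (ρ : Matrix A A ℂ) : Prop where
  posSemidef : ρ.PosSemidef
  trace_eq_one : ρ.trace = 1

/-- Positive operator valued measures with outcomes in `W`. -/
structure IsPOVM {W : Type*} [Fintype W] (Λ : W → Matrix A A ℂ) : Prop where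
  posSemidef : ∀ w, (Λ w).PosSemidef
  sum_eq_one : ∑ w, Λ w = 1

/-- The trace norm `tr √(X† X)`. -/
def traceNorm (X : Matrix A A ℂ) : ℝ :=
  (cfc Real.sqrt (X.conjTranspose * X)).trace.re

/-- The real power `ρ ^ a` of a positive semidefinite matrix, taken on the support of `ρ`
(`0 ^ a = 0` for `a ≠ 0`). -/
def matPow (ρ : Matrix A A ℂ) (a : ℝ) : Matrix A A ℂ :=
  cfc (fun x : ℝ => x ^ a) ρ

/-- The number of distinct eigenvalues. -/
def numEigenvalues (X : Matrix A A ℂ) : ℕ :=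
  (spectrum ℂ X).ncard

/-- The von Neumann entropy `- tr (ρ log ρ)`, in bits. -/
def entropy (ρ : Matrix A A ℂ) : ℝ :=
  (cfc Real.negMulLog ρ).trace.re / Real.log 2

/-- The Rényi entropy `H^a(ρ) = - (1 / a) log tr (ρ ^ (a + 1))`, in bits. -/
def renyiEntropy (a : ℝ) (ρ : Matrix A A ℂ) : ℝ :=
  -(1 / a) * Real.logb 2 (matPow ρ (a + 1)).trace.re

end States

section Channels

variable {A B : Type*} [Fintype A] [DecidableEq A] [Fintype B] [DecidableEq B]

/-- The ampliation `id ⊗ N`, acting on an operator on `ℂ^m ⊗ ℂ^A` blockwise. -/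
def ampliation (m : ℕ) (N : Matrix A A ℂ →ₗ[ℂ] Matrix B B ℂ)
    (X : Matrix (Fin m × A) (Fin m × A) ℂ) : Matrix (Fin m × B) (Fin m × B) ℂ :=
  Matrix.of fun p q => N (Matrix.of fun a a' => X (p.1, a) (q.1, a')) p.2 q.2

/-- Quantum channels: completely positive trace-preserving linear maps. -/
structure IsChannel (N : Matrix A A ℂ →ₗ[ℂ] Matrix B B ℂ) : Prop where
  completelyPositive : ∀ (m : ℕ) (X : Matrix (Fin m × A) (Fin m × A) ℂ),
    X.PosSemidef → (ampliation m N X).PosSemidef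
  tracePreserving : ∀ X : Matrix A A ℂ, (N X).trace = X.trace

/-- The tensor power `N^{⊗ n}` of a linear map on operators. -/
def tensorPow (n : ℕ) (N : Matrix A A ℂ →ₗ[ℂ] Matrix B B ℂ) :
    Matrix (Fin n → A) (Fin n → A) ℂ →ₗ[ℂ] Matrix (Fin n → B) (Fin n → B) ℂ where
  toFun X := Matrix.of fun b b' =>
    ∑ a : Fin n → A, ∑ a' : Fin n → A,
      X a a' * ∏ i, N (Matrix.single (a i) (a' i) (1 : ℂ)) (b i) (b' i)
  map_add' X Y := by
    ext b b'
    simp [add_mul, Finset.sum_add_distrib]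
  map_smul' c X := by
    ext b b'
    simp [mul_assoc, Finset.mul_sum]

end Channels

section Codes

variable {I O : Type*} [Fintype I] [DecidableEq I] [Fintype O] [DecidableEq O]
variable {S W : Type*} [Fintype S] [Fintype W]

/-- `(f, Λ)` is a classical communication code with (uniformly distributed) message in `W` and
average error probability at most `ε` for the channel `T`. -/
structure IsCode (T : Matrix I I ℂ →ₗ[ℂ] Matrix O O ℂ) (ε : ℝ)
    (f : W → Matrix I I ℂ) (Λ : W → Matrix O O ℂ) : Prop where
  isDensity : ∀ w, IsDensity (f w)
  isPOVM : IsPOVM Λ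
  success : 1 - ε ≤ (Fintype.card W : ℝ)⁻¹ * ∑ w, (Λ w * T (f w)).trace.re

/-- The output state induced by an encoder. -/
def inducedState (T : Matrix I I ℂ →ₗ[ℂ] Matrix O O ℂ) (f : W → Matrix I I ℂ) : Matrix O O ℂ :=
  (Fintype.card W : ℂ)⁻¹ • ∑ w, T (f w)

/-- A classical communication code that uses a shared secret key, uniformly distributed over `S`
and known to the encoder and the decoder; the error is averaged over key and message. -/
structure IsKeyedCode (T : Matrix I I ℂ →ₗ[ℂ] Matrix O O ℂ) (ε : ℝ)
    (f : S → W → Matrix I I ℂ) (Λ : S → W → Matrix O O ℂ) : Prop where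
  isDensity : ∀ s w, IsDensity (f s w)
  isPOVM : ∀ s, IsPOVM (Λ s)
  success : 1 - ε ≤ ((Fintype.card S : ℝ) * (Fintype.card W : ℝ))⁻¹ *
    ∑ s, ∑ w, (Λ s w * T (f s w)).trace.re

/-- The output state induced by a keyed encoder (averaged over key and message). -/
def keyedInducedState (T : Matrix I I ℂ →ₗ[ℂ] Matrix O O ℂ) (f : S → W → Matrix I I ℂ) :
    Matrix O O ℂ :=
  ((Fintype.card S : ℂ) * (Fintype.card W : ℂ))⁻¹ • ∑ s, ∑ w, T (f s w)

end Codes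

section Stego

variable {I O : Type*} [Fintype I] [DecidableEq I] [Fintype O] [DecidableEq O]

/-- There is a stego protocol for the channel `T` transmitting a cover message in `Fin M` together
with a cypher message in `Fin Mc` with error at most `ε`, whose induced output state is within
`η` in trace norm of the cover output state `ρc`; no key is used. -/
def HasStegoCode (T : Matrix I I ℂ →ₗ[ℂ] Matrix O O ℂ) (M Mc : ℕ) (ε η : ℝ)
    (ρc : Matrix O O ℂ) : Prop :=
  ∃ (g : Fin M × Fin Mc → Matrix I I ℂ) (Γ : Fin M × Fin Mc → Matrix O O ℂ),
    IsCode T ε g Γ ∧ traceNorm (inducedState T g - ρc) ≤ η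

/-- The same with a shared secret key uniformly distributed over `Fin K`. -/
def HasKeyedStegoCode (T : Matrix I I ℂ →ₗ[ℂ] Matrix O O ℂ) (M Mc K : ℕ) (ε η : ℝ)
    (ρc : Matrix O O ℂ) : Prop :=
  ∃ (g : Fin K → Fin M × Fin Mc → Matrix I I ℂ) (Γ : Fin K → Fin M × Fin Mc → Matrix O O ℂ),
    IsKeyedCode T ε g Γ ∧ traceNorm (keyedInducedState T g - ρc) ≤ η

end Stego

section ProductStructure

variable {A : Type*}

/-- The `i`-th block of length `k` of a word of length `n = r * k`. -/
def block {n r k : ℕ} (h : r * k = n) (x : Fin n → A) (i : Fin r) : Fin k → A :=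
  fun j => x (Fin.cast h (finProdFinEquiv (i, j)))

/-- The operator `σ 0 ⊗ ⋯ ⊗ σ (r - 1)` on `n = r * k` systems, each `σ i` acting on `k` systems. -/
def blockTensor {n r k : ℕ} (h : r * k = n) (σ : Fin r → Matrix (Fin k → A) (Fin k → A) ℂ) :
    Matrix (Fin n → A) (Fin n → A) ℂ :=
  Matrix.of fun x y => ∏ i, σ i (block h x i) (block h y i)

/-- The encoder `f` has a product structure with respect to `{P 0, …, P (ℓ - 1)}`. -/
def HasProductStructure {W : Type*} {n k ℓ : ℕ} (P : Fin ℓ → Matrix (Fin k → A) (Fin k → A) ℂ)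
    (f : W → Matrix (Fin n → A) (Fin n → A) ℂ) : Prop :=
  ∃ (r : ℕ) (h : r * k = n), ∀ w, ∃ c : Fin r → Fin ℓ, f w = blockTensor h fun i => P (c i)

end ProductStructure

section CQStates

/-- The data of a classical-quantum state `∑ x, P(x) |x⟩⟨x| ⊗ ρ^x`. -/
structure CQ (X A : Type*) where
  prob : X → ℝ
  state : X → Matrix A A ℂ

namespace CQ

variable {X A B : Type*} [Fintype X] [DecidableEq X]

/-- `P` is a probability mass function and all `ρ^x` are density operators. -/
structure IsState [Fintype A] (σ : CQ X A) : Prop where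
  prob_nonneg : ∀ x, 0 ≤ σ.prob x
  prob_sum : ∑ x, σ.prob x = 1
  isDensity : ∀ x, IsDensity (σ.state x)

/-- `(id_X ⊗ T)(σ)`. -/
def map (T : Matrix A A ℂ →ₗ[ℂ] Matrix B B ℂ) (σ : CQ X A) : CQ X B where
  prob := σ.prob
  state x := T (σ.state x)

/-- The joint operator `σ_{XA}`. -/
def joint (σ : CQ X A) : Matrix (X × A) (X × A) ℂ :=
  ∑ x, (σ.prob x : ℂ) • (Matrix.single x x (1 : ℂ) ⊗ₖ σ.state x)

/-- The classical marginal `σ_X`. -/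
def margX (σ : CQ X A) : Matrix X X ℂ :=
  Matrix.diagonal fun x => (σ.prob x : ℂ)

/-- The quantum marginal `σ_A = tr_X σ_{XA}`. -/
def margA (σ : CQ X A) : Matrix A A ℂ :=
  ∑ x, (σ.prob x : ℂ) • σ.state x

variable [Fintype A] [DecidableEq A]

/-- The mutual information `I(X;A) = H(X) + H(A) - H(XA)`, in bits. -/
def mutualInfo (σ : CQ X A) : ℝ :=
  entropy σ.margX + entropy σ.margA - entropy σ.joint

/-- The Rényi mutual information
`-(1/a) log tr (σ_{XA} (σ_X ⊗ σ_A)^{a/2} σ_{XA}^{-a} (σ_X ⊗ σ_A)^{a/2})`. -/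
def renyiInfoJoint (a : ℝ) (σ : CQ X A) : ℝ :=
  -(1 / a) * Real.logb 2
    (σ.joint * matPow (σ.margX ⊗ₖ σ.margA) (a / 2) * matPow σ.joint (-a) *
      matPow (σ.margX ⊗ₖ σ.margA) (a / 2)).trace.re

/-- The Rényi mutual information `-(1/a) log ∑ x, P(x) tr ((ρ^x)^{1-a} σ_A^a)`. -/
def renyiInfoCond (a : ℝ) (σ : CQ X A) : ℝ :=
  -(1 / a) * Real.logb 2
    (∑ x, σ.prob x * (matPow (σ.state x) (1 - a) * matPow σ.margA a).trace.re)

end CQ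

end CQStates

section Rates

variable {B X W : Type*} [Fintype B] [DecidableEq B] [Fintype X] [DecidableEq X]

/-- The number of cypher bits of the stego protocol on a noiseless channel with cover output
states `ρ^w`: `min_w sup_{0<a<1} (H^a(ρ^w) - (4/a) log (2/ζ))`. -/
def cypherBitsNoiseless (ζ : ℝ) (ρ : W → Matrix B B ℂ) : EReal :=
  ⨅ w, ⨆ a ∈ Set.Ioo (0 : ℝ) 1,
    ((renyiEntropy a (ρ w) - 4 / a * Real.logb 2 (2 / ζ) : ℝ) : EReal)

/-- The quantity `log M̄_w` of the stego protocol on a noisy channel, for a cq output state `σ^w`: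
`sup_{0<a<1} (I_a - (1/a) log ν(σ_X ⊗ σ_B) - (4/a) log (12/ζ))`. -/
def cypherBitsAt (ζ : ℝ) (σ : CQ X B) : EReal :=
  ⨆ a ∈ Set.Ioo (0 : ℝ) 1,
    ((σ.renyiInfoJoint a - 1 / a * Real.logb 2 (numEigenvalues (σ.margX ⊗ₖ σ.margA))
      - 4 / a * Real.logb 2 (12 / ζ) : ℝ) : EReal)

/-- The number of cypher bits on a noisy channel: `min_w log M̄_w`. -/
def cypherBitsNoisy (ζ : ℝ) (σ : W → CQ X B) : EReal :=
  ⨅ w, cypherBitsAt ζ (σ w)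

/-- The number of key bits on a noisy channel:
`max_w (inf_{a<0} (I_a + log ν(σ_B) + (2 - 2/a) log (12/ξ)) - log M̄_w + 1)`. -/
def keyBitsNoisy (ζ ξ : ℝ) (σ : W → CQ X B) : EReal :=
  ⨆ w, ((⨅ a ∈ Set.Iio (0 : ℝ),
    (((σ w).renyiInfoCond a + Real.logb 2 (numEigenvalues (σ w).margA)
      + (2 - 2 / a) * Real.logb 2 (12 / ξ) : ℝ) : EReal)) - cypherBitsAt ζ (σ w) + 1)

end Rates

section Information

variable {A B : Type*} [Fintype A] [DecidableEq A] [Fintype B] [DecidableEq B]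

/-- `sup I(X;B)` over all cq input states `σ_{XA}` with finite alphabet `X` whose output
`σ_{XB} = (id ⊗ T)(σ_{XA})` has quantum marginal `τ`. -/
def supInfo (T : Matrix A A ℂ →ₗ[ℂ] Matrix B B ℂ) (τ : Matrix B B ℂ) : ℝ :=
  sSup {I : ℝ | ∃ (d : ℕ) (σ : CQ (Fin d) A),
    σ.IsState ∧ (σ.map T).margA = τ ∧ I = (σ.map T).mutualInfo}

end Information

section Values

variable {A B : Type*} [Fintype A] [DecidableEq A] [Fintype B] [DecidableEq B] {k ℓ : ℕ}

/-- `min_j H(𝓜^{⊗ k}(P j))`. -/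
def minOutputEntropy (𝓜 : Matrix A A ℂ →ₗ[ℂ] Matrix A A ℂ)
    (P : Fin ℓ → Matrix (Fin k → A) (Fin k → A) ℂ) : ℝ :=
  ⨅ j, entropy (tensorPow k 𝓜 (P j))

/-- `inf_j sup I(X;B^k)`, the supremum being over the cq input states whose output under
`𝓝^{⊗ k}` has quantum marginal `𝓝^{⊗ k}(𝓜^{⊗ k}(P j))`. -/
def infSupInfo (𝓜 : Matrix A A ℂ →ₗ[ℂ] Matrix A A ℂ) (𝓝 : Matrix A A ℂ →ₗ[ℂ] Matrix B B ℂ)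
    (P : Fin ℓ → Matrix (Fin k → A) (Fin k → A) ℂ) : ℝ :=
  ⨅ j, supInfo (tensorPow k 𝓝) (tensorPow k 𝓝 (tensorPow k 𝓜 (P j)))

end Values

end

end QuantumStego

/-! Single-letter asymptotics. The cover output for each message is a tensor product of `r` blocks
from a finite family. All relevant moments (`margMoment`, `condMoment`, `sandwichMoment`,
`petzMoment`) multiply over blocks, equal one at exponent zero, and have as derivative there minus
an entropy, a conditional entropy or a mutual information. Since the family is finite, one small
exponent `s` makes the first-order expansion of the logarithm accurate to `γ * s` per block,
whatever the sequence of blocks. At this fixed `s` the Rényi quantities are within `r * γ` nats of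
their von Neumann values, while the additive corrections are constants or logarithms of eigenvalue
counts polynomial in `r`. This gives the rate expressions. By Markov's inequality the same moments
bound the weight of atypical eigenvalues by `exp (-(r * γ * s))`, which is all the codes need
(`exists_exponent`, `exists_exponent_density`).

Noiseless channel: the eigenvectors of an output state are distributed greedily into `N` bins. If
most eigenvalues are small compared to `1 / N`, the bins have nearly equal weight, so the state is
almost a uniform mixture of `N` orthogonal states, and these carry the cypher message without a key
(`exists_distinguishable_mixture`).

Noisy channel: for each block type a nearly optimal ensemble with the prescribed output average is
chosen, and codewords are drawn at random from the product ensemble. They are indexed by key, cypher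
message and an additional dummy message, which the encoder randomizes locally and the decoder also
recovers. Packing requires cypher and dummy messages together to stay slightly below the mutual
information; covering requires key, cypher and dummy messages together to lie slightly above it. The
key therefore only bridges a small gap, even when the cypher rate is far below the mutual
information. One codebook meets both demands because the suitably weighted expected errors add up to
less than one (`CQ.IsState.exists_codebook`, `exists_cypher_code_of_tails`).

Combination: for every cover message the average over cypher messages and keys imitates the cover
output up to `ξ`, so the cover decoder still works. Its square-root measurement is followed by the
cypher decoder belonging to its outcome, and the errors add up with constants three and two
(`one_sub_conj_le`, `hasKeyedStegoCode_of_decoders`). -/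

namespace QuantumStego

open Matrix
open scoped MatrixOrder

set_option linter.unusedSectionVars false

/-! ### Functional calculus in an eigenbasis, and powers on the support. -/

section Spectral

variable {n m : Type*} [Fintype n] [DecidableEq n] [Fintype m] [DecidableEq m]

/-- The matrix `U diag(d) U†`. -/
noncomputable def conjDiag (U : Matrix n n ℂ) (d : n → ℝ) : Matrix n n ℂ :=
  U * diagonal (fun i => (d i : ℂ)) * Uᴴ

theorem conjDiag_isHermitian (U : Matrix n n ℂ) (d : n → ℝ) : (conjDiag U d).IsHermitian := by
  unfold conjDiag Matrix.IsHermitian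
  simp only [conjTranspose_mul, conjTranspose_conjTranspose, diagonal_conjTranspose, Matrix.mul_assoc]
  congr 3
  ext i
  simp

theorem conjDiag_mul {U : Matrix n n ℂ} (hU : Uᴴ * U = 1) (d e : n → ℝ) :
    conjDiag U d * conjDiag U e = conjDiag U (fun i => d i * e i) := by
  unfold conjDiag
  calc _ = U * diagonal (fun i => (d i : ℂ)) * (Uᴴ * U) * diagonal (fun i => (e i : ℂ)) * Uᴴ := by
        simp only [Matrix.mul_assoc]
    _ = _ := by
        rw [hU, Matrix.mul_one, Matrix.mul_assoc U, diagonal_mul_diagonal]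
        simp

theorem trace_conjDiag {U : Matrix n n ℂ} (hU : Uᴴ * U = 1) (d : n → ℝ) :
    (conjDiag U d).trace = ((∑ i, d i : ℝ) : ℂ) := by
  unfold conjDiag
  rw [Matrix.trace_mul_comm, ← Matrix.mul_assoc, hU, Matrix.one_mul, trace_diagonal]
  simp

theorem conjDiag_posSemidef (U : Matrix n n ℂ) {d : n → ℝ} (hd : ∀ i, 0 ≤ d i) :
    (conjDiag U d).PosSemidef :=
  (PosSemidef.diagonal (fun i => by simpa using hd i)).mul_mul_conjTranspose_same U

theorem conjDiag_apply (U : Matrix n n ℂ) (d : n → ℝ) (i j : n) :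
    conjDiag U d i j = ∑ l, U i l * (d l : ℂ) * star (U j l) := by
  unfold conjDiag
  rw [Matrix.mul_apply]
  simp [Matrix.mul_diagonal]

theorem continuousOn_spectrum (f : ℝ → ℝ) (ρ : Matrix n n ℂ) :
    ContinuousOn f (spectrum ℝ ρ) := ρ.finite_real_spectrum.continuousOn f

/-- On a finite spectrum every function agrees with an interpolating polynomial, and polynomials act
entrywise on a diagonalization. No choice of eigenbasis is imposed, so tensor products and block
sums of eigenbases may be used later. -/
theorem cfc_conjDiag {U : Matrix n n ℂ} (hU : Uᴴ * U = 1) (d : n → ℝ) (f : ℝ → ℝ) :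
    cfc f (conjDiag U d) = conjDiag U (fun i => f (d i)) := by
  classical
  have hU' : U * Uᴴ = 1 := mul_eq_one_comm.mp hU
  have hH : IsSelfAdjoint (conjDiag U d) := conjDiag_isHermitian U d
  -- The nodes include the entries of `d` directly, so that their identification with the spectrum
  -- is not needed.
  set s : Finset ℝ := (conjDiag U d).finite_real_spectrum.toFinset ∪ Finset.univ.image d with hs
  set p : Polynomial ℝ := Lagrange.interpolate s id f with hp
  have hpe : ∀ x ∈ s, p.eval x = f x := fun x hx =>
    Lagrange.eval_interpolate_at_node (v := id) f (Set.injOn_id _) hx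
  rw [cfc_congr (g := p.eval) (fun x hx => (hpe x (by simp [hs, hx])).symm),
    cfc_polynomial p _ hH]
  have hpow : ∀ k : ℕ, (conjDiag U d) ^ k = conjDiag U (fun i => d i ^ k) := by
    intro k
    induction k with
    | zero => simp [conjDiag, hU']
    | succ k ih => rw [pow_succ, ih, conjDiag_mul hU]; simp [pow_succ]
  rw [Polynomial.aeval_eq_sum_range]
  ext i j
  simp only [hpow, Matrix.sum_apply, Matrix.smul_apply, conjDiag_apply]
  simp only [Finset.smul_sum]
  rw [Finset.sum_comm]
  refine Finset.sum_congr rfl fun l _ => ?_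
  rw [← hpe (d l) (by simp [hs]), Polynomial.eval_eq_sum_range]
  push_cast
  rw [Finset.mul_sum, Finset.sum_mul]
  refine Finset.sum_congr rfl fun k _ => ?_
  rw [Complex.real_smul]
  ring

theorem exists_conjDiag {ρ : Matrix n n ℂ} (hρ : ρ.IsHermitian) :
    ∃ (U : Matrix n n ℂ) (d : n → ℝ), Uᴴ * U = 1 ∧ ρ = conjDiag U d := by
  refine ⟨hρ.eigenvectorUnitary, hρ.eigenvalues, ?_, ?_⟩
  · simpa [star_eq_conjTranspose] using Unitary.coe_star_mul_self hρ.eigenvectorUnitary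
  · conv_lhs => rw [hρ.spectral_theorem]
    rfl

theorem exists_conjDiag_nonneg {ρ : Matrix n n ℂ} (hρ : ρ.PosSemidef) :
    ∃ (U : Matrix n n ℂ) (d : n → ℝ), Uᴴ * U = 1 ∧ (∀ i, 0 ≤ d i) ∧ ρ = conjDiag U d := by
  refine ⟨hρ.1.eigenvectorUnitary, hρ.1.eigenvalues, ?_, hρ.eigenvalues_nonneg, ?_⟩
  · simpa [star_eq_conjTranspose] using Unitary.coe_star_mul_self hρ.1.eigenvectorUnitary
  · conv_lhs => rw [hρ.1.spectral_theorem]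
    rfl

theorem conjDiag_one {U : Matrix n n ℂ} (hU : Uᴴ * U = 1) : conjDiag U (fun _ => 1) = 1 := by
  simpa [conjDiag] using mul_eq_one_comm.mp hU

/-- Traces of products of positive operators are nonnegative. -/
theorem trace_mul_nonneg {X Y : Matrix n n ℂ} (hX : X.PosSemidef) (hY : Y.PosSemidef) :
    0 ≤ (X * Y).trace := by
  obtain ⟨Z, rfl⟩ := CStarAlgebra.nonneg_iff_eq_star_mul_self.mp hX.nonneg
  rw [star_eq_conjTranspose, Matrix.mul_assoc, Matrix.trace_mul_comm]
  exact (hY.mul_mul_conjTranspose_same Z).trace_nonneg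

theorem trace_mul_re_nonneg {X Y : Matrix n n ℂ} (hX : X.PosSemidef) (hY : Y.PosSemidef) :
    0 ≤ (X * Y).trace.re := (Complex.le_def.mp (trace_mul_nonneg hX hY)).1

theorem trace_re_nonneg {X : Matrix n n ℂ} (hX : X.PosSemidef) : 0 ≤ X.trace.re :=
  (Complex.le_def.mp hX.trace_nonneg).1

theorem trace_mul_re_mono {X Y ω : Matrix n n ℂ} (h : X ≤ Y) (hω : ω.PosSemidef) :
    (X * ω).trace.re ≤ (Y * ω).trace.re := by
  have := trace_mul_re_nonneg (Matrix.le_iff.mp h) hω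
  rw [sub_mul, trace_sub, Complex.sub_re] at this
  linarith

theorem trace_re_mono {X Y : Matrix n n ℂ} (h : X ≤ Y) : X.trace.re ≤ Y.trace.re := by
  simpa using trace_mul_re_mono h (PosSemidef.one (n := n) (R := ℂ))

/-- The power `ρ ^ a` on the support of `ρ`, for all real exponents `a`. -/
noncomputable def suppPow (ρ : Matrix n n ℂ) (a : ℝ) : Matrix n n ℂ :=
  cfc (fun x : ℝ => if x = 0 then 0 else x ^ a) ρ

/-- The two powers can only differ at exponent zero, where `0 ^ 0 = 1` would give the identity
instead of the support projection. The version on the support is continuous in the exponent at zero,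
as the derivatives below require. -/
theorem matPow_eq_suppPow (ρ : Matrix n n ℂ) {a : ℝ} (ha : a ≠ 0) : matPow ρ a = suppPow ρ a := by
  unfold matPow suppPow
  congr 1
  ext x
  split_ifs with h
  · rw [h, Real.zero_rpow ha]
  · rfl

theorem suppPow_conjDiag {U : Matrix n n ℂ} (hU : Uᴴ * U = 1) (d : n → ℝ) (a : ℝ) :
    suppPow (conjDiag U d) a = conjDiag U (fun i => if d i = 0 then 0 else d i ^ a) :=
  cfc_conjDiag hU d _

theorem suppPow_posSemidef {ρ : Matrix n n ℂ} (hρ : ρ.PosSemidef) (a : ℝ) :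
    (suppPow ρ a).PosSemidef := by
  obtain ⟨U, d, hU, hd, rfl⟩ := exists_conjDiag_nonneg hρ
  rw [suppPow_conjDiag hU]
  refine conjDiag_posSemidef U fun i => ?_
  split_ifs
  · rfl
  · exact Real.rpow_nonneg (hd i) a

theorem suppPow_mul {ρ : Matrix n n ℂ} (hρ : ρ.PosSemidef) (a b : ℝ) :
    suppPow ρ a * suppPow ρ b = suppPow ρ (a + b) := by
  obtain ⟨U, d, hU, hd, rfl⟩ := exists_conjDiag_nonneg hρ
  rw [suppPow_conjDiag hU, suppPow_conjDiag hU, suppPow_conjDiag hU, conjDiag_mul hU]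
  congr 1
  ext i
  split_ifs with h
  · simp
  · rw [Real.rpow_add (lt_of_le_of_ne (hd i) (Ne.symm h))]

theorem suppPow_one {ρ : Matrix n n ℂ} (hρ : ρ.PosSemidef) : suppPow ρ 1 = ρ := by
  obtain ⟨U, d, hU, hd, rfl⟩ := exists_conjDiag_nonneg hρ
  rw [suppPow_conjDiag hU]
  congr 1
  ext i
  split_ifs with h <;> simp [h]

theorem cfc_mul_cfc (ρ : Matrix n n ℂ) (f g : ℝ → ℝ) :
    cfc f ρ * cfc g ρ = cfc (fun x => f x * g x) ρ :=
  (cfc_mul f g ρ (continuousOn_spectrum _ _) (continuousOn_spectrum _ _)).symm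

theorem cfc_posSemidef {ρ : Matrix n n ℂ} (hρ : ρ.PosSemidef) {f : ℝ → ℝ}
    (hf : ∀ x, 0 ≤ x → 0 ≤ f x) : (cfc f ρ).PosSemidef := by
  obtain ⟨U, d, hU, hd, rfl⟩ := exists_conjDiag_nonneg hρ
  rw [cfc_conjDiag hU]
  exact conjDiag_posSemidef U fun i => hf _ (hd i)

theorem cfc_mono_posSemidef {ρ : Matrix n n ℂ} (hρ : ρ.PosSemidef) {f g : ℝ → ℝ}
    (h : ∀ x, 0 ≤ x → f x ≤ g x) : cfc f ρ ≤ cfc g ρ := by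
  rw [Matrix.le_iff, ← cfc_sub g f ρ (continuousOn_spectrum _ _) (continuousOn_spectrum _ _)]
  exact cfc_posSemidef hρ fun x hx => sub_nonneg.mpr (h x hx)

theorem cfc_isHermitian (ρ : Matrix n n ℂ) (f : ℝ → ℝ) : (cfc f ρ).IsHermitian :=
  cfc_predicate f ρ

theorem cfc_const_one' {ρ : Matrix n n ℂ} (hρ : ρ.IsHermitian) : cfc (fun _ : ℝ => (1 : ℝ)) ρ = 1 :=
  cfc_const_one ℝ ρ hρ

end Spectral

/-! ### Trace norm and its dual description for Hermitian operators. -/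

section TraceNorm

variable {n : Type*} [Fintype n] [DecidableEq n]

theorem traceNorm_conjDiag {U : Matrix n n ℂ} (hU : Uᴴ * U = 1) (d : n → ℝ) :
    traceNorm (conjDiag U d) = ∑ i, |d i| := by
  unfold traceNorm
  rw [(conjDiag_isHermitian U d).eq, conjDiag_mul hU, cfc_conjDiag hU, trace_conjDiag hU,
    Complex.ofReal_re]
  exact Finset.sum_congr rfl fun i _ => Real.sqrt_mul_self_eq_abs _

/-- A Hermitian operator attains its trace norm on a Hermitian unitary. -/
theorem exists_traceNorm_eq {X : Matrix n n ℂ} (hX : X.IsHermitian) :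
    ∃ V : Matrix n n ℂ, V.IsHermitian ∧ V * V = 1 ∧ traceNorm X = (V * X).trace.re := by
  obtain ⟨U, d, hU, rfl⟩ := exists_conjDiag hX
  refine ⟨conjDiag U fun i => if 0 ≤ d i then 1 else -1, conjDiag_isHermitian _ _, ?_, ?_⟩
  · rw [conjDiag_mul hU]
    convert conjDiag_one hU using 2
    ext i
    split_ifs <;> simp
  · rw [traceNorm_conjDiag hU, conjDiag_mul hU, trace_conjDiag hU, Complex.ofReal_re]
    refine Finset.sum_congr rfl fun i _ => ?_
    split_ifs with h
    · rw [abs_of_nonneg h, one_mul]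
    · rw [abs_of_neg (not_le.mp h)]; ring

theorem trace_mul_conjDiag (L U : Matrix n n ℂ) (d : n → ℝ) :
    (L * conjDiag U d).trace = ∑ i, (Uᴴ * L * U) i i * (d i : ℂ) := by
  unfold conjDiag
  rw [← Matrix.mul_assoc, Matrix.trace_mul_comm, ← Matrix.mul_assoc, ← Matrix.mul_assoc]
  simp [Matrix.trace, Matrix.mul_diagonal]

/-- In an eigenbasis of `X` only the diagonal of `L` matters, and its entries lie in `[-1, 1]`. This
is the easy half of trace-norm duality; it also transfers success probabilities between nearby
states. -/
theorem trace_mul_re_le_traceNorm {L X : Matrix n n ℂ} (hX : X.IsHermitian) (h0 : -1 ≤ L)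
    (h1 : L ≤ 1) : (L * X).trace.re ≤ traceNorm X := by
  obtain ⟨U, d, hU, rfl⟩ := exists_conjDiag hX
  have key : ∀ M : Matrix n n ℂ, M.PosSemidef → ∀ i, 0 ≤ ((Uᴴ * M * U) i i).re := fun M hM i =>
    (Complex.le_def.mp (hM.conjTranspose_mul_mul_same U).diag_nonneg).1
  have e1 := fun i => key _ (Matrix.le_iff.mp h0) i
  have e2 := fun i => key _ (Matrix.le_iff.mp h1) i
  rw [traceNorm_conjDiag hU, trace_mul_conjDiag, Complex.re_sum]
  refine Finset.sum_le_sum fun i _ => ?_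
  have e1 := e1 i
  have e2 := e2 i
  simp only [mul_sub, sub_mul, Matrix.mul_one, hU, sub_neg_eq_add, mul_add, add_mul, Matrix.add_apply,
    Matrix.sub_apply, Matrix.one_apply_eq, Complex.add_re, Complex.sub_re, Complex.one_re] at e1 e2
  rw [Complex.mul_re, Complex.ofReal_re, Complex.ofReal_im, mul_zero, sub_zero]
  calc _ ≤ |((Uᴴ * L * U) i i).re * d i| := le_abs_self _
    _ = |((Uᴴ * L * U) i i).re| * |d i| := abs_mul _ _
    _ ≤ 1 * |d i| := by
        gcongr
        rw [abs_le]; constructor <;> linarith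
    _ = _ := one_mul _

theorem isHermitian_unitary_bounds {V : Matrix n n ℂ} (hV : V.IsHermitian) (hVV : V * V = 1) :
    -1 ≤ V ∧ V ≤ 1 := by
  constructor
  · rw [Matrix.le_iff]
    have : V - -1 = (2⁻¹ : ℝ) • ((1 + V)ᴴ * (1 + V)) := by
      rw [conjTranspose_add, hV.eq, conjTranspose_one, add_mul, mul_add, mul_add, hVV]
      simp only [mul_one, one_mul, sub_neg_eq_add]
      rw [show (1 : Matrix n n ℂ) + V + (V + 1) = (2 : ℝ) • (V + 1) by rw [two_smul]; abel,
        smul_smul]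
      norm_num
    rw [this]
    exact (posSemidef_conjTranspose_mul_self _).smul (by norm_num)
  · rw [Matrix.le_iff]
    have : 1 - V = (2⁻¹ : ℝ) • ((1 - V)ᴴ * (1 - V)) := by
      rw [conjTranspose_sub, hV.eq, conjTranspose_one, sub_mul, mul_sub, mul_sub, hVV]
      simp only [mul_one, one_mul]
      rw [show (1 : Matrix n n ℂ) - V - (V - 1) = (2 : ℝ) • (1 - V) by rw [two_smul]; abel,
        smul_smul]
      norm_num
    rw [this]
    exact (posSemidef_conjTranspose_mul_self _).smul (by norm_num)

/-- A unitary attaining the norm of the sum tests all the summands simultaneously. -/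
theorem traceNorm_sum_le {ι : Type*} (s : Finset ι) {X : ι → Matrix n n ℂ} {a : ι → ℝ}
    (ha : ∀ i, 0 ≤ a i) (hX : ∀ i, (X i).IsHermitian) :
    traceNorm (∑ i ∈ s, (a i : ℂ) • X i) ≤ ∑ i ∈ s, a i * traceNorm (X i) := by
  have hS : (∑ i ∈ s, (a i : ℂ) • X i).IsHermitian := by
    unfold Matrix.IsHermitian
    rw [conjTranspose_sum]
    refine Finset.sum_congr rfl fun i _ => ?_
    rw [conjTranspose_smul, (hX i).eq]
    simp
  obtain ⟨V, hV, hVV, h⟩ := exists_traceNorm_eq hS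
  rw [h, Finset.mul_sum, trace_sum, Complex.re_sum]
  refine Finset.sum_le_sum fun i _ => ?_
  rw [Matrix.mul_smul, trace_smul, smul_eq_mul, Complex.re_ofReal_mul]
  exact mul_le_mul_of_nonneg_left (trace_mul_re_le_traceNorm (hX i)
    (isHermitian_unitary_bounds hV hVV).1 (isHermitian_unitary_bounds hV hVV).2) (ha i)

theorem traceNorm_nonneg {X : Matrix n n ℂ} (hX : X.IsHermitian) : 0 ≤ traceNorm X := by
  obtain ⟨U, d, hU, rfl⟩ := exists_conjDiag hX
  rw [traceNorm_conjDiag hU]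
  positivity

end TraceNorm

/-! ### Tensor products of blocks. -/

section BlockTensor

variable {A B : Type*} [Fintype A] [DecidableEq A] [Fintype B] [DecidableEq B] {n r k : ℕ}

/-- Words of length `r * k` as `r` blocks of length `k`. -/
def blockEquiv (h : r * k = n) : (Fin n → A) ≃ (Fin r → Fin k → A) :=
  ((Equiv.arrowCongr (finProdFinEquiv.trans (finCongr h)) (Equiv.refl A)).symm).trans
    (Equiv.curry (Fin r) (Fin k) A)

theorem sum_block {R : Type*} [AddCommMonoid R] (h : r * k = n) (F : (Fin r → Fin k → A) → R) :
    ∑ x : Fin n → A, F (block h x) = ∑ y, F y :=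
  Equiv.sum_comp (blockEquiv h) F

theorem prod_block {R : Type*} [CommMonoid R] (h : r * k = n) (g : Fin n → R) :
    ∏ t, g t = ∏ i : Fin r, ∏ j : Fin k, g (Fin.cast h (finProdFinEquiv (i, j))) := by
  rw [← Fintype.prod_prod_type', ← Equiv.prod_comp (finProdFinEquiv.trans (finCongr h))]
  rfl

theorem block_injective (h : r * k = n) : Function.Injective (block (A := A) h) :=
  (blockEquiv h).injective

theorem blockTensor_apply (h : r * k = n) (σ : Fin r → Matrix (Fin k → A) (Fin k → A) ℂ)
    (x y : Fin n → A) : blockTensor h σ x y = ∏ i, σ i (block h x i) (block h y i) := rfl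

theorem blockTensor_mul (h : r * k = n) (σ τ : Fin r → Matrix (Fin k → A) (Fin k → A) ℂ) :
    blockTensor h σ * blockTensor h τ = blockTensor h fun i => σ i * τ i := by
  ext x y
  simp only [Matrix.mul_apply, blockTensor_apply, ← Finset.prod_mul_distrib]
  rw [sum_block h fun z => ∏ i, σ i (block h x i) (z i) * τ i (z i) (block h y i), Fintype.prod_sum]

theorem trace_blockTensor (h : r * k = n) (σ : Fin r → Matrix (Fin k → A) (Fin k → A) ℂ) :
    (blockTensor h σ).trace = ∏ i, (σ i).trace := by
  simp only [Matrix.trace, Matrix.diag_apply, blockTensor_apply]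
  rw [sum_block h fun z => ∏ i, σ i (z i) (z i), Fintype.prod_sum]

theorem conjTranspose_blockTensor (h : r * k = n)
    (σ : Fin r → Matrix (Fin k → A) (Fin k → A) ℂ) :
    (blockTensor h σ)ᴴ = blockTensor h fun i => (σ i)ᴴ := by
  ext x y
  simp [blockTensor_apply, Matrix.conjTranspose_apply]

theorem blockTensor_diagonal (h : r * k = n) (d : Fin r → (Fin k → A) → ℂ) :
    (blockTensor h fun i => diagonal (d i)) = diagonal fun x => ∏ i, d i (block h x i) := by
  ext x y
  rw [blockTensor_apply, diagonal_apply]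
  split_ifs with hxy
  · subst hxy; simp
  · obtain ⟨i, hi⟩ : ∃ i, block h x i ≠ block h y i := by
      by_contra! hc
      exact hxy (block_injective h (funext hc))
    exact Finset.prod_eq_zero (Finset.mem_univ i) (by simp [hi])

theorem blockTensor_one (h : r * k = n) :
    (blockTensor h fun _ => (1 : Matrix (Fin k → A) (Fin k → A) ℂ)) = 1 := by
  simpa using blockTensor_diagonal h fun _ (_ : Fin k → A) => (1 : ℂ)

theorem blockTensor_conjDiag (h : r * k = n) (U : Fin r → Matrix (Fin k → A) (Fin k → A) ℂ)
    (d : Fin r → (Fin k → A) → ℝ) :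
    (blockTensor h fun i => conjDiag (U i) (d i)) =
      conjDiag (blockTensor h U) fun x => ∏ i, d i (block h x i) := by
  unfold conjDiag
  rw [conjTranspose_blockTensor, ← blockTensor_mul, ← blockTensor_mul, blockTensor_diagonal]
  simp

theorem blockTensor_isometry (h : r * k = n) {U : Fin r → Matrix (Fin k → A) (Fin k → A) ℂ}
    (hU : ∀ i, (U i)ᴴ * U i = 1) : (blockTensor h U)ᴴ * blockTensor h U = 1 := by
  rw [conjTranspose_blockTensor, blockTensor_mul]
  simp only [hU, blockTensor_one]

theorem blockTensor_posSemidef (h : r * k = n)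
    {σ : Fin r → Matrix (Fin k → A) (Fin k → A) ℂ} (hσ : ∀ i, (σ i).PosSemidef) :
    (blockTensor h σ).PosSemidef := by
  choose U d hU hd hs using fun i => exists_conjDiag_nonneg (hσ i)
  rw [funext hs, blockTensor_conjDiag]
  exact conjDiag_posSemidef _ fun x => Finset.prod_nonneg fun i _ => hd i _

/-- The tensor product of eigenbases is an eigenbasis, and a product of eigenvalues vanishes exactly
when one factor does, so the convention at zero is compatible with products. -/
theorem suppPow_blockTensor (h : r * k = n)
    {σ : Fin r → Matrix (Fin k → A) (Fin k → A) ℂ} (hσ : ∀ i, (σ i).PosSemidef) (a : ℝ) :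
    suppPow (blockTensor h σ) a = blockTensor h fun i => suppPow (σ i) a := by
  choose U d hU hd hs using fun i => exists_conjDiag_nonneg (hσ i)
  rw [funext hs, blockTensor_conjDiag, suppPow_conjDiag (blockTensor_isometry h hU)]
  simp only [suppPow_conjDiag (hU _), blockTensor_conjDiag]
  congr 1
  ext x
  split_ifs with h0
  · obtain ⟨i, hi, hi0⟩ := Finset.prod_eq_zero_iff.mp h0
    exact (Finset.prod_eq_zero (f := fun i => if d i (block h x i) = 0 then (0 : ℝ)
      else d i (block h x i) ^ a) hi (if_pos hi0)).symm
  · have h1 : ∀ i, d i (block h x i) ≠ 0 := fun i => by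
      have := Finset.prod_ne_zero_iff.mp h0 i (Finset.mem_univ i)
      exact this
    simp only [h1, if_false]
    rw [Real.finsetProd_rpow _ _ fun i _ => hd i _]

theorem IsDensity.blockTensor (h : r * k = n)
    {σ : Fin r → Matrix (Fin k → A) (Fin k → A) ℂ} (hσ : ∀ i, IsDensity (σ i)) :
    IsDensity (blockTensor h σ) where
  posSemidef := blockTensor_posSemidef h fun i => (hσ i).posSemidef
  trace_eq_one := by
    rw [trace_blockTensor]
    exact Finset.prod_eq_one fun i _ => (hσ i).trace_eq_one

theorem tensorPow_apply (N : Matrix A A ℂ →ₗ[ℂ] Matrix B B ℂ) (X : Matrix (Fin n → A) (Fin n → A) ℂ)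
    (b b' : Fin n → B) : tensorPow n N X b b' = ∑ a : Fin n → A, ∑ a' : Fin n → A,
      X a a' * ∏ i, N (Matrix.single (a i) (a' i) (1 : ℂ)) (b i) (b' i) := rfl

theorem tensorPow_blockTensor (h : r * k = n) (N : Matrix A A ℂ →ₗ[ℂ] Matrix B B ℂ)
    (σ : Fin r → Matrix (Fin k → A) (Fin k → A) ℂ) :
    tensorPow n N (blockTensor h σ) = blockTensor h fun i => tensorPow k N (σ i) := by
  ext b b'
  simp only [blockTensor_apply, tensorPow_apply]
  have e : ∀ a a' : Fin n → A, ∏ t, N (Matrix.single (a t) (a' t) (1 : ℂ)) (b t) (b' t) =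
      ∏ i : Fin r, ∏ j : Fin k, N (Matrix.single (block h a i j) (block h a' i j) (1 : ℂ))
        (block h b i j) (block h b' i j) := fun a a' => prod_block h _
  simp only [e, ← Finset.prod_mul_distrib]
  rw [sum_block h fun a => ∑ a' : Fin n → A, ∏ i : Fin r, (σ i (a i) (block h a' i) *
    ∏ j : Fin k, N (Matrix.single (a i j) (block h a' i j) (1 : ℂ))
      (block h b i j) (block h b' i j))]
  have e2 : ∀ a : Fin r → Fin k → A, (∑ a' : Fin n → A, ∏ i : Fin r, (σ i (a i) (block h a' i) *
    ∏ j : Fin k, N (Matrix.single (a i j) (block h a' i j) (1 : ℂ))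
      (block h b i j) (block h b' i j))) = ∏ i : Fin r, ∑ a' : Fin k → A, (σ i (a i) a' *
    ∏ j : Fin k, N (Matrix.single (a i j) (a' j) (1 : ℂ))
      (block h b i j) (block h b' i j)) := by
    intro a
    rw [sum_block h fun a' => ∏ i : Fin r, (σ i (a i) (a' i) *
      ∏ j : Fin k, N (Matrix.single (a i j) (a' i j) (1 : ℂ)) (block h b i j) (block h b' i j)),
      Fintype.prod_sum]
  simp only [e2]
  rw [Fintype.prod_sum]

theorem tensorPow_id (X : Matrix (Fin n → A) (Fin n → A) ℂ) :
    tensorPow n (LinearMap.id : Matrix A A ℂ →ₗ[ℂ] Matrix A A ℂ) X = X := by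
  ext b b'
  rw [tensorPow_apply]
  have e : ∀ a a' : Fin n → A, ∏ i, (LinearMap.id : Matrix A A ℂ →ₗ[ℂ] Matrix A A ℂ)
      (Matrix.single (a i) (a' i) (1 : ℂ)) (b i) (b' i) = if a = b ∧ a' = b' then 1 else 0 := by
    intro a a'
    split_ifs with hab
    · rw [hab.1, hab.2]; simp
    · obtain ⟨i, hi⟩ : ∃ i, ¬ (a i = b i ∧ a' i = b' i) := by
        by_contra! hc
        exact hab ⟨funext fun i => (hc i).1, funext fun i => (hc i).2⟩
      exact Finset.prod_eq_zero (Finset.mem_univ i) (by simp [hi])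
  simp only [e]
  rw [Finset.sum_eq_single b, Finset.sum_eq_single b']
  · simp
  · intro c _ hc; simp [hc]
  · simp
  · intro c _ hc; simp [hc]
  · simp

/-- Sums of block tensors over product families. -/
theorem sum_prod_smul_blockTensor {X : Type*} [Fintype X] (h : r * k = n)
    (p : Fin r → X → ℝ) (σ : Fin r → X → Matrix (Fin k → A) (Fin k → A) ℂ) :
    ∑ x : Fin r → X, ((∏ i, p i (x i) : ℝ) : ℂ) • blockTensor h (fun i => σ i (x i)) =
      blockTensor h fun i => ∑ x, (p i x : ℂ) • σ i x := by
  ext a b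
  simp only [Matrix.sum_apply, Matrix.smul_apply, blockTensor_apply, smul_eq_mul, Fintype.prod_sum]
  refine Finset.sum_congr rfl fun x _ => ?_
  push_cast
  rw [Finset.prod_mul_distrib]

end BlockTensor

/-! ### Kraus operators and tensor powers of channels. -/

section Channel

variable {A B : Type*} [Fintype A] [DecidableEq A] [Fintype B] [DecidableEq B]

/-- Kraus decomposition of a channel. -/
theorem IsChannel.exists_kraus {N : Matrix A A ℂ →ₗ[ℂ] Matrix B B ℂ} (hN : IsChannel N) :
    ∃ (d : ℕ) (K : Fin d → Matrix B A ℂ), ∀ a a' b b',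
      N (Matrix.single a a' 1) b b' = ∑ s, K s b a * star (K s b' a') := by
  let e := Fintype.equivFin A
  -- The unnormalized maximally entangled vector: the image of its rank-one operator is the Choi
  -- matrix, whose factorization `star Z * Z` yields the Kraus operators.
  let v : Fin (Fintype.card A) × A → ℂ := fun p => if e p.2 = p.1 then 1 else 0
  have hC := hN.completelyPositive (Fintype.card A) _ (posSemidef_vecMulVec_self_star v)
  obtain ⟨Z, hZ⟩ := CStarAlgebra.nonneg_iff_eq_star_mul_self.mp hC.nonneg
  let f := Fintype.equivFin (Fin (Fintype.card A) × B)
  refine ⟨Fintype.card (Fin (Fintype.card A) × B),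
    fun s => Matrix.of fun b a => star (Z (f.symm s) (e a, b)), fun a a' b b' => ?_⟩
  have h1 := congrFun (congrFun hZ (e a, b)) (e a', b')
  rw [star_eq_conjTranspose, Matrix.mul_apply] at h1
  simp only [Matrix.conjTranspose_apply] at h1
  rw [← Equiv.sum_comp f]
  simp only [Equiv.symm_apply_apply, Matrix.of_apply, star_star]
  rw [← h1]
  have : (Matrix.single a a' 1 : Matrix A A ℂ) =
      Matrix.of fun x y => vecMulVec v (star v) (e a, x) (e a', y) := by
    ext x y
    simp only [Matrix.vecMulVec_apply, Matrix.of_apply, Pi.star_apply, v,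
      EmbeddingLike.apply_eq_iff_eq, Matrix.single_apply]
    by_cases h1 : x = a <;> by_cases h2 : y = a' <;> simp [h1, h2, eq_comm] <;> grind
  rw [this]
  rfl

/-- Positivity of the tensor power is where complete positivity enters: products of Kraus operators
are Kraus operators of the power. -/
theorem IsChannel.tensorPow_isDensity {N : Matrix A A ℂ →ₗ[ℂ] Matrix B B ℂ} (hN : IsChannel N)
    (n : ℕ) {ρ : Matrix (Fin n → A) (Fin n → A) ℂ} (hρ : IsDensity ρ) :
    IsDensity (tensorPow n N ρ) where
  posSemidef := by
    obtain ⟨d, K, hK⟩ := hN.exists_kraus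
    have : tensorPow n N ρ = ∑ s : Fin n → Fin d,
        (Matrix.of fun b a => ∏ i, K (s i) (b i) (a i) : Matrix (Fin n → B) (Fin n → A) ℂ) * ρ *
        (Matrix.of fun b a => ∏ i, K (s i) (b i) (a i) : Matrix (Fin n → B) (Fin n → A) ℂ)ᴴ := by
      ext b b'
      simp only [tensorPow_apply, hK, Fintype.prod_sum, Matrix.sum_apply, Matrix.mul_apply,
        Matrix.of_apply, Matrix.conjTranspose_apply, Finset.mul_sum, Finset.sum_mul]
      rw [Finset.sum_comm]
      rw [Finset.sum_congr rfl fun a' _ => Finset.sum_comm]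
      rw [Finset.sum_comm]
      refine Finset.sum_congr rfl fun s _ => Finset.sum_congr rfl fun a' _ =>
        Finset.sum_congr rfl fun a _ => ?_
      rw [Finset.prod_mul_distrib]
      simp only [star_prod]
      ring
    rw [this]
    exact posSemidef_sum _ fun s _ => hρ.posSemidef.mul_mul_conjTranspose_same _
  trace_eq_one := by
    rw [← hρ.trace_eq_one]
    simp only [Matrix.trace, Matrix.diag_apply, tensorPow_apply]
    rw [Finset.sum_comm]
    refine Finset.sum_congr rfl fun a _ => ?_
    rw [Finset.sum_comm]
    have : ∀ a' : Fin n → A, ∑ b : Fin n → B,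
        ρ a a' * ∏ i, N (Matrix.single (a i) (a' i) (1 : ℂ)) (b i) (b i) =
        if a = a' then ρ a a' else 0 := by
      intro a'
      rw [← Finset.mul_sum, ← Fintype.prod_sum fun i b => N (Matrix.single (a i) (a' i) (1 : ℂ)) b b]
      have e : ∀ i, ∑ b, N (Matrix.single (a i) (a' i) (1 : ℂ)) b b = if a i = a' i then 1 else 0 := by
        intro i
        have := hN.tracePreserving (Matrix.single (a i) (a' i) (1 : ℂ))
        rw [Matrix.trace] at this
        simp only [Matrix.diag_apply] at this
        rw [this]
        split_ifs with hi
        · rw [hi]; simp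
        · simp [hi]
      simp only [e]
      split_ifs with haa
      · simp [haa]
      · obtain ⟨i, hi⟩ := Function.ne_iff.mp haa
        rw [Finset.prod_eq_zero (Finset.mem_univ i) (if_neg hi), mul_zero]
    simp only [this]
    simp

end Channel

/-! ### Derivatives of moments at exponent zero. -/

section Derivatives

open scoped Matrix.Norms.L2Operator
open Filter Topology

variable {n : Type*} [Fintype n] [DecidableEq n]

theorem conjDiag_eq_sum (U : Matrix n n ℂ) (d : n → ℝ) :
    conjDiag U d = ∑ i, d i • conjDiag U (Pi.single i 1) := by
  ext a b
  simp only [Matrix.sum_apply, Matrix.smul_apply, conjDiag_apply, Complex.real_smul,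
    Finset.mul_sum]
  rw [Finset.sum_comm]
  refine Finset.sum_congr rfl fun l _ => ?_
  rw [Finset.sum_eq_single l]
  · simp; ring
  · intro i _ hi
    simp [hi.symm]
  · simp

/-- Zero eigenvalues contribute the constant zero, matching the convention `Real.log 0 = 0`. -/
theorem hasDerivAt_suppPow {ρ : Matrix n n ℂ} (hρ : ρ.PosSemidef) (c : ℝ) :
    HasDerivAt (fun a : ℝ => suppPow ρ (c * a)) (c • cfc Real.log ρ) 0 := by
  obtain ⟨U, d, hU, hd, rfl⟩ := exists_conjDiag_nonneg hρ
  rw [cfc_conjDiag hU]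
  have e : (fun a : ℝ => suppPow (conjDiag U d) (c * a)) = fun a =>
      ∑ i, (if d i = 0 then 0 else d i ^ (c * a)) • conjDiag U (Pi.single i 1) := by
    ext1 a
    rw [suppPow_conjDiag hU, conjDiag_eq_sum]
  rw [e, conjDiag_eq_sum, Finset.smul_sum]
  refine HasDerivAt.fun_sum fun i _ => ?_
  rw [smul_smul]
  refine HasDerivAt.smul_const ?_ _
  by_cases h : d i = 0
  · simpa [h] using hasDerivAt_const (0 : ℝ) (0 : ℝ)
  · simp only [h, if_false]
    have hp : 0 < d i := lt_of_le_of_ne (hd i) (Ne.symm h)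
    have h1 : HasDerivAt (fun a : ℝ => c * a) c 0 := by simpa using (hasDerivAt_id (0 : ℝ)).const_mul c
    have := (h1.const_rpow hp)
    simpa [mul_comm] using this

theorem _root_.HasDerivAt.matrix_trace_re {F : ℝ → Matrix n n ℂ} {F' : Matrix n n ℂ} {x : ℝ}
    (h : HasDerivAt F F' x) : HasDerivAt (fun a => (F a).trace.re) F'.trace.re x := by
  let L : Matrix n n ℂ →L[ℝ] ℝ := LinearMap.toContinuousLinearMap
    (Complex.reLm ∘ₗ (Matrix.traceLinearMap n ℝ ℂ))
  exact L.hasFDerivAt.comp_hasDerivAt x h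

theorem mul_suppPow_zero {ρ : Matrix n n ℂ} (hρ : ρ.PosSemidef) : ρ * suppPow ρ 0 = ρ := by
  conv_lhs => rw [← suppPow_one hρ]
  conv_rhs => rw [← suppPow_one hρ]
  have := suppPow_mul hρ 1 0
  rw [suppPow_one hρ] at this ⊢
  simpa [suppPow_one hρ] using this

theorem suppPow_zero_mul {ρ : Matrix n n ℂ} (hρ : ρ.PosSemidef) : suppPow ρ 0 * ρ = ρ := by
  have := suppPow_mul hρ 0 1
  simpa [suppPow_one hρ] using this

/-- If `c ρ ≤ τ` then the support of `ρ` is contained in that of `τ`. -/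
theorem mul_suppPow_zero_of_le {ρ τ : Matrix n n ℂ} (hρ : ρ.PosSemidef) (hτ : τ.PosSemidef)
    {c : ℝ} (hc : 0 < c) (h : (c : ℂ) • ρ ≤ τ) : ρ * suppPow τ 0 = ρ := by
  set Q := 1 - suppPow τ 0 with hQ
  have hQh : Qᴴ = Q := by
    rw [hQ, conjTranspose_sub, conjTranspose_one, (suppPow_posSemidef hτ 0).1.eq]
  have hz : τ * Q = 0 := by rw [hQ, mul_sub, mul_one, mul_suppPow_zero hτ, sub_self]
  obtain ⟨Z, rfl⟩ := CStarAlgebra.nonneg_iff_eq_star_mul_self.mp hρ.nonneg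
  rw [star_eq_conjTranspose] at *
  -- With `ρ = Zᴴ * Z`, compressing `c ρ ≤ τ` by the projection `Q` onto the kernel of `τ` leaves a
  -- nonpositive Gram operator, hence `Z * Q = 0`.
  have h2 : (c : ℂ) • ((Z * Q)ᴴ * (Z * Q)) ≤ 0 := by
    have := star_left_conjugate_le_conjugate h Q
    rw [mul_assoc, mul_assoc, hz, mul_zero] at this
    convert this using 1
    rw [star_eq_conjTranspose, conjTranspose_mul, Matrix.smul_mul, Matrix.mul_smul]
    simp only [Matrix.mul_assoc]
  have h3 : ((Z * Q)ᴴ * (Z * Q)).trace = 0 := by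
    have h4 := trace_re_mono h2
    have h5 : 0 ≤ ((Z * Q)ᴴ * (Z * Q)).trace :=
      (posSemidef_conjTranspose_mul_self (Z * Q)).trace_nonneg
    rw [trace_smul, smul_eq_mul, Complex.re_ofReal_mul, trace_zero, Complex.zero_re] at h4
    obtain ⟨h6, h7⟩ := Complex.le_def.mp h5
    refine Complex.ext ?_ h7.symm
    have : ((Z * Q)ᴴ * (Z * Q)).trace.re ≤ 0 := by
      by_contra hcon
      exact absurd h4 (not_le.mpr (mul_pos hc (not_le.mp hcon)))
    exact le_antisymm this h6
  have h4 : Z * Q = 0 := trace_conjTranspose_mul_self_eq_zero_iff.mp h3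
  have h5 : Zᴴ * Z * Q = 0 := by rw [Matrix.mul_assoc, h4, Matrix.mul_zero]
  rw [hQ, mul_sub, mul_one, sub_eq_zero] at h5
  exact h5.symm

theorem suppPow_zero_mul_of_le {ρ τ : Matrix n n ℂ} (hρ : ρ.PosSemidef) (hτ : τ.PosSemidef)
    {c : ℝ} (hc : 0 < c) (h : (c : ℂ) • ρ ≤ τ) : suppPow τ 0 * ρ = ρ := by
  have := congrArg conjTranspose (mul_suppPow_zero_of_le hρ hτ hc h)
  rwa [conjTranspose_mul, hρ.1.eq, (suppPow_posSemidef hτ 0).1.eq] at this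

/-- The entropy in nats. -/
noncomputable def natEntropy (ρ : Matrix n n ℂ) : ℝ := (cfc Real.negMulLog ρ).trace.re

theorem trace_mul_log {ρ : Matrix n n ℂ} (hρ : ρ.PosSemidef) :
    (ρ * cfc Real.log ρ).trace.re = -natEntropy ρ := by
  obtain ⟨U, d, hU, hd, rfl⟩ := exists_conjDiag_nonneg hρ
  unfold natEntropy
  rw [cfc_conjDiag hU, cfc_conjDiag hU, conjDiag_mul hU, trace_conjDiag hU, trace_conjDiag hU,
    Complex.ofReal_re, Complex.ofReal_re, ← Finset.sum_neg_distrib]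
  exact Finset.sum_congr rfl fun i _ => by simp [Real.negMulLog]

theorem hasDerivAt_trace_suppPow {ρ : Matrix n n ℂ} (hρ : ρ.PosSemidef) (c : ℝ) :
    HasDerivAt (fun a : ℝ => (suppPow ρ (1 + c * a)).trace.re) (-c * natEntropy ρ) 0 := by
  have h := ((hasDerivAt_suppPow hρ c).const_mul ρ).matrix_trace_re
  rw [Matrix.mul_smul, trace_smul, Complex.smul_re, trace_mul_log hρ] at h
  convert h using 1
  · ext a
    rw [← suppPow_mul hρ, suppPow_one hρ]
  · simp

/-- At exponent zero the powers become support projections, which `ρ` absorbs thanks to the support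
inclusion; the product rule then gives minus the relative entropy. -/
theorem hasDerivAt_trace_suppPow_mul {ρ τ : Matrix n n ℂ} (hρ : ρ.PosSemidef) (hτ : τ.PosSemidef)
    {c : ℝ} (hc : 0 < c) (h : (c : ℂ) • ρ ≤ τ) :
    HasDerivAt (fun a : ℝ => (suppPow ρ (1 - a) * suppPow τ a).trace.re)
      (natEntropy ρ + (ρ * cfc Real.log τ).trace.re) 0 := by
  have h1 := ((((hasDerivAt_suppPow hρ (-1)).const_mul ρ).mul
    (hasDerivAt_suppPow hτ 1))).matrix_trace_re
  convert h1 using 1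
  · ext a
    simp only [Pi.mul_apply]
    rw [sub_eq_add_neg, ← suppPow_mul hρ, suppPow_one hρ]
    simp
  · rw [mul_zero, mul_zero, mul_suppPow_zero hρ, one_smul, trace_add, Complex.add_re]
    congr 1
    rw [Matrix.mul_assoc, Matrix.trace_mul_comm, Matrix.mul_assoc,
      suppPow_zero_mul_of_le hρ hτ hc h, Matrix.trace_mul_comm]
    rw [Matrix.mul_smul, trace_smul, Complex.smul_re, trace_mul_log hρ]
    simp

theorem hasDerivAt_trace_sandwich {ρ τ : Matrix n n ℂ} (hρ : ρ.PosSemidef) (hτ : τ.PosSemidef)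
    {c : ℝ} (hc : 0 < c) (h : (c : ℂ) • ρ ≤ τ) :
    HasDerivAt (fun a : ℝ =>
        (ρ * suppPow τ (a / 2) * suppPow ρ (-a) * suppPow τ (a / 2)).trace.re)
      (natEntropy ρ + (ρ * cfc Real.log τ).trace.re) 0 := by
  have hT := hasDerivAt_suppPow hτ (1 / 2)
  have h1 := ((((hT.const_mul ρ).mul (hasDerivAt_suppPow hρ (-1)))).mul hT).matrix_trace_re
  convert h1 using 1
  · ext a
    simp only [Pi.mul_apply]
    rw [show a / 2 = 1 / 2 * a by ring, show -a = -1 * a by ring]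
  · simp only [mul_zero, Pi.mul_apply]
    set P := suppPow ρ 0 with hP
    set T := suppPow τ 0 with hT
    set Lτ := cfc Real.log τ
    set Lρ := cfc Real.log ρ
    have r1 : ρ * T = ρ := mul_suppPow_zero_of_le hρ hτ hc h
    have r2 : T * ρ = ρ := suppPow_zero_mul_of_le hρ hτ hc h
    have r3 : ρ * P = ρ := mul_suppPow_zero hρ
    have r4 : P * ρ = ρ := suppPow_zero_mul hρ
    -- The two factors with exponent `a / 2` each contribute half of the logarithm of `τ`; the
    -- middle factor contributes the entropy of `ρ`.
    have t1 : (ρ * ((1 / 2 : ℝ) • Lτ) * P * T).trace = (1 / 2 : ℝ) • (ρ * Lτ).trace := by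
      rw [Matrix.mul_smul, Matrix.smul_mul, Matrix.smul_mul, trace_smul, Matrix.mul_assoc,
        Matrix.mul_assoc, Matrix.trace_mul_comm, Matrix.mul_assoc, Matrix.mul_assoc, r2, r4,
        Matrix.trace_mul_comm]
    have t2 : (ρ * T * ((-1 : ℝ) • Lρ) * T).trace = -(ρ * Lρ).trace := by
      rw [r1, Matrix.trace_mul_comm, ← Matrix.mul_assoc, r2, Matrix.mul_smul, trace_smul]
      simp
    have t3 : (ρ * T * P * ((1 / 2 : ℝ) • Lτ)).trace = (1 / 2 : ℝ) • (ρ * Lτ).trace := by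
      rw [r1, r3, Matrix.mul_smul, trace_smul]
    rw [add_mul, trace_add, trace_add, t1, t2, t3]
    simp only [Complex.add_re, Complex.neg_re, Complex.smul_re, smul_eq_mul]
    rw [trace_mul_log hρ]
    ring

end Derivatives

/-! ### First-order expansion of logarithms. -/

section Calculus

open Filter Topology

/-- First-order expansion of the logarithm of a function that equals one at the origin. -/
theorem eventually_log_bounds {φ : ℝ → ℝ} {D : ℝ} (h : HasDerivAt φ D 0) (h0 : φ 0 = 1) {γ : ℝ}
    (hγ : 0 < γ) :
    ∀ᶠ a in 𝓝 (0 : ℝ), 0 < φ a ∧ |Real.log (φ a) - a * D| ≤ γ * |a| := by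
  have h1 : ∀ᶠ a in 𝓝 (0 : ℝ), 0 < φ a :=
    h.continuousAt.eventually (lt_mem_nhds (by rw [h0]; norm_num))
  have h2 : HasDerivAt (fun a => Real.log (φ a)) D 0 := by
    simpa [h0] using h.log (by rw [h0]; norm_num)
  have h3 := (hasDerivAt_iff_isLittleO.mp h2).def hγ
  filter_upwards [h1, h3] with a ha hb
  refine ⟨ha, ?_⟩
  simpa [h0] using hb

end Calculus

/-! ### Block-diagonal operators, the form of joint operators of cq states. -/

section BlockDiag

variable {X B : Type*} [Fintype X] [DecidableEq X] [Fintype B] [DecidableEq B]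

/-- The block-diagonal matrix `∑ x, |x⟩⟨x| ⊗ F x`. -/
def blockDiag (F : X → Matrix B B ℂ) : Matrix (X × B) (X × B) ℂ :=
  Matrix.of fun p q => if p.1 = q.1 then F p.1 p.2 q.2 else 0

theorem blockDiag_mul (F G : X → Matrix B B ℂ) :
    blockDiag F * blockDiag G = blockDiag fun x => F x * G x := by
  ext p q
  simp only [blockDiag, Matrix.mul_apply, Matrix.of_apply, Fintype.sum_prod_type]
  rw [Finset.sum_eq_single p.1]
  · simp only [if_true]
    split_ifs <;> simp
  · intro y _ hy
    simp [hy.symm]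
  · simp

theorem trace_blockDiag (F : X → Matrix B B ℂ) :
    (blockDiag F).trace = ∑ x, (F x).trace := by
  simp [blockDiag, Matrix.trace, Fintype.sum_prod_type]

theorem conjTranspose_blockDiag (F : X → Matrix B B ℂ) :
    (blockDiag F)ᴴ = blockDiag fun x => (F x)ᴴ := by
  ext p q
  simp only [blockDiag, Matrix.conjTranspose_apply, Matrix.of_apply]
  by_cases h : p.1 = q.1
  · simp [h]
  · simp [h, Ne.symm h]

theorem blockDiag_diagonal (d : X → B → ℂ) :
    (blockDiag fun x => diagonal (d x)) = diagonal fun p => d p.1 p.2 := by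
  ext ⟨x, b⟩ ⟨y, c⟩
  simp only [blockDiag, Matrix.of_apply, diagonal_apply, Prod.mk.injEq]
  by_cases h : x = y <;> by_cases h' : b = c <;> simp [h, h']

theorem blockDiag_one : (blockDiag fun _ : X => (1 : Matrix B B ℂ)) = 1 := by
  simpa using blockDiag_diagonal fun (_ : X) (_ : B) => (1 : ℂ)

theorem blockDiag_conjDiag (U : X → Matrix B B ℂ) (d : X → B → ℝ) :
    (blockDiag fun x => conjDiag (U x) (d x)) = conjDiag (blockDiag U) fun p => d p.1 p.2 := by
  unfold conjDiag
  rw [conjTranspose_blockDiag, ← blockDiag_mul, ← blockDiag_mul, blockDiag_diagonal]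

theorem cfc_blockDiag {F : X → Matrix B B ℂ} (hF : ∀ x, (F x).IsHermitian) (f : ℝ → ℝ) :
    cfc f (blockDiag F) = blockDiag fun x => cfc f (F x) := by
  choose U d hU hs using fun x => exists_conjDiag (hF x)
  have hI : (blockDiag U)ᴴ * blockDiag U = 1 := by
    rw [conjTranspose_blockDiag, blockDiag_mul]
    simp only [hU, blockDiag_one]
  rw [funext hs, blockDiag_conjDiag, cfc_conjDiag hI]
  simp only [cfc_conjDiag (hU _), blockDiag_conjDiag]

theorem suppPow_blockDiag {F : X → Matrix B B ℂ} (hF : ∀ x, (F x).IsHermitian) (a : ℝ) :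
    suppPow (blockDiag F) a = blockDiag fun x => suppPow (F x) a := cfc_blockDiag hF _

theorem suppPow_smul {ρ : Matrix B B ℂ} (hρ : ρ.PosSemidef) {c : ℝ} (hc : 0 < c) (a : ℝ) :
    suppPow ((c : ℂ) • ρ) a = ((c ^ a : ℝ) : ℂ) • suppPow ρ a := by
  obtain ⟨U, d, hU, hd, rfl⟩ := exists_conjDiag_nonneg hρ
  have hs : ∀ (t : ℝ) (e : B → ℝ), ((t : ℂ) • conjDiag U e) = conjDiag U fun i => t * e i := by
    intro t e
    ext i j
    simp only [Matrix.smul_apply, conjDiag_apply, smul_eq_mul, Finset.mul_sum]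
    exact Finset.sum_congr rfl fun l _ => by push_cast; ring
  rw [hs, suppPow_conjDiag hU, suppPow_conjDiag hU, hs]
  congr 1
  ext i
  by_cases h : d i = 0
  · simp [h]
  · simp [h, hc.ne', Real.mul_rpow hc.le (hd i)]

theorem natEntropy_conjDiag {U : Matrix B B ℂ} (hU : Uᴴ * U = 1) (d : B → ℝ) :
    natEntropy (conjDiag U d) = ∑ i, Real.negMulLog (d i) := by
  unfold natEntropy
  rw [cfc_conjDiag hU, trace_conjDiag hU, Complex.ofReal_re]

theorem natEntropy_smul {ρ : Matrix B B ℂ} (hρ : IsDensity ρ) (c : ℝ) :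
    natEntropy ((c : ℂ) • ρ) = c * natEntropy ρ + Real.negMulLog c := by
  obtain ⟨U, d, hU, hd, h⟩ := exists_conjDiag_nonneg hρ.posSemidef
  have htr := hρ.trace_eq_one
  have hs : ((c : ℂ) • conjDiag U d) = conjDiag U fun i => c * d i := by
    ext i j
    simp only [Matrix.smul_apply, conjDiag_apply, smul_eq_mul, Finset.mul_sum]
    exact Finset.sum_congr rfl fun l _ => by push_cast; ring
  rw [h, trace_conjDiag hU] at htr
  have htr' : ∑ i, d i = 1 := by exact_mod_cast htr
  rw [h, hs, natEntropy_conjDiag hU, natEntropy_conjDiag hU]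
  simp only [Real.negMulLog_mul, Finset.sum_add_distrib, ← Finset.mul_sum, ← Finset.sum_mul, htr']
  ring

end BlockDiag

/-! ### Information quantities of cq states as letterwise moments. -/

section CQFormulas

variable {X B : Type*} [Fintype X] [DecidableEq X] [Fintype B] [DecidableEq B]

namespace CQ

theorem joint_eq_blockDiag (σ : CQ X B) :
    σ.joint = blockDiag fun x => (σ.prob x : ℂ) • σ.state x := by
  ext ⟨x, b⟩ ⟨y, c⟩
  simp only [joint, blockDiag, Matrix.sum_apply, Matrix.smul_apply, kroneckerMap_apply,
    Matrix.single_apply, Matrix.of_apply, smul_eq_mul]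
  rw [Finset.sum_eq_single x]
  · split_ifs <;> simp_all
  · intro z _ hz
    simp [hz]
  · simp

theorem margX_kronecker_margA (σ : CQ X B) :
    σ.margX ⊗ₖ σ.margA = blockDiag fun x => (σ.prob x : ℂ) • σ.margA := by
  ext ⟨x, b⟩ ⟨y, c⟩
  simp only [margX, blockDiag, Matrix.smul_apply, kroneckerMap_apply, diagonal_apply,
    Matrix.of_apply, smul_eq_mul]
  split_ifs <;> simp

variable {σ : CQ X B}

/-- Supplies the support inclusion for every letter of positive probability. -/
theorem IsState.smul_state_le (hσ : σ.IsState) (x : X) :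
    (σ.prob x : ℂ) • σ.state x ≤ σ.margA := by
  unfold margA
  refine Finset.single_le_sum (f := fun x => (σ.prob x : ℂ) • σ.state x) (fun y _ => ?_)
    (Finset.mem_univ x)
  exact ((hσ.isDensity y).posSemidef.smul (by exact_mod_cast hσ.prob_nonneg y)).nonneg

theorem IsState.margA_isDensity (hσ : σ.IsState) : IsDensity σ.margA where
  posSemidef := posSemidef_sum _ fun x _ =>
    (hσ.isDensity x).posSemidef.smul (by exact_mod_cast hσ.prob_nonneg x)
  trace_eq_one := by
    unfold margA
    simp only [trace_sum, trace_smul, (hσ.isDensity _).trace_eq_one, smul_eq_mul, mul_one]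
    exact_mod_cast hσ.prob_sum

/-- `∑ x, P(x) tr (ρ^x)^{1+s}`. -/
noncomputable def condMoment (σ : CQ X B) (s : ℝ) : ℝ :=
  ∑ x, σ.prob x * (suppPow (σ.state x) (1 + s)).trace.re

/-- `tr σ_B^{1+s}`. -/
noncomputable def margMoment (σ : CQ X B) (s : ℝ) : ℝ := (suppPow σ.margA (1 + s)).trace.re

/-- `∑ x, P(x) tr (ρ^x σ_B^{a/2} (ρ^x)^{-a} σ_B^{a/2})`. -/
noncomputable def sandwichMoment (σ : CQ X B) (a : ℝ) : ℝ :=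
  ∑ x, σ.prob x * (σ.state x * suppPow σ.margA (a / 2) * suppPow (σ.state x) (-a) *
    suppPow σ.margA (a / 2)).trace.re

/-- `∑ x, P(x) tr ((ρ^x)^{1-a} σ_B^a)`. -/
noncomputable def petzMoment (σ : CQ X B) (a : ℝ) : ℝ :=
  ∑ x, σ.prob x * (suppPow (σ.state x) (1 - a) * suppPow σ.margA a).trace.re

/-- The conditional entropy `H(B|X)`, in nats. -/
noncomputable def condEntropy (σ : CQ X B) : ℝ := ∑ x, σ.prob x * natEntropy (σ.state x)

theorem IsState.renyiInfoJoint_eq (hσ : σ.IsState) {a : ℝ} (ha : a ≠ 0) :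
    σ.renyiInfoJoint a = -(1 / a) * Real.logb 2 (σ.sandwichMoment a) := by
  have h2 : a / 2 ≠ 0 := by simpa using ha
  have hp := fun x => (hσ.isDensity x).posSemidef
  have hm := hσ.margA_isDensity.posSemidef
  have hpc : ∀ x, (0 : ℂ) ≤ σ.prob x := fun x => by exact_mod_cast hσ.prob_nonneg x
  unfold renyiInfoJoint sandwichMoment
  rw [matPow_eq_suppPow _ h2, matPow_eq_suppPow _ (neg_ne_zero.mpr ha), joint_eq_blockDiag,
    margX_kronecker_margA]
  rw [suppPow_blockDiag fun x => (hm.smul (hpc x)).1,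
    suppPow_blockDiag fun x => ((hp x).smul (hpc x)).1,
    blockDiag_mul, blockDiag_mul, blockDiag_mul, trace_blockDiag, Complex.re_sum]
  congr 2
  refine Finset.sum_congr rfl fun x _ => ?_
  rcases (hσ.prob_nonneg x).eq_or_lt with h0 | h0
  · simp [← h0]
  · rw [suppPow_smul hm h0, suppPow_smul (hp x) h0]
    simp only [Matrix.smul_mul, Matrix.mul_smul, smul_smul, trace_smul, smul_eq_mul]
    rw [← Complex.ofReal_mul, ← Complex.ofReal_mul, ← Complex.ofReal_mul, Complex.re_ofReal_mul]
    congr 1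
    -- The powers of the letter probability have exponents `1`, `a / 2`, `-a`, `a / 2`, so one
    -- factor of the probability remains.
    rw [← Real.rpow_add_one h0.ne', ← Real.rpow_add h0, ← Real.rpow_add h0,
      show a / 2 + (-a + (a / 2 + 1)) = 1 by ring, Real.rpow_one]

theorem renyiInfoCond_eq {a : ℝ} (ha : a < 0) :
    σ.renyiInfoCond a = -(1 / a) * Real.logb 2 (σ.petzMoment a) := by
  unfold renyiInfoCond petzMoment
  simp only [matPow_eq_suppPow _ ha.ne, matPow_eq_suppPow _ (by linarith : 1 - a ≠ 0)]

theorem IsState.mutualInfo_eq (hσ : σ.IsState) :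
    σ.mutualInfo = (natEntropy σ.margA - σ.condEntropy) / Real.log 2 := by
  have hpc : ∀ x, (0 : ℂ) ≤ σ.prob x := fun x => by exact_mod_cast hσ.prob_nonneg x
  have h1 : natEntropy σ.margX = ∑ x, Real.negMulLog (σ.prob x) := by
    have : σ.margX = conjDiag 1 σ.prob := by simp [margX, conjDiag]
    rw [this, natEntropy_conjDiag (by simp)]
  have h2 : natEntropy σ.joint = σ.condEntropy + ∑ x, Real.negMulLog (σ.prob x) := by
    unfold condEntropy
    rw [joint_eq_blockDiag, natEntropy, cfc_blockDiag
      fun x => ((hσ.isDensity x).posSemidef.smul (hpc x)).1, trace_blockDiag, Complex.re_sum,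
      ← Finset.sum_add_distrib]
    exact Finset.sum_congr rfl fun x _ => natEntropy_smul (hσ.isDensity x) _
  unfold mutualInfo
  change natEntropy _ / _ + natEntropy _ / _ - natEntropy _ / _ = _
  rw [h1, h2]
  ring

theorem trace_state_re (hσ : σ.IsState) (x : X) : (σ.state x).trace.re = 1 := by
  rw [(hσ.isDensity x).trace_eq_one, Complex.one_re]

theorem IsState.hasDerivAt_condMoment (hσ : σ.IsState) :
    HasDerivAt σ.condMoment (-σ.condEntropy) 0 ∧ σ.condMoment 0 = 1 := by
  unfold condMoment condEntropy
  constructor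
  · rw [← Finset.sum_neg_distrib]
    refine HasDerivAt.fun_sum fun x _ => ?_
    rw [← mul_neg]
    refine HasDerivAt.const_mul _ ?_
    simpa using hasDerivAt_trace_suppPow (hσ.isDensity x).posSemidef 1
  · simp only [add_zero, suppPow_one (hσ.isDensity _).posSemidef, trace_state_re hσ, mul_one]
    exact hσ.prob_sum

theorem IsState.hasDerivAt_margMoment (hσ : σ.IsState) :
    HasDerivAt σ.margMoment (-natEntropy σ.margA) 0 ∧ σ.margMoment 0 = 1 := by
  unfold margMoment
  constructor
  · simpa using hasDerivAt_trace_suppPow hσ.margA_isDensity.posSemidef 1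
  · rw [add_zero, suppPow_one hσ.margA_isDensity.posSemidef, hσ.margA_isDensity.trace_eq_one,
      Complex.one_re]

/-- Averaging the states inside the trace with the logarithm produces the entropy of the marginal,
so the average relative entropy to the marginal is the mutual information. -/
theorem IsState.sum_trace_mul_log (hσ : σ.IsState) :
    ∑ x, σ.prob x * (natEntropy (σ.state x) + (σ.state x * cfc Real.log σ.margA).trace.re) =
      -(natEntropy σ.margA - σ.condEntropy) := by
  have : ∑ x, σ.prob x * (σ.state x * cfc Real.log σ.margA).trace.re = -natEntropy σ.margA := by
    rw [← trace_mul_log hσ.margA_isDensity.posSemidef]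
    conv_rhs => rw [show σ.margA * cfc Real.log σ.margA =
      (∑ x, (σ.prob x : ℂ) • σ.state x) * cfc Real.log σ.margA from rfl]
    rw [Finset.sum_mul, trace_sum, Complex.re_sum]
    refine Finset.sum_congr rfl fun x _ => ?_
    rw [Matrix.smul_mul, trace_smul, smul_eq_mul, Complex.re_ofReal_mul]
  simp only [mul_add, Finset.sum_add_distrib, this]
  unfold condEntropy
  ring

theorem IsState.hasDerivAt_sandwichMoment (hσ : σ.IsState) :
    HasDerivAt σ.sandwichMoment (-(natEntropy σ.margA - σ.condEntropy)) 0 ∧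
      σ.sandwichMoment 0 = 1 := by
  have hm := hσ.margA_isDensity.posSemidef
  rw [← hσ.sum_trace_mul_log]
  unfold sandwichMoment
  constructor
  · refine HasDerivAt.fun_sum fun x _ => ?_
    rcases (hσ.prob_nonneg x).eq_or_lt with h0 | h0
    · simpa [← h0] using hasDerivAt_const (0 : ℝ) (0 : ℝ)
    · exact (hasDerivAt_trace_sandwich (hσ.isDensity x).posSemidef hm h0
        (hσ.smul_state_le x)).const_mul _
  · refine (Finset.sum_congr rfl fun x _ => ?_).trans hσ.prob_sum
    rcases (hσ.prob_nonneg x).eq_or_lt with h0 | h0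
    · simp [← h0]
    · have hp := (hσ.isDensity x).posSemidef
      have h1 := mul_suppPow_zero_of_le hp hm h0 (hσ.smul_state_le x)
      rw [zero_div, neg_zero, h1, mul_suppPow_zero hp, h1, trace_state_re hσ, mul_one]

theorem IsState.hasDerivAt_petzMoment (hσ : σ.IsState) :
    HasDerivAt σ.petzMoment (-(natEntropy σ.margA - σ.condEntropy)) 0 ∧
      σ.petzMoment 0 = 1 := by
  have hm := hσ.margA_isDensity.posSemidef
  rw [← hσ.sum_trace_mul_log]
  unfold petzMoment
  constructor
  · refine HasDerivAt.fun_sum fun x _ => ?_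
    rcases (hσ.prob_nonneg x).eq_or_lt with h0 | h0
    · simpa [← h0] using hasDerivAt_const (0 : ℝ) (0 : ℝ)
    · exact (hasDerivAt_trace_suppPow_mul (hσ.isDensity x).posSemidef hm h0
        (hσ.smul_state_le x)).const_mul _
  · refine (Finset.sum_congr rfl fun x _ => ?_).trans hσ.prob_sum
    rcases (hσ.prob_nonneg x).eq_or_lt with h0 | h0
    · simp [← h0]
    · have hp := (hσ.isDensity x).posSemidef
      rw [sub_zero, suppPow_one hp, mul_suppPow_zero_of_le hp hm h0 (hσ.smul_state_le x),
        trace_state_re hσ, mul_one]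

end CQ

end CQFormulas

/-! ### Multiplicativity of the moments over blocks. -/

section Products

variable {X Y B : Type*} [Fintype X] [DecidableEq X] [Fintype Y] [DecidableEq Y]
  [Fintype B] [DecidableEq B] {n r k : ℕ}

/-- The product of cq states, with alphabet identified with words along `e`. -/
def CQ.prod (h : r * k = n) (e : Y ≃ (Fin r → X)) (σ : Fin r → CQ X (Fin k → B)) :
    CQ Y (Fin n → B) where
  prob y := ∏ i, (σ i).prob (e y i)
  state y := blockTensor h fun i => (σ i).state (e y i)

variable (h : r * k = n) (e : Y ≃ (Fin r → X)) {σ : Fin r → CQ X (Fin k → B)}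

theorem CQ.prod_sum_eq (p q : Fin r → X → ℝ) :
    ∑ y : Y, (∏ i, p i (e y i)) * ∏ i, q i (e y i) = ∏ i, ∑ x, p i x * q i x := by
  rw [Equiv.sum_comp e fun z => (∏ i, p i (z i)) * ∏ i, q i (z i), Fintype.prod_sum]
  simp only [Finset.prod_mul_distrib]

theorem CQ.prod_margA : (CQ.prod h e σ).margA = blockTensor h fun i => (σ i).margA := by
  unfold CQ.margA
  rw [← sum_prod_smul_blockTensor, ← Equiv.sum_comp e]
  rfl

theorem CQ.prod_isState (hσ : ∀ i, (σ i).IsState) : (CQ.prod h e σ).IsState where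
  prob_nonneg y := Finset.prod_nonneg (s := Finset.univ) fun i _ => (hσ i).prob_nonneg (e y i)
  prob_sum := by
    have := CQ.prod_sum_eq e (fun i => (σ i).prob) fun _ _ => 1
    simp only [Finset.prod_const_one, mul_one, (hσ _).prob_sum] at this
    exact this
  isDensity y := IsDensity.blockTensor h fun i => (hσ i).isDensity _

theorem CQ.map_prod {A : Type*} [Fintype A] [DecidableEq A] (N : Matrix A A ℂ →ₗ[ℂ] Matrix B B ℂ)
    (τ : Fin r → CQ X (Fin k → A)) :
    (CQ.prod h e τ).map (tensorPow n N) = CQ.prod h e fun i => (τ i).map (tensorPow k N) := by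
  unfold CQ.prod CQ.map
  congr 1
  ext1 y
  exact tensorPow_blockTensor h N _

/-- Real parts multiply only because the traces involved are nonnegative, hence real. -/
theorem re_prod_of_nonneg {ι : Type*} (s : Finset ι) {z : ι → ℂ} (hz : ∀ i, 0 ≤ z i) :
    (∏ i ∈ s, z i).re = ∏ i ∈ s, (z i).re := by
  have : ∀ i, z i = ((z i).re : ℂ) := fun i =>
    Complex.ext rfl (by simpa using (Complex.le_def.mp (hz i)).2.symm)
  rw [Finset.prod_congr rfl fun i _ => this i, ← Complex.ofReal_prod, Complex.ofReal_re]

theorem CQ.prod_condMoment (hσ : ∀ i, (σ i).IsState) (s : ℝ) :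
    (CQ.prod h e σ).condMoment s = ∏ i, (σ i).condMoment s := by
  unfold CQ.condMoment
  rw [← CQ.prod_sum_eq e]
  refine Finset.sum_congr rfl fun y _ => ?_
  have hp := fun i => ((hσ i).isDensity (e y i)).posSemidef
  simp only [CQ.prod]
  rw [suppPow_blockTensor h hp, trace_blockTensor, re_prod_of_nonneg]
  exact fun i => (suppPow_posSemidef (hp i) _).trace_nonneg

theorem CQ.prod_margMoment (hσ : ∀ i, (σ i).IsState) (s : ℝ) :
    (CQ.prod h e σ).margMoment s = ∏ i, (σ i).margMoment s := by
  unfold CQ.margMoment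
  have hm := fun i => (hσ i).margA_isDensity.posSemidef
  rw [CQ.prod_margA, suppPow_blockTensor h hm, trace_blockTensor, re_prod_of_nonneg]
  exact fun i => (suppPow_posSemidef (hm i) _).trace_nonneg

theorem CQ.prod_sandwichMoment (hσ : ∀ i, (σ i).IsState) (a : ℝ) :
    (CQ.prod h e σ).sandwichMoment a = ∏ i, (σ i).sandwichMoment a := by
  unfold CQ.sandwichMoment
  have hm := fun i => (hσ i).margA_isDensity.posSemidef
  rw [← CQ.prod_sum_eq e, CQ.prod_margA, suppPow_blockTensor h hm]
  refine Finset.sum_congr rfl fun y _ => ?_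
  have hp := fun i => ((hσ i).isDensity (e y i)).posSemidef
  simp only [CQ.prod]
  rw [suppPow_blockTensor h hp, blockTensor_mul, blockTensor_mul, blockTensor_mul,
    trace_blockTensor, re_prod_of_nonneg]
  intro i
  -- Grouping the last three factors as a conjugated positive operator shows that the sandwiched
  -- trace is nonnegative.
  rw [Matrix.mul_assoc, Matrix.mul_assoc, ← Matrix.mul_assoc (suppPow _ _)]
  refine trace_mul_nonneg (hp i) ?_
  have := (suppPow_posSemidef (hp i) (-a)).mul_mul_conjTranspose_same
    (suppPow (σ i).margA (a / 2))
  rwa [(suppPow_posSemidef (hm i) _).1.eq] at this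

theorem CQ.prod_petzMoment (hσ : ∀ i, (σ i).IsState) (a : ℝ) :
    (CQ.prod h e σ).petzMoment a = ∏ i, (σ i).petzMoment a := by
  unfold CQ.petzMoment
  have hm := fun i => (hσ i).margA_isDensity.posSemidef
  rw [← CQ.prod_sum_eq e, CQ.prod_margA, suppPow_blockTensor h hm]
  refine Finset.sum_congr rfl fun y _ => ?_
  have hp := fun i => ((hσ i).isDensity (e y i)).posSemidef
  simp only [CQ.prod]
  rw [suppPow_blockTensor h hp, blockTensor_mul, trace_blockTensor, re_prod_of_nonneg]
  exact fun i => trace_mul_nonneg (suppPow_posSemidef (hp i) _) (suppPow_posSemidef (hm i) _)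

end Products

/-! ### Polynomial bounds on the number of distinct eigenvalues. -/

section Eigenvalues

variable {n : Type*} [Fintype n] [DecidableEq n]

theorem numEigenvalues_conjDiag_le {U : Matrix n n ℂ} (hU : Uᴴ * U = 1) (d : n → ℝ) {S : Set ℝ}
    (hS : S.Finite) (hd : ∀ i, d i ∈ S) : numEigenvalues (conjDiag U d) ≤ S.ncard := by
  have hU' : U * Uᴴ = 1 := mul_eq_one_comm.mp hU
  let V : unitary (Matrix n n ℂ) := ⟨U, by
    rw [Unitary.mem_iff, star_eq_conjTranspose]; exact ⟨hU, hU'⟩⟩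
  have hsp : spectrum ℂ (conjDiag U d) = Set.range fun i => (d i : ℂ) := by
    have : conjDiag U d = V * diagonal (fun i => (d i : ℂ)) * (star V : Matrix n n ℂ) := rfl
    rw [this, Unitary.spectrum_star_right_conjugate, spectrum_diagonal]
  unfold numEigenvalues
  rw [hsp, ← Set.ncard_image_of_injective S Complex.ofReal_injective]
  refine Set.ncard_le_ncard ?_ (hS.image _)
  rintro _ ⟨i, rfl⟩
  exact ⟨d i, hd i, rfl⟩

/-- The number of different products of `r` factors from a finite family is polynomial in `r`. -/
theorem ncard_range_prod_le {Z : Type*} [Fintype Z] [DecidableEq Z] (v : Z → ℝ) (r : ℕ) :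
    (Set.range fun z : Fin r → Z => ∏ i, v (z i)).ncard ≤ (r + 1) ^ Fintype.card Z := by
  -- Method of types: the product depends only on how often each letter of `Z` occurs, and each
  -- multiplicity takes at most `r + 1` values.
  have hsub : (Set.range fun z : Fin r → Z => ∏ i, v (z i)) ⊆
      (fun c : Z → Fin (r + 1) => ∏ w, v w ^ (c w : ℕ)) '' Set.univ := by
    rintro _ ⟨z, rfl⟩
    refine ⟨fun w => ⟨(Finset.univ.filter fun i => z i = w).card, ?_⟩, trivial, ?_⟩
    · have := Finset.card_filter_le (Finset.univ : Finset (Fin r)) fun i => z i = w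
      rw [Finset.card_univ, Fintype.card_fin] at this
      omega
    · change ∏ w, v w ^ (Finset.univ.filter fun i => z i = w).card = ∏ i, v (z i)
      rw [← Finset.prod_fiberwise Finset.univ z]
      refine Finset.prod_congr rfl fun w _ => ?_
      rw [Finset.prod_congr rfl fun i hi => by rw [(Finset.mem_filter.mp hi).2],
        Finset.prod_const]
  calc _ ≤ _ := Set.ncard_le_ncard hsub (Set.toFinite _)
    _ ≤ _ := Set.ncard_image_le (Set.toFinite _)
    _ = _ := by rw [Set.ncard_univ, Nat.card_eq_fintype_card, Fintype.card_fun, Fintype.card_fin]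

variable {X Y B J : Type*} [Fintype X] [DecidableEq X] [Fintype Y] [DecidableEq Y]
  [Fintype B] [DecidableEq B] [Fintype J] [DecidableEq J] {r k m : ℕ}

theorem CQ.prod_numEigenvalues_margA_le (h : r * k = m) (e : Y ≃ (Fin r → X))
    {τ : J → CQ X (Fin k → B)} (hτ : ∀ j, (τ j).IsState) (c : Fin r → J) :
    numEigenvalues (CQ.prod h e fun i => τ (c i)).margA ≤
      (r + 1) ^ Fintype.card (J × (Fin k → B)) := by
  choose U d hU hd hs using fun j => exists_conjDiag_nonneg (hτ j).margA_isDensity.posSemidef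
  rw [CQ.prod_margA, funext fun i => hs (c i), blockTensor_conjDiag]
  refine (numEigenvalues_conjDiag_le (blockTensor_isometry h fun i => hU (c i)) _ (Set.finite_range
    fun z : Fin r → J × (Fin k → B) => ∏ i, d (z i).1 (z i).2) fun x => ?_).trans
      (ncard_range_prod_le (fun z : J × (Fin k → B) => d z.1 z.2) r)
  exact ⟨fun i => (c i, block h x i), rfl⟩

theorem CQ.margX_kronecker_conjDiag (σ : CQ Y B) {U : Matrix B B ℂ} {d : B → ℝ}
    (hσ : σ.margA = conjDiag U d) :
    σ.margX ⊗ₖ σ.margA = conjDiag (blockDiag fun _ : Y => U) fun p => σ.prob p.1 * d p.2 := by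
  rw [CQ.margX_kronecker_margA, hσ, ← blockDiag_conjDiag _ fun (y : Y) (b : B) => σ.prob y * d b]
  congr 1
  ext y a b
  simp only [Matrix.smul_apply, conjDiag_apply, smul_eq_mul, Finset.mul_sum]
  refine Finset.sum_congr rfl fun l _ => ?_
  push_cast
  ring

theorem CQ.prod_numEigenvalues_joint_le (h : r * k = m) (e : Y ≃ (Fin r → X))
    {τ : J → CQ X (Fin k → B)} (hτ : ∀ j, (τ j).IsState) (c : Fin r → J) :
    numEigenvalues ((CQ.prod h e fun i => τ (c i)).margX ⊗ₖ
      (CQ.prod h e fun i => τ (c i)).margA) ≤ (r + 1) ^ Fintype.card (J × X × (Fin k → B)) := by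
  choose U d hU hd hs using fun j => exists_conjDiag_nonneg (hτ j).margA_isDensity.posSemidef
  have hT : (blockTensor h fun i => U (c i))ᴴ * (blockTensor h fun i => U (c i)) = 1 :=
    blockTensor_isometry h fun i => hU (c i)
  have hI : (blockDiag fun _ : Y => blockTensor h fun i => U (c i))ᴴ *
      (blockDiag fun _ : Y => blockTensor h fun i => U (c i)) = 1 := by
    rw [conjTranspose_blockDiag, blockDiag_mul]
    simp only [hT, blockDiag_one]
  have key : (CQ.prod h e fun i => τ (c i)).margA =
      conjDiag (blockTensor h fun i => U (c i)) fun b => ∏ i, d (c i) (block h b i) := by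
    rw [CQ.prod_margA, funext fun i => hs (c i), blockTensor_conjDiag]
  rw [CQ.margX_kronecker_conjDiag _ key]
  refine (numEigenvalues_conjDiag_le hI _ (Set.finite_range
    fun z : Fin r → J × X × (Fin k → B) => ∏ i, ((τ (z i).1).prob (z i).2.1 *
      d (z i).1 (z i).2.2)) fun p => ?_).trans (ncard_range_prod_le
      (fun z : J × X × (Fin k → B) => (τ z.1).prob z.2.1 * d z.1 z.2.2) r)
  refine ⟨fun i => (c i, e p.1 i, block h p.2 i), ?_⟩
  simp only [Finset.prod_mul_distrib, CQ.prod]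

end Eigenvalues

/-! ### Operator inequalities for measurements. -/

section OperatorInequalities

variable {n : Type*} [Fintype n] [DecidableEq n]

open scoped Matrix.Norms.L2Operator in
theorem le_of_mul_self_le {S R : Matrix n n ℂ} (hS : S.PosSemidef) (hR : R.PosSemidef)
    (h : S * S ≤ R * R) : S ≤ R := by
  have := CFC.sqrt_le_sqrt _ _ h
  rwa [CFC.sqrt_mul_self S hS.nonneg, CFC.sqrt_mul_self R hR.nonneg] at this

theorem conj_nonneg {T D : Matrix n n ℂ} (hT : 0 ≤ T) (hD : D.IsHermitian) : 0 ≤ D * T * D := by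
  have := (hT.posSemidef.mul_mul_conjTranspose_same D).nonneg
  rwa [hD.eq] at this

theorem conj_mono {S T D : Matrix n n ℂ} (h : S ≤ T) (hD : D.IsHermitian) :
    D * S * D ≤ D * T * D := by
  have := conj_nonneg (sub_nonneg.mpr h) hD
  rwa [mul_sub, sub_mul, sub_nonneg] at this

/-- The difference is `S * (1 - S) * S + (1 - S) * S * (1 - S)`. -/
theorem mul_self_le_self {S : Matrix n n ℂ} (h0 : 0 ≤ S) (h1 : S ≤ 1) : S * S ≤ S := by
  have hS : S.IsHermitian := h0.posSemidef.1
  have hS' : (1 - S).IsHermitian := (Matrix.le_iff.mp h1).1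
  have := add_nonneg (conj_nonneg (sub_nonneg.mpr h1) hS) (conj_nonneg h0 hS')
  rw [← sub_nonneg]
  convert this using 1
  noncomm_ring

/-- The difference of the two sides is `(1 - D) * T * (1 - D)`. -/
theorem conj_one_add_le {T D : Matrix n n ℂ} (hT : 0 ≤ T) (hD : D.IsHermitian) :
    (1 + D) * T * (1 + D) ≤ 2 • T + 2 • (D * T * D) := by
  have := conj_nonneg hT ((isHermitian_one (n := n) (α := ℂ)).sub hD)
  rw [← sub_nonneg]
  convert this using 1
  noncomm_ring

/-- The Hayashi–Nagaoka measurement for a family of tests. -/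
theorem exists_povm_of_tests {C : Type*} [Fintype C] [DecidableEq C] [Nonempty C]
    {S : C → Matrix n n ℂ} (h0 : ∀ c, 0 ≤ S c) (h1 : ∀ c, S c ≤ 1) {η : ℝ} (hη : 0 < η) :
    ∃ Γ : C → Matrix n n ℂ, IsPOVM Γ ∧ ∀ c,
      1 - Γ c ≤ 2 • (1 - S c) + 4 • (∑ c', S c' + η • 1 - S c) := by
  -- The multiple of the identity makes `W` invertible, at the price of `η` in the error; its share
  -- of the resolution of the identity is given to one arbitrary outcome.
  set W : Matrix n n ℂ := ∑ c, S c + η • 1 with hW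
  have hη1 : (η • (1 : Matrix n n ℂ)).PosDef := PosDef.one.smul hη
  have hS0 : (∑ c, S c).PosSemidef := posSemidef_sum _ fun c _ => (h0 c).posSemidef
  have hWp : W.PosDef := hη1.posSemidef_add hS0
  obtain ⟨U, d, hU, hd, hWd⟩ : ∃ (U : Matrix n n ℂ) (d : n → ℝ), Uᴴ * U = 1 ∧ (∀ i, 0 < d i) ∧
      W = conjDiag U d := by
    refine ⟨hWp.1.eigenvectorUnitary, hWp.1.eigenvalues, ?_, hWp.eigenvalues_pos, ?_⟩
    · simpa [star_eq_conjTranspose] using Unitary.coe_star_mul_self hWp.1.eigenvectorUnitary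
    · conv_lhs => rw [hWp.1.spectral_theorem]
      rfl
  set R := conjDiag U fun i => √(d i) with hR
  set Q := conjDiag U fun i => (√(d i))⁻¹ with hQ
  have hsq : ∀ i, √(d i) ≠ 0 := fun i => (Real.sqrt_pos.mpr (hd i)).ne'
  have hRR : R * R = W := by
    rw [hR, conjDiag_mul hU, hWd]
    congr 1
    ext i
    exact Real.mul_self_sqrt (hd i).le
  have hQR : Q * R = 1 := by
    rw [hQ, hR, conjDiag_mul hU, ← conjDiag_one hU]
    congr 1
    ext i
    exact inv_mul_cancel₀ (hsq i)
  have hRQ : R * Q = 1 := mul_eq_one_comm.mp hQR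
  have hRp : R.PosSemidef := conjDiag_posSemidef U fun i => Real.sqrt_nonneg _
  have hQp : Q.PosSemidef := conjDiag_posSemidef U fun i => inv_nonneg.mpr (Real.sqrt_nonneg _)
  have hQWQ : Q * W * Q = 1 := by
    rw [← hRR, ← Matrix.mul_assoc, hQR, Matrix.one_mul, hRQ]
  have hrest : 0 ≤ Q * (η • 1) * Q := conj_nonneg hη1.posSemidef.nonneg hQp.1
  obtain ⟨c₀⟩ := ‹Nonempty C›
  refine ⟨fun c => Q * S c * Q + if c = c₀ then Q * (η • 1) * Q else 0, ⟨fun c => ?_, ?_⟩,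
    fun c => ?_⟩
  · refine ((conj_nonneg (h0 c) hQp.1).posSemidef).add ?_
    split_ifs
    · exact hrest.posSemidef
    · exact PosSemidef.zero
  · rw [Finset.sum_add_distrib, Finset.sum_ite_eq' Finset.univ c₀, if_pos (Finset.mem_univ _),
      ← Finset.sum_mul, ← Finset.mul_sum, ← add_mul, ← mul_add, ← hW, hQWQ]
  · have hle : 1 - (Q * S c * Q + if c = c₀ then Q * (η • 1) * Q else 0) ≤
        Q * (W - S c) * Q := by
      rw [mul_sub, sub_mul, hQWQ]
      refine sub_le_sub_left (le_add_of_nonneg_right ?_) _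
      split_ifs
      · exact hrest
      · exact le_rfl
    refine hle.trans ?_
    have hSW : S c ≤ W := by
      rw [hW]
      refine le_add_of_le_of_nonneg ?_ hη1.posSemidef.nonneg
      exact Finset.single_le_sum (f := S) (fun c _ => h0 c) (Finset.mem_univ c)
    have hT : 0 ≤ W - S c := sub_nonneg.mpr hSW
    -- `S² ≤ S ≤ W = R²` and operator monotonicity of the square root.
    have hSR : S c ≤ R := le_of_mul_self_le (h0 c).posSemidef hRp
      (by rw [hRR]; exact (mul_self_le_self (h0 c) (h1 c)).trans hSW)
    have hD : (Q - 1).IsHermitian := hQp.1.sub isHermitian_one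
    -- Expanding `Q = 1 + (Q - 1)` around the identity leaves `(Q - 1) * W * (Q - 1) = 1 - 2 R + W`,
    -- where `R` may be replaced by the smaller `S c`.
    have e1 := conj_one_add_le hT hD
    have e2 : (Q - 1) * (W - S c) * (Q - 1) ≤ (Q - 1) * W * (Q - 1) :=
      conj_mono (sub_le_self _ (h0 c)) hD
    have e3 : (Q - 1) * W * (Q - 1) = 1 - 2 • R + W := by
      have a1 : Q * W = R := by rw [← hRR, ← Matrix.mul_assoc, hQR, Matrix.one_mul]
      have a2 : W * Q = R := by rw [← hRR, Matrix.mul_assoc, hRQ, Matrix.mul_one]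
      rw [sub_mul, sub_mul, mul_sub, mul_sub, hQWQ, a1, Matrix.one_mul, a2]
      noncomm_ring
    rw [add_sub_cancel] at e1
    calc Q * (W - S c) * Q ≤ _ := e1
      _ ≤ 2 • (W - S c) + 2 • (1 - 2 • S c + W) := by
          gcongr
          refine e2.trans (e3.le.trans ?_)
          gcongr
      _ = _ := by noncomm_ring

/-- Decoding with a second measurement after a gentle first one. -/
theorem one_sub_conj_le {R P : Matrix n n ℂ} (hR : R.PosSemidef) (hR1 : R * R ≤ 1) (hP0 : 0 ≤ P)
    (hP1 : P ≤ 1) : 1 - R * P * R ≤ 3 • (1 - R * R) + 2 • (1 - P) := by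
  have hR1' : R ≤ 1 := le_of_mul_self_le hR PosSemidef.one (by rwa [mul_one])
  have hRR : R * R ≤ R := mul_self_le_self hR.nonneg hR1'
  have hD : (R - 1).IsHermitian := hR.1.sub isHermitian_one
  have e1 := conj_one_add_le (sub_nonneg.mpr hP1) hD
  have e2 := conj_mono (sub_le_self 1 hP0) hD
  rw [add_sub_cancel] at e1
  -- The difference is twice `R - R * R`, which is nonnegative for a contraction.
  have e3 : (R - 1) * 1 * (R - 1) ≤ 1 - R * R := by
    have := sub_nonneg.mpr hRR
    rw [← sub_nonneg]
    have h2 := add_nonneg this this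
    convert h2 using 1
    noncomm_ring
  calc 1 - R * P * R = 1 - R * R + R * (1 - P) * R := by noncomm_ring
    _ ≤ 1 - R * R + (2 • (1 - P) + 2 • (1 - R * R)) := by
        gcongr
        refine e1.trans ?_
        gcongr
        exact e2.trans e3
    _ = _ := by noncomm_ring

theorem exists_sqrt {Λ : Matrix n n ℂ} (h : Λ.PosSemidef) :
    ∃ R : Matrix n n ℂ, R.PosSemidef ∧ R * R = Λ := by
  obtain ⟨U, d, hU, hd, rfl⟩ := exists_conjDiag_nonneg h
  refine ⟨conjDiag U fun i => √(d i), conjDiag_posSemidef U fun i => Real.sqrt_nonneg _, ?_⟩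
  rw [conjDiag_mul hU]
  congr 1
  ext i
  exact Real.mul_self_sqrt (hd i)

theorem IsPOVM.le_one {W : Type*} [Fintype W] {Λ : W → Matrix n n ℂ} (h : IsPOVM Λ) (w : W) :
    Λ w ≤ 1 := by
  rw [← h.sum_eq_one]
  exact Finset.single_le_sum (f := Λ) (fun w _ => (h.posSemidef w).nonneg) (Finset.mem_univ w)

end OperatorInequalities

/-! ### Spectral truncation and the packing test. -/

section Truncation

variable {n : Type*} [Fintype n] [DecidableEq n] {ρ : Matrix n n ℂ}

/-- The weight of the eigenvalues of `ρ` above `u`. -/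
noncomputable def tailGt (ρ : Matrix n n ℂ) (u : ℝ) : ℝ :=
  (cfc (fun t : ℝ => if u < t then t else 0) ρ).trace.re

/-- The weight of the eigenvalues of `ρ` below `v`. -/
noncomputable def tailLt (ρ : Matrix n n ℂ) (v : ℝ) : ℝ :=
  (cfc (fun t : ℝ => if t < v then t else 0) ρ).trace.re

theorem trace_cfc_mono (hρ : ρ.PosSemidef) {f g : ℝ → ℝ} (h : ∀ x, 0 ≤ x → f x ≤ g x) :
    (cfc f ρ).trace.re ≤ (cfc g ρ).trace.re := trace_re_mono (cfc_mono_posSemidef hρ h)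

theorem trace_cfc_const_mul (c : ℝ) (f : ℝ → ℝ) (ρ : Matrix n n ℂ) :
    (cfc (fun x => c * f x) ρ).trace.re = c * (cfc f ρ).trace.re := by
  rw [cfc_const_mul c f ρ (continuousOn_spectrum _ _), trace_smul, Complex.smul_re, smul_eq_mul]

/-- Markov's inequality for the eigenvalue distribution: `1 ≤ (x / u) ^ s` above the threshold. -/
theorem tailGt_le (hρ : ρ.PosSemidef) {u s : ℝ} (hu : 0 < u) (hs : 0 ≤ s) :
    tailGt ρ u ≤ u ^ (-s) * (suppPow ρ (1 + s)).trace.re := by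
  unfold tailGt suppPow
  rw [← trace_cfc_const_mul]
  refine trace_cfc_mono hρ fun x hx => ?_
  rcases hx.eq_or_lt with rfl | hx
  · simp
  rw [if_neg hx.ne', Real.rpow_add hx, Real.rpow_one]
  split_ifs with h
  · have : 1 ≤ u ^ (-s) * x ^ s := by
      rw [Real.rpow_neg hu.le, ← Real.inv_rpow hu.le, ← Real.mul_rpow (by positivity) hx.le]
      refine Real.one_le_rpow ?_ hs
      rw [inv_mul_eq_div, one_le_div hu]
      exact h.le
    nlinarith
  · positivity

theorem tailLt_le (hρ : ρ.PosSemidef) {v s : ℝ} (hv : 0 < v) (hs : 0 ≤ s) :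
    tailLt ρ v ≤ v ^ s * (suppPow ρ (1 + -s)).trace.re := by
  unfold tailLt suppPow
  rw [← trace_cfc_const_mul]
  refine trace_cfc_mono hρ fun x hx => ?_
  rcases hx.eq_or_lt with rfl | hx
  · simp
  rw [if_neg hx.ne', Real.rpow_add hx, Real.rpow_one]
  split_ifs with h
  · have : 1 ≤ v ^ s * x ^ (-s) := by
      rw [Real.rpow_neg hx.le, ← Real.inv_rpow hx.le, ← Real.mul_rpow hv.le (by positivity)]
      refine Real.one_le_rpow ?_ hs
      rw [← div_eq_mul_inv, one_le_div hx]
      exact h.le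
    nlinarith
  · positivity

theorem cfc_mul_self (hρ : ρ.IsHermitian) (f : ℝ → ℝ) :
    cfc f ρ * ρ = cfc (fun x => f x * x) ρ := by
  have h : cfc (fun x : ℝ => x) ρ = ρ := cfc_id' ℝ ρ hρ
  rw [← cfc_mul_cfc, h]

/-- The projection on the eigenvalues satisfying `p`. -/
noncomputable def specProj (ρ : Matrix n n ℂ) (p : Set ℝ) : Matrix n n ℂ :=
  open Classical in cfc (fun t : ℝ => if t ∈ p then 1 else 0) ρ

theorem specProj_isHermitian (ρ : Matrix n n ℂ) (p : Set ℝ) : (specProj ρ p).IsHermitian :=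
  cfc_isHermitian _ _

theorem specProj_mul_self (ρ : Matrix n n ℂ) (p : Set ℝ) :
    specProj ρ p * specProj ρ p = specProj ρ p := by
  unfold specProj
  rw [cfc_mul_cfc]
  congr 1
  ext x
  split_ifs <;> simp

theorem specProj_nonneg (ρ : Matrix n n ℂ) (p : Set ℝ) : 0 ≤ specProj ρ p := by
  have := (posSemidef_conjTranspose_mul_self (specProj ρ p)).nonneg
  rwa [(specProj_isHermitian ρ p).eq, specProj_mul_self] at this

theorem one_sub_specProj (hρ : ρ.IsHermitian) (p : Set ℝ) :
    1 - specProj ρ p = specProj ρ pᶜ := by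
  unfold specProj
  rw [← cfc_const_one' hρ, ← cfc_sub _ _ ρ (continuousOn_spectrum _ _) (continuousOn_spectrum _ _)]
  congr 1
  ext x
  by_cases h : x ∈ p <;> simp [h]

theorem specProj_le_one (hρ : ρ.IsHermitian) (p : Set ℝ) : specProj ρ p ≤ 1 := by
  rw [← sub_nonneg, one_sub_specProj hρ]
  exact specProj_nonneg _ _

theorem trace_specProj_Ioi_mul (hρ : ρ.IsHermitian) (u : ℝ) :
    (specProj ρ (Set.Ioi u) * ρ).trace.re = tailGt ρ u := by
  unfold specProj tailGt
  rw [cfc_mul_self hρ]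
  congr 3
  ext x
  simp

theorem trace_specProj_Iio_mul (hρ : ρ.IsHermitian) (u : ℝ) :
    (specProj ρ (Set.Iio u) * ρ).trace.re = tailLt ρ u := by
  unfold specProj tailLt
  rw [cfc_mul_self hρ]
  congr 3
  ext x
  simp

theorem specProj_Ici_le (hρ : ρ.PosSemidef) {v : ℝ} (hv : 0 < v) :
    specProj ρ (Set.Ici v) ≤ v⁻¹ • ρ := by
  have : v⁻¹ • ρ = cfc (fun x : ℝ => v⁻¹ * x) ρ := (cfc_const_mul_id v⁻¹ ρ hρ.1).symm
  rw [this]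
  refine cfc_mono_posSemidef hρ fun x hx => ?_
  simp only [Set.mem_Ici]
  split_ifs with h
  · rw [inv_mul_eq_div, one_le_div hv]; exact h
  · positivity

theorem trace_specProj_Ici_le (hρ : IsDensity ρ) {v : ℝ} (hv : 0 < v) :
    (specProj ρ (Set.Ici v)).trace.re ≤ v⁻¹ := by
  have := trace_re_mono (specProj_Ici_le hρ.posSemidef hv)
  rwa [trace_smul, hρ.trace_eq_one, Complex.smul_re, Complex.one_re, smul_eq_mul, mul_one] at this

theorem specProj_Iic_conj_le (hρ : ρ.PosSemidef) {u : ℝ} (hu : 0 ≤ u) :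
    specProj ρ (Set.Iic u) * ρ * specProj ρ (Set.Iic u) ≤ u • 1 := by
  unfold specProj
  rw [cfc_mul_self hρ.1, cfc_mul_cfc]
  have : u • (1 : Matrix n n ℂ) = cfc (fun _ : ℝ => u) ρ := by
    rw [← Algebra.algebraMap_eq_smul_one]
    exact (cfc_const u ρ hρ.1).symm
  rw [this]
  refine cfc_mono_posSemidef hρ fun x hx => ?_
  simp only [Set.mem_Iic]
  split_ifs with h
  · simpa using h
  · simpa using hu

/-- The test `Π Π' Π` with the spectral projections `Π` of `τ` and `Π'` of `ρ`. -/
noncomputable def packingTest (τ ρ : Matrix n n ℂ) (u v : ℝ) : Matrix n n ℂ :=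
  specProj τ (Set.Iic u) * specProj ρ (Set.Ici v) * specProj τ (Set.Iic u)

variable {τ : Matrix n n ℂ}

theorem packingTest_nonneg (u v : ℝ) : 0 ≤ packingTest τ ρ u v :=
  conj_nonneg (specProj_nonneg _ _) (specProj_isHermitian _ _)

theorem one_sub_packingTest_le (hρ : ρ.IsHermitian) (hτ : τ.IsHermitian) (u v : ℝ) :
    1 - packingTest τ ρ u v ≤ 3 • specProj τ (Set.Ioi u) + 2 • specProj ρ (Set.Iio v) := by
  have := one_sub_conj_le (specProj_nonneg τ (Set.Iic u)).posSemidef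
    (by rw [specProj_mul_self]; exact specProj_le_one hτ _) (specProj_nonneg ρ (Set.Ici v))
    (specProj_le_one hρ _)
  rwa [specProj_mul_self, one_sub_specProj hτ, one_sub_specProj hρ, Set.compl_Iic,
    Set.compl_Ici] at this

theorem packingTest_le_one (hρ : ρ.IsHermitian) (hτ : τ.IsHermitian) (u v : ℝ) :
    packingTest τ ρ u v ≤ 1 := by
  refine (conj_mono (specProj_le_one hρ _) (specProj_isHermitian _ _)).trans ?_
  rw [mul_one, specProj_mul_self]
  exact specProj_le_one hτ _

/-- The compressed `τ` is at most `u`, and at most `v⁻¹` eigenvalues of `ρ` reach `v`. This bounds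
the probability of confusing two independent codewords. -/
theorem trace_packingTest_mul_le (hρ : IsDensity ρ) (hτ : τ.PosSemidef) {u v : ℝ} (hu : 0 ≤ u)
    (hv : 0 < v) : (packingTest τ ρ u v * τ).trace.re ≤ u / v := by
  unfold packingTest
  have e : (specProj τ (Set.Iic u) * specProj ρ (Set.Ici v) * specProj τ (Set.Iic u) * τ).trace =
      (specProj τ (Set.Iic u) * τ * specProj τ (Set.Iic u) * specProj ρ (Set.Ici v)).trace := by
    rw [Matrix.mul_assoc, Matrix.trace_mul_comm]
    simp only [Matrix.mul_assoc]
  rw [e]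
  have := trace_mul_re_mono (specProj_Iic_conj_le hτ hu)
    (specProj_nonneg ρ (Set.Ici v)).posSemidef
  rw [Matrix.smul_mul, Matrix.one_mul, trace_smul, Complex.smul_re, smul_eq_mul] at this
  refine this.trans ?_
  rw [div_eq_mul_inv]
  exact mul_le_mul_of_nonneg_left (trace_specProj_Ici_le hρ hv) hu

end Truncation

/-! ### Expectations over independent codewords. -/

section Expectation

variable {Y ι : Type*} [Fintype Y] [DecidableEq Y] [Fintype ι] [DecidableEq ι]

/-- Expectation over independent, identically distributed codewords. -/
def expect (p : Y → ℝ) (F : (ι → Y) → ℝ) : ℝ := ∑ x : ι → Y, (∏ i, p (x i)) * F x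

variable {p : Y → ℝ}

theorem expect_add (F G : (ι → Y) → ℝ) :
    expect p (fun x => F x + G x) = expect p F + expect p G := by
  simp [expect, mul_add, Finset.sum_add_distrib]

theorem expect_const_mul (c : ℝ) (F : (ι → Y) → ℝ) :
    expect p (fun x => c * F x) = c * expect p F := by
  simp only [expect, Finset.mul_sum]
  exact Finset.sum_congr rfl fun x _ => by ring

theorem expect_sum {κ : Type*} (s : Finset κ) (F : κ → (ι → Y) → ℝ) :
    expect p (fun x => ∑ j ∈ s, F j x) = ∑ j ∈ s, expect p (F j) := by
  simp only [expect, Finset.mul_sum]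
  exact Finset.sum_comm

theorem expect_prod (f : ι → Y → ℝ) :
    expect p (fun x => ∏ i, f i (x i)) = ∏ i, ∑ y, p y * f i y := by
  simp only [expect, Fintype.prod_sum, Finset.prod_mul_distrib]

theorem expect_const (hp : ∑ y, p y = 1) (c : ℝ) : expect p (fun _ : ι → Y => c) = c := by
  have := expect_prod (p := p) (ι := ι) fun _ _ => 1
  simp only [Finset.prod_const_one, mul_one, hp] at this
  calc _ = expect p (fun _ : ι → Y => c * 1) := by simp
    _ = _ := by rw [expect_const_mul, this, mul_one]

theorem expect_pair (hp : ∑ y, p y = 1) {i j : ι} (hij : i ≠ j) (g : Y → Y → ℝ) :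
    expect p (fun x : ι → Y => g (x i) (x j)) = ∑ y, ∑ z, p y * p z * g y z := by
  -- Indicators of single letters factor over coordinates, and they span all functions of two
  -- codewords.
  have key : ∀ a b : Y, expect p (fun x : ι → Y => (if x i = a then 1 else 0) *
      if x j = b then 1 else 0) = p a * p b := by
    intro a b
    have := expect_prod (p := p) (ι := ι) fun t y =>
      (if t = i then (if y = a then 1 else 0) else 1) * if t = j then (if y = b then 1 else 0) else 1
    simp only [Finset.prod_mul_distrib, Finset.prod_ite_eq', Finset.mem_univ, if_true] at this
    rw [this, ← Finset.mul_prod_erase _ _ (Finset.mem_univ i),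
      ← Finset.mul_prod_erase _ _ (Finset.mem_erase.mpr ⟨hij.symm, Finset.mem_univ j⟩),
      Finset.prod_eq_one]
    · simp [hij, hij.symm]
    · intro t ht
      rw [Finset.mem_erase, Finset.mem_erase] at ht
      simp [ht.1, ht.2.1, hp]
  have e : (fun x : ι → Y => g (x i) (x j)) = fun x => ∑ a, ∑ b,
      g a b * ((if x i = a then 1 else 0) * if x j = b then 1 else 0) := by
    ext x
    simp
  rw [e, expect_sum]
  refine Finset.sum_congr rfl fun a _ => ?_
  rw [expect_sum]
  refine Finset.sum_congr rfl fun b _ => ?_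
  rw [expect_const_mul, key]
  ring

theorem expect_single (hp : ∑ y, p y = 1) (i : ι) (g : Y → ℝ) :
    expect p (fun x : ι → Y => g (x i)) = ∑ y, p y * g y := by
  have key : ∀ a : Y, expect p (fun x : ι → Y => (if x i = a then 1 else 0)) = p a := by
    intro a
    have := expect_prod (p := p) (ι := ι) fun t y =>
      (if t = i then (if y = a then 1 else 0) else 1)
    simp only [Finset.prod_ite_eq', Finset.mem_univ, if_true] at this
    rw [this, ← Finset.mul_prod_erase _ _ (Finset.mem_univ i), Finset.prod_eq_one]
    · simp
    · intro t ht
      rw [Finset.mem_erase] at ht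
      simp [ht.1, hp]
  have e : (fun x : ι → Y => g (x i)) = fun x => ∑ a, g a * (if x i = a then 1 else 0) := by
    ext x
    simp
  rw [e, expect_sum]
  refine Finset.sum_congr rfl fun a _ => ?_
  rw [expect_const_mul, key]
  ring

theorem exists_lt_of_expect_lt (hp0 : ∀ y, 0 ≤ p y) (hp : ∑ y, p y = 1) {F : (ι → Y) → ℝ} {c : ℝ}
    (h : expect p F < c) : ∃ x, F x < c := by
  by_contra! hc
  have : expect p (fun _ : ι → Y => c) ≤ expect p F :=
    Finset.sum_le_sum fun x _ =>
      mul_le_mul_of_nonneg_left (hc x) (Finset.prod_nonneg fun i _ => hp0 _)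
  rw [expect_const hp] at this
  linarith

end Expectation

/-! ### Trace distance bounds by truncation and second moments. -/

section Covering

variable {n : Type*} [Fintype n] [DecidableEq n]

theorem trace_conjTranspose_re (X : Matrix n n ℂ) : Xᴴ.trace.re = X.trace.re := by
  rw [trace_conjTranspose]; simp

/-- Cauchy–Schwarz with a free weight `θ`, obtained by expanding the nonnegative trace of `ω`
conjugated by `E - θ V`. The weighted form avoids square roots, so expectations can be taken
directly. -/
theorem trace_mul_proj_le {V ω E : Matrix n n ℂ} (hV : V.IsHermitian) (hVV : V * V = 1)
    (hω : ω.PosSemidef) (hE : E.IsHermitian) (hEE : E * E = E) {θ : ℝ} (hθ : 0 < θ) :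
    (V * ω * E).trace.re ≤ θ / 2 * ω.trace.re + 1 / (2 * θ) * (E * ω).trace.re := by
  have h := trace_re_nonneg (hω.mul_mul_conjTranspose_same (E - (θ : ℂ) • V))
  have hs : (E - (θ : ℂ) • V)ᴴ = E - (θ : ℂ) • V := by
    rw [conjTranspose_sub, conjTranspose_smul, hE.eq, hV.eq]; simp
  rw [hs, sub_mul, sub_mul, mul_sub, mul_sub, Matrix.smul_mul, Matrix.smul_mul, Matrix.smul_mul,
    Matrix.mul_smul, Matrix.mul_smul] at h
  have t1 : (E * ω * E).trace = (E * ω).trace := by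
    rw [Matrix.trace_mul_comm, ← Matrix.mul_assoc, hEE]
  have t2 : (V * ω * V).trace = ω.trace := by
    rw [Matrix.trace_mul_comm, ← Matrix.mul_assoc, hVV, Matrix.one_mul]
  have t3 : (E * ω * V).trace.re = (V * ω * E).trace.re := by
    rw [← trace_conjTranspose_re, conjTranspose_mul, conjTranspose_mul, hE.eq, hV.eq, hω.1.eq,
      Matrix.mul_assoc]
  simp only [trace_sub, trace_smul, smul_eq_mul, Complex.sub_re, Complex.re_ofReal_mul, t1, t2,
    t3] at h
  rw [← sub_nonneg]
  have : θ / 2 * ω.trace.re + 1 / (2 * θ) * (E * ω).trace.re - (V * ω * E).trace.re =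
      1 / (2 * θ) * ((E * ω).trace.re - θ * (V * ω * E).trace.re -
        (θ * (V * ω * E).trace.re - θ * (θ * ω.trace.re))) := by
    field_simp
    ring
  rw [this]
  exact mul_nonneg (by positivity) h

theorem trace_mul_proj_le_sq {V X P : Matrix n n ℂ} (hV : V.IsHermitian) (hVV : V * V = 1)
    (hX : X.IsHermitian) (hP : P.IsHermitian) (hPP : P * P = P) {θ : ℝ} (hθ : 0 < θ) :
    (V * X * P).trace.re ≤ θ / 2 * P.trace.re + 1 / (2 * θ) * (X * X).trace.re := by
  have h := trace_re_nonneg (posSemidef_self_mul_conjTranspose (X - (θ : ℂ) • (P * V)))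
  have hs : (X - (θ : ℂ) • (P * V))ᴴ = X - (θ : ℂ) • (V * P) := by
    rw [conjTranspose_sub, conjTranspose_smul, conjTranspose_mul, hX.eq, hP.eq, hV.eq]; simp
  rw [hs, sub_mul, mul_sub, mul_sub, Matrix.smul_mul, Matrix.smul_mul,
    Matrix.mul_smul, Matrix.mul_smul] at h
  have t1 : (P * V * (V * P)).trace = P.trace := by
    rw [Matrix.mul_assoc, ← Matrix.mul_assoc V, hVV, Matrix.one_mul, hPP]
  have t2 : (P * V * X).trace = (V * X * P).trace := by
    rw [Matrix.mul_assoc, Matrix.trace_mul_comm]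
  have t3 : (X * (V * P)).trace.re = (V * X * P).trace.re := by
    rw [← t2, ← trace_conjTranspose_re, conjTranspose_mul, conjTranspose_mul, hP.eq, hV.eq, hX.eq]
  simp only [trace_sub, trace_smul, smul_eq_mul, Complex.sub_re, Complex.re_ofReal_mul, t1, t2,
    t3] at h
  rw [← sub_nonneg]
  have : θ / 2 * P.trace.re + 1 / (2 * θ) * (X * X).trace.re - (V * X * P).trace.re =
      1 / (2 * θ) * ((X * X).trace.re - θ * (V * X * P).trace.re -
        (θ * (V * X * P).trace.re - θ * (θ * P.trace.re))) := by
    field_simp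
    ring
  rw [this]
  exact mul_nonneg (by positivity) h

theorem trace_mul_unitary_le {V ω : Matrix n n ℂ} (hV : V.IsHermitian) (hVV : V * V = 1)
    (hω : ω.PosSemidef) : (V * ω).trace.re ≤ ω.trace.re := by
  simpa using trace_mul_re_mono (isHermitian_unitary_bounds hV hVV).2 hω

/-- Trace distance bound by truncation and a second moment. -/
theorem traceNorm_sub_le_of_truncation {ω ω' τ m P : Matrix n n ℂ} (hω : (ω - ω').PosSemidef)
    (hω' : ω'.PosSemidef) (hτ : (τ - m).PosSemidef) (hm : m.PosSemidef) (hP : P.IsHermitian)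
    (hPP : P * P = P) {κ θ : ℝ} (hκ : 0 < κ) (hθ : 0 < θ) :
    traceNorm (ω - τ) ≤ (ω - ω').trace.re + (τ - m).trace.re + κ / 2 * P.trace.re +
      1 / (2 * κ) * ((ω' - m) * (ω' - m)).trace.re + θ / 2 * (ω'.trace.re + m.trace.re) +
      1 / (2 * θ) * (((1 - P) * ω').trace.re + ((1 - P) * m).trace.re) := by
  have hX : (ω - τ).IsHermitian := by
    have := ((hω.1.add hω'.1).sub (hτ.1.add hm.1))
    simpa using this
  obtain ⟨V, hV, hVV, h⟩ := exists_traceNorm_eq hX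
  have hE : (1 - P).IsHermitian := isHermitian_one.sub hP
  have hEE : (1 - P) * (1 - P) = 1 - P := by
    rw [sub_mul, mul_sub, mul_sub, hPP]; simp
  have hV' : (-V).IsHermitian := hV.neg
  have hVV' : -V * -V = 1 := by rw [neg_mul_neg, hVV]
  -- The errors are separated: truncation of `ω`, truncation of `τ`, fluctuation on the large
  -- subspace `P`, and leakage of both truncated operators out of `P`.
  have e : V * (ω - τ) = V * (ω - ω') + -V * (τ - m) + V * (ω' - m) * P + V * ω' * (1 - P) +
      -V * m * (1 - P) := by noncomm_ring
  rw [h, e]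
  simp only [trace_add, Complex.add_re]
  have b1 := trace_mul_unitary_le hV hVV hω
  have b2 := trace_mul_unitary_le hV' hVV' hτ
  have b3 := trace_mul_proj_le_sq hV hVV (hω'.1.sub hm.1) hP hPP hκ
  have b4 := trace_mul_proj_le hV hVV hω' hE hEE hθ
  have b5 := trace_mul_proj_le hV' hVV' hm hE hEE hθ
  linarith

/-- The part of `ρ` with eigenvalues at most `u`. -/
noncomputable def truncate (ρ : Matrix n n ℂ) (u : ℝ) : Matrix n n ℂ :=
  cfc (fun t : ℝ => if u < t then 0 else t) ρ

variable {ρ : Matrix n n ℂ}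

theorem truncate_posSemidef (hρ : ρ.PosSemidef) (u : ℝ) : (truncate ρ u).PosSemidef :=
  cfc_posSemidef hρ fun x hx => by split_ifs <;> simp [hx]

theorem sub_truncate (hρ : ρ.IsHermitian) (u : ℝ) :
    ρ - truncate ρ u = cfc (fun t : ℝ => if u < t then t else 0) ρ := by
  have h : cfc (fun x : ℝ => x) ρ = ρ := cfc_id' ℝ ρ hρ
  unfold truncate
  nth_rw 1 [← h]
  rw [← cfc_sub _ _ ρ (continuousOn_spectrum _ _) (continuousOn_spectrum _ _)]
  congr 1
  ext x
  split_ifs <;> simp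

theorem sub_truncate_posSemidef (hρ : ρ.PosSemidef) (u : ℝ) : (ρ - truncate ρ u).PosSemidef := by
  rw [sub_truncate hρ.1]
  exact cfc_posSemidef hρ fun x hx => by split_ifs <;> simp [hx]

theorem trace_sub_truncate (hρ : ρ.IsHermitian) (u : ℝ) :
    (ρ - truncate ρ u).trace.re = tailGt ρ u := by
  rw [sub_truncate hρ]; rfl

theorem trace_truncate_sq_le (hρ : IsDensity ρ) {u : ℝ} (hu : 0 ≤ u) :
    (truncate ρ u * truncate ρ u).trace.re ≤ u := by
  have h : (cfc (fun x : ℝ => u * x) ρ) = u • ρ := cfc_const_mul_id u ρ hρ.posSemidef.1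
  unfold truncate
  rw [cfc_mul_cfc]
  refine (trace_cfc_mono hρ.posSemidef (g := fun x => u * x) fun x hx => ?_).trans ?_
  · split_ifs with h
    · simpa using mul_nonneg hu hx
    · exact mul_le_mul_of_nonneg_right (not_lt.mp h) hx
  · rw [h, trace_smul, hρ.trace_eq_one]
    simp

end Covering

/-! ### Random codebooks: covering and packing together. -/

section RandomCoding

variable {Y n : Type*} [Fintype Y] [DecidableEq Y] [Fintype n] [DecidableEq n] {σ : CQ Y n}

theorem re_trace_sum_smul_mul {ι : Type*} (s : Finset ι) (a : ι → ℝ) (X : ι → Matrix n n ℂ)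
    (Z : Matrix n n ℂ) :
    (Z * ∑ i ∈ s, (a i : ℂ) • X i).trace.re = ∑ i ∈ s, a i * (Z * X i).trace.re := by
  rw [Finset.mul_sum, trace_sum, Complex.re_sum]
  refine Finset.sum_congr rfl fun i _ => ?_
  rw [Matrix.mul_smul, trace_smul, smul_eq_mul, Complex.re_ofReal_mul]

theorem posSemidef_sum_smul {ι : Type*} (s : Finset ι) {a : ι → ℝ} (ha : ∀ i, 0 ≤ a i)
    {X : ι → Matrix n n ℂ} (hX : ∀ i, (X i).PosSemidef) :
    (∑ i ∈ s, (a i : ℂ) • X i).PosSemidef :=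
  posSemidef_sum _ fun i _ => (hX i).smul (by exact_mod_cast ha i)

variable {ι : Type*} [Fintype ι] [DecidableEq ι] [Nonempty ι]

/-- The covering error of a codebook `x` is bounded by a quantity with a simple expectation. -/
theorem CQ.IsState.traceNorm_codebook_le (hσ : σ.IsState) (x : ι → Y) {u v θ : ℝ}
    (hv : 0 < v) (hθ : 0 < θ) :
    traceNorm (∑ i, (((Fintype.card ι : ℝ)⁻¹ : ℝ) : ℂ) • σ.state (x i) - σ.margA) ≤
      ∑ i, (Fintype.card ι : ℝ)⁻¹ * tailGt (σ.state (x i)) u +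
      ∑ y, σ.prob y * tailGt (σ.state y) u + 3 / 2 * θ +
      1 / (2 * (θ * v)) * ∑ i, ∑ j, ((Fintype.card ι : ℝ)⁻¹ * (Fintype.card ι : ℝ)⁻¹) *
        ((truncate (σ.state (x i)) u - ∑ y, (σ.prob y : ℂ) • truncate (σ.state y) u) *
         (truncate (σ.state (x j)) u - ∑ y, (σ.prob y : ℂ) • truncate (σ.state y) u)).trace.re +
      1 / (2 * θ) * (∑ i, (Fintype.card ι : ℝ)⁻¹ *
        (specProj σ.margA (Set.Iio v) * σ.state (x i)).trace.re + tailLt σ.margA v) := by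
  set q : ℝ := (Fintype.card ι : ℝ)⁻¹ with hq
  have hq0 : 0 ≤ q := by positivity
  have hcard : (Fintype.card ι : ℝ) * q = 1 := mul_inv_cancel₀ (by positivity)
  have hp := fun y => (hσ.isDensity y).posSemidef
  have hτ := hσ.margA_isDensity
  set T : Y → Matrix n n ℂ := fun y => truncate (σ.state y) u with hT
  set m := ∑ y, (σ.prob y : ℂ) • T y with hm
  set P := specProj σ.margA (Set.Ici v) with hP
  have hTp : ∀ y, (T y).PosSemidef := fun y => truncate_posSemidef (hp y) u
  have hTs : ∀ y, (σ.state y - T y).PosSemidef := fun y => sub_truncate_posSemidef (hp y) u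
  have d1 : ∑ i, (q : ℂ) • σ.state (x i) - ∑ i, (q : ℂ) • T (x i) =
      ∑ i, (q : ℂ) • (σ.state (x i) - T (x i)) := by
    rw [← Finset.sum_sub_distrib]; simp only [smul_sub]
  have d2 : σ.margA - m = ∑ y, (σ.prob y : ℂ) • (σ.state y - T y) := by
    rw [hm, CQ.margA, ← Finset.sum_sub_distrib]; simp only [smul_sub]
  have d3 : ∑ i, (q : ℂ) • T (x i) - m = ∑ i, (q : ℂ) • (T (x i) - m) := by
    simp only [smul_sub, Finset.sum_sub_distrib, Finset.sum_const, Finset.card_univ]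
    congr 1
    rw [← Nat.cast_smul_eq_nsmul ℂ, smul_smul]
    have : (Fintype.card ι : ℂ) * (q : ℂ) = 1 := by exact_mod_cast hcard
    rw [this, one_smul]
  -- The weight `κ = θ * v` is matched to `tr P ≤ v⁻¹`, so that the dimension term costs `θ / 2`.
  have key := traceNorm_sub_le_of_truncation (ω := ∑ i, (q : ℂ) • σ.state (x i))
    (ω' := ∑ i, (q : ℂ) • T (x i)) (τ := σ.margA) (m := m) (P := P)
    (by rw [d1]; exact posSemidef_sum_smul _ (fun _ => hq0) fun i => hTs _)
    (posSemidef_sum_smul _ (fun _ => hq0) fun i => hTp _)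
    (by rw [d2]; exact posSemidef_sum_smul _ hσ.prob_nonneg fun i => hTs _)
    (posSemidef_sum_smul _ hσ.prob_nonneg fun i => hTp _)
    (specProj_isHermitian _ _) (specProj_mul_self _ _) (mul_pos hθ hv) hθ
  refine key.trans ?_
  have hE : 1 - P = specProj σ.margA (Set.Iio v) := by
    rw [hP, one_sub_specProj hτ.posSemidef.1, Set.compl_Ici]
  have hE0 := (specProj_nonneg σ.margA (Set.Iio v)).posSemidef
  have tr1 : ∀ y, (T y).trace.re ≤ 1 := fun y => by
    have := trace_re_nonneg (hTs y)
    rw [trace_sub, Complex.sub_re, CQ.trace_state_re hσ] at this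
    linarith
  have tr2 : ∀ y, (specProj σ.margA (Set.Iio v) * T y).trace.re ≤
      (specProj σ.margA (Set.Iio v) * σ.state y).trace.re := fun y => by
    have := trace_mul_re_nonneg hE0 (hTs y)
    rw [mul_sub, trace_sub, Complex.sub_re] at this
    linarith
  have c1 : (∑ i, (q : ℂ) • σ.state (x i) - ∑ i, (q : ℂ) • T (x i)).trace.re =
      ∑ i, q * tailGt (σ.state (x i)) u := by
    rw [d1]
    have := re_trace_sum_smul_mul Finset.univ (fun _ => q) (fun i => σ.state (x i) - T (x i)) 1
    rw [Matrix.one_mul] at this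
    rw [this]
    exact Finset.sum_congr rfl fun i _ => by
      rw [Matrix.one_mul, trace_sub_truncate (hp _).1]
  have c2 : (σ.margA - m).trace.re = ∑ y, σ.prob y * tailGt (σ.state y) u := by
    rw [d2]
    have := re_trace_sum_smul_mul Finset.univ σ.prob (fun y => σ.state y - T y) 1
    rw [Matrix.one_mul] at this
    rw [this]
    exact Finset.sum_congr rfl fun i _ => by
      rw [Matrix.one_mul, trace_sub_truncate (hp _).1]
  have c3 : P.trace.re ≤ v⁻¹ := trace_specProj_Ici_le hτ hv
  have c4 : ((∑ i, (q : ℂ) • T (x i) - m) * (∑ i, (q : ℂ) • T (x i) - m)).trace.re =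
      ∑ i, ∑ j, (q * q) * ((T (x i) - m) * (T (x j) - m)).trace.re := by
    rw [d3, Finset.sum_mul, trace_sum, Complex.re_sum]
    refine Finset.sum_congr rfl fun i _ => ?_
    rw [re_trace_sum_smul_mul]
    refine Finset.sum_congr rfl fun j _ => ?_
    rw [Matrix.smul_mul, trace_smul, smul_eq_mul, Complex.re_ofReal_mul]
    ring
  have c5 : (∑ i, (q : ℂ) • T (x i)).trace.re ≤ 1 := by
    have := re_trace_sum_smul_mul Finset.univ (fun _ => q) (fun i => T (x i)) 1
    simp only [Matrix.one_mul] at this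
    rw [this]
    calc _ ≤ ∑ i : ι, q * 1 := Finset.sum_le_sum fun i _ => mul_le_mul_of_nonneg_left (tr1 _) hq0
      _ = 1 := by rw [Finset.sum_const, Finset.card_univ, nsmul_eq_mul, mul_one, hcard]
  have c6 : m.trace.re ≤ 1 := by
    have := re_trace_sum_smul_mul Finset.univ σ.prob T 1
    simp only [Matrix.one_mul] at this
    rw [hm, this]
    calc _ ≤ ∑ y, σ.prob y * 1 :=
          Finset.sum_le_sum fun i _ => mul_le_mul_of_nonneg_left (tr1 _) (hσ.prob_nonneg i)
      _ = 1 := by simp [hσ.prob_sum]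
  have c7 : ((1 - P) * ∑ i, (q : ℂ) • T (x i)).trace.re ≤
      ∑ i, q * (specProj σ.margA (Set.Iio v) * σ.state (x i)).trace.re := by
    rw [hE, re_trace_sum_smul_mul]
    exact Finset.sum_le_sum fun i _ => mul_le_mul_of_nonneg_left (tr2 _) hq0
  have c8 : ((1 - P) * m).trace.re ≤ tailLt σ.margA v := by
    have e : (specProj σ.margA (Set.Iio v) * σ.margA).trace.re =
        ∑ y, σ.prob y * (specProj σ.margA (Set.Iio v) * σ.state y).trace.re :=
      re_trace_sum_smul_mul Finset.univ σ.prob σ.state _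
    rw [hE, hm, re_trace_sum_smul_mul, ← trace_specProj_Iio_mul hτ.posSemidef.1, e]
    exact Finset.sum_le_sum fun i _ => mul_le_mul_of_nonneg_left (tr2 _) (hσ.prob_nonneg i)
  rw [c1, c2, c4]
  have b1 : θ * v / 2 * P.trace.re ≤ θ / 2 := by
    calc _ ≤ θ * v / 2 * v⁻¹ := by gcongr
      _ = θ / 2 := by field_simp
  have b2 : θ / 2 * ((∑ i, (q : ℂ) • T (x i)).trace.re + m.trace.re) ≤ θ / 2 * 2 :=
    mul_le_mul_of_nonneg_left (by linarith) (by positivity)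
  have b3 : 1 / (2 * θ) * (((1 - P) * ∑ i, (q : ℂ) • T (x i)).trace.re +
      ((1 - P) * m).trace.re) ≤ 1 / (2 * θ) * (∑ i, q *
        (specProj σ.margA (Set.Iio v) * σ.state (x i)).trace.re + tailLt σ.margA v) :=
    mul_le_mul_of_nonneg_left (add_le_add c7 c8) (by positivity)
  linarith

/-- The truncated states are centred at their mean, so independent pairs contribute nothing; each
diagonal term is at most `u`, because truncated eigenvalues do not exceed `u`. -/
theorem CQ.IsState.expect_second_moment_le (hσ : σ.IsState) {u : ℝ} (hu : 0 ≤ u) :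
    expect σ.prob (fun x : ι → Y => ∑ i, ∑ j,
        ((Fintype.card ι : ℝ)⁻¹ * (Fintype.card ι : ℝ)⁻¹) *
        ((truncate (σ.state (x i)) u - ∑ y, (σ.prob y : ℂ) • truncate (σ.state y) u) *
         (truncate (σ.state (x j)) u - ∑ y, (σ.prob y : ℂ) • truncate (σ.state y) u)).trace.re) ≤
      u / Fintype.card ι := by
  set q : ℝ := (Fintype.card ι : ℝ)⁻¹ with hq
  have hcard : (Fintype.card ι : ℝ) * q = 1 := mul_inv_cancel₀ (by positivity)
  set T : Y → Matrix n n ℂ := fun y => truncate (σ.state y) u with hT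
  set m := ∑ y, (σ.prob y : ℂ) • T y with hm
  have hmp : m.PosSemidef := posSemidef_sum_smul _ hσ.prob_nonneg fun y =>
    truncate_posSemidef (hσ.isDensity y).posSemidef u
  have hm' : ∀ Z, ∑ y, σ.prob y * (Z * (T y - m)).trace.re = 0 := by
    intro Z
    rw [← re_trace_sum_smul_mul]
    simp only [smul_sub, Finset.sum_sub_distrib, ← Finset.sum_smul, ← Complex.ofReal_sum,
      hσ.prob_sum, Complex.ofReal_one, one_smul]
    simp [hm]
  have diag : ∑ y, σ.prob y * ((T y - m) * (T y - m)).trace.re ≤ u := by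
    have e : ∀ y, σ.prob y * ((T y - m) * (T y - m)).trace.re =
        σ.prob y * (T y * T y).trace.re - σ.prob y * (m * (T y - m)).trace.re -
          σ.prob y * (m * T y).trace.re := by
      intro y
      rw [sub_mul, mul_sub, trace_sub, trace_sub, Matrix.trace_mul_comm (T y) m]
      simp only [Complex.sub_re]
      ring
    simp only [e, Finset.sum_sub_distrib, hm']
    have h1 : 0 ≤ ∑ y, σ.prob y * (m * T y).trace.re := Finset.sum_nonneg fun y _ =>
      mul_nonneg (hσ.prob_nonneg y) (trace_mul_re_nonneg hmp
        (truncate_posSemidef (hσ.isDensity y).posSemidef u))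
    have h2 : ∑ y, σ.prob y * (T y * T y).trace.re ≤ ∑ y, σ.prob y * u :=
      Finset.sum_le_sum fun y _ => mul_le_mul_of_nonneg_left
        (trace_truncate_sq_le (hσ.isDensity y) hu) (hσ.prob_nonneg y)
    rw [← Finset.sum_mul, hσ.prob_sum, one_mul] at h2
    linarith
  rw [expect_sum]
  have term : ∀ i : ι, expect σ.prob (fun x : ι → Y => ∑ j, (q * q) *
      ((T (x i) - m) * (T (x j) - m)).trace.re) ≤ q * q * u := by
    intro i
    rw [expect_sum, Finset.sum_eq_single i]
    · rw [expect_const_mul,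
        expect_single hσ.prob_sum i fun y => ((T y - m) * (T y - m)).trace.re]
      gcongr
    · intro j _ hj
      rw [expect_const_mul, expect_pair hσ.prob_sum hj.symm
        fun y z => ((T y - m) * (T z - m)).trace.re]
      simp only [mul_assoc, ← Finset.mul_sum, hm']
      simp
    · simp
  calc _ ≤ ∑ i : ι, q * q * u := Finset.sum_le_sum fun i _ => term i
    _ = ((Fintype.card ι : ℝ) * q) * (q * u) := by
        rw [Finset.sum_const, Finset.card_univ, nsmul_eq_mul]; ring
    _ = _ := by rw [hcard, one_mul, hq, inv_mul_eq_div]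

theorem sum_card_inv_mul_const (c : ℝ) : ∑ _i : ι, (Fintype.card ι : ℝ)⁻¹ * c = c := by
  rw [Finset.sum_const, Finset.card_univ, nsmul_eq_mul, ← mul_assoc,
    mul_inv_cancel₀ (by positivity), one_mul]

/-- Random codebooks are simultaneously good for covering and for decoding. -/
theorem CQ.IsState.exists_codebook (hσ : σ.IsState) {K L : Type*} [Fintype K] [DecidableEq K]
    [Nonempty K] [Fintype L] [DecidableEq L] [Nonempty L] {u v u' v' θ η ε₁ ε₂ : ℝ} (hu : 0 ≤ u)
    (hv : 0 < v) (hu' : 0 ≤ u') (hv' : 0 < v') (hθ : 0 < θ) (hη : 0 < η) (hε₁ : 0 < ε₁)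
    (hε₂ : 0 < ε₂)
    (hcov : 2 * ∑ y, σ.prob y * tailGt (σ.state y) u + 3 / 2 * θ +
      1 / (2 * (θ * v)) * (u / Fintype.card (K × L)) + 1 / θ * tailLt σ.margA v < ε₁ / 2)
    (hdec : 6 * tailGt σ.margA u' + 4 * ∑ y, σ.prob y * tailLt (σ.state y) v' +
      4 * ((Fintype.card L : ℝ) - 1) * (u' / v') + 4 * η < ε₂ / 2) :
    ∃ (x : K × L → Y) (Γ : K → L → Matrix n n ℂ), (∀ s, IsPOVM (Γ s)) ∧
      traceNorm (∑ i, (((Fintype.card (K × L) : ℝ)⁻¹ : ℝ) : ℂ) • σ.state (x i) - σ.margA) ≤ ε₁ ∧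
      ∑ i : K × L, (Fintype.card (K × L) : ℝ)⁻¹ *
        ((1 - Γ i.1 i.2) * σ.state (x i)).trace.re ≤ ε₂ := by
  set q : ℝ := (Fintype.card (K × L) : ℝ)⁻¹ with hq
  have hq0 : 0 ≤ q := by positivity
  have hp := fun y => (hσ.isDensity y).posSemidef
  have hτ := hσ.margA_isDensity
  have hps := hσ.prob_sum
  set S : Y → Matrix n n ℂ := fun y => packingTest σ.margA (σ.state y) u' v' with hS
  have hS0 : ∀ y, 0 ≤ S y := fun y => packingTest_nonneg _ _
  have hS1 : ∀ y, S y ≤ 1 := fun y => packingTest_le_one (hp y).1 hτ.posSemidef.1 _ _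
  let cov : (K × L → Y) → ℝ := fun x =>
    ∑ i, q * tailGt (σ.state (x i)) u +
      ∑ y, σ.prob y * tailGt (σ.state y) u + 3 / 2 * θ +
      1 / (2 * (θ * v)) * ∑ i, ∑ j, (q * q) *
        ((truncate (σ.state (x i)) u - ∑ y, (σ.prob y : ℂ) • truncate (σ.state y) u) *
         (truncate (σ.state (x j)) u - ∑ y, (σ.prob y : ℂ) • truncate (σ.state y) u)).trace.re +
      1 / (2 * θ) * (∑ i, q *
        (specProj σ.margA (Set.Iio v) * σ.state (x i)).trace.re + tailLt σ.margA v)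
  -- The decoder knows the key, so only codewords with the same first index compete.
  let dec : (K × L → Y) → ℝ := fun x => ∑ i : K × L, q *
    (2 * ((1 - S (x i)) * σ.state (x i)).trace.re +
      4 * ∑ l ∈ Finset.univ.erase i.2, (S (x (i.1, l)) * σ.state (x i)).trace.re + 4 * η)
  have hcovE : expect σ.prob cov < ε₁ / 2 := by
    refine lt_of_le_of_lt ?_ hcov
    simp only [cov, expect_add, expect_const_mul, expect_const hps, expect_sum,
      expect_single hps _ fun y => tailGt (σ.state y) u,
      expect_single hps _ fun y => (specProj σ.margA (Set.Iio v) * σ.state y).trace.re]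
    have h2 := hσ.expect_second_moment_le (ι := K × L) hu
    simp only [expect_sum, expect_const_mul] at h2
    rw [sum_card_inv_mul_const, sum_card_inv_mul_const, ← re_trace_sum_smul_mul]
    change _ + _ + _ + _ + _ * ((specProj σ.margA (Set.Iio v) * σ.margA).trace.re + _) ≤ _
    rw [trace_specProj_Iio_mul hτ.posSemidef.1]
    have h3 := mul_le_mul_of_nonneg_left h2 (show 0 ≤ 1 / (2 * (θ * v)) by positivity)
    have h4 : 1 / (2 * θ) * (tailLt σ.margA v + tailLt σ.margA v) =
        1 / θ * tailLt σ.margA v := by field_simp; ring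
    rw [h4]
    linarith
  have hdecE : expect σ.prob dec < ε₂ / 2 := by
    refine lt_of_le_of_lt ?_ hdec
    have hA : ∑ y, σ.prob y * ((1 - S y) * σ.state y).trace.re ≤
        3 * tailGt σ.margA u' + 2 * ∑ y, σ.prob y * tailLt (σ.state y) v' := by
      have h1 : ∀ y, ((1 - S y) * σ.state y).trace.re ≤
          3 * (specProj σ.margA (Set.Ioi u') * σ.state y).trace.re +
            2 * tailLt (σ.state y) v' := by
        intro y
        have := trace_mul_re_mono (one_sub_packingTest_le (hp y).1 hτ.posSemidef.1 u' v') (hp y)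
        rw [add_mul, trace_add, Complex.add_re, smul_mul_assoc, smul_mul_assoc, trace_smul,
          trace_smul, ← trace_specProj_Iio_mul (hp y).1] at *
        simpa using this
      calc _ ≤ ∑ y, σ.prob y * (3 * (specProj σ.margA (Set.Ioi u') * σ.state y).trace.re +
            2 * tailLt (σ.state y) v') :=
            Finset.sum_le_sum fun y _ => mul_le_mul_of_nonneg_left (h1 y) (hσ.prob_nonneg y)
        _ = 3 * (∑ y, σ.prob y * (specProj σ.margA (Set.Ioi u') * σ.state y).trace.re) +
            2 * ∑ y, σ.prob y * tailLt (σ.state y) v' := by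
            simp only [Finset.mul_sum, mul_add, Finset.sum_add_distrib]
            congr 1 <;> exact Finset.sum_congr rfl fun y _ => by ring
        _ = _ := by
            rw [← re_trace_sum_smul_mul, ← trace_specProj_Ioi_mul hτ.posSemidef.1]
            rfl
    have hB : ∑ y, ∑ z, σ.prob y * σ.prob z * (S y * σ.state z).trace.re ≤ u' / v' := by
      have h1 : ∀ y, ∑ z, σ.prob y * σ.prob z * (S y * σ.state z).trace.re ≤
          σ.prob y * (u' / v') := by
        intro y
        simp only [mul_assoc, ← Finset.mul_sum]
        rw [← re_trace_sum_smul_mul]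
        exact mul_le_mul_of_nonneg_left
          (trace_packingTest_mul_le (hσ.isDensity y) hτ.posSemidef hu' hv') (hσ.prob_nonneg y)
      calc _ ≤ ∑ y, σ.prob y * (u' / v') := Finset.sum_le_sum fun y _ => h1 y
        _ = _ := by rw [← Finset.sum_mul, hps, one_mul]
    have hterm : ∀ i : K × L, expect σ.prob (fun x : K × L → Y =>
        2 * ((1 - S (x i)) * σ.state (x i)).trace.re +
        4 * ∑ l ∈ Finset.univ.erase i.2, (S (x (i.1, l)) * σ.state (x i)).trace.re + 4 * η) ≤
        6 * tailGt σ.margA u' + 4 * ∑ y, σ.prob y * tailLt (σ.state y) v' +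
          4 * ((Fintype.card L : ℝ) - 1) * (u' / v') + 4 * η := by
      intro i
      rw [expect_add, expect_add, expect_const hps, expect_const_mul, expect_const_mul,
        expect_single hps i fun y => ((1 - S y) * σ.state y).trace.re, expect_sum]
      have : ∑ l ∈ Finset.univ.erase i.2, expect σ.prob (fun x : K × L → Y =>
          (S (x (i.1, l)) * σ.state (x i)).trace.re) ≤ ((Fintype.card L : ℝ) - 1) * (u' / v') := by
        calc _ ≤ ∑ l ∈ Finset.univ.erase i.2, u' / v' := by
              refine Finset.sum_le_sum fun l hl => ?_
              have hne : (i.1, l) ≠ i := by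
                rintro h
                exact (Finset.mem_erase.mp hl).1 (congrArg Prod.snd h)
              rw [expect_pair hps hne fun y z => (S y * σ.state z).trace.re]
              exact hB
          _ = _ := by
              rw [Finset.sum_const, Finset.card_erase_of_mem (Finset.mem_univ _),
                Finset.card_univ, nsmul_eq_mul, Nat.cast_sub Fintype.card_pos, Nat.cast_one]
      linarith
    simp only [dec]
    rw [expect_sum]
    calc _ ≤ ∑ i : K × L, q * (6 * tailGt σ.margA u' +
          4 * ∑ y, σ.prob y * tailLt (σ.state y) v' +
          4 * ((Fintype.card L : ℝ) - 1) * (u' / v') + 4 * η) :=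
          Finset.sum_le_sum fun i _ => by
            rw [expect_const_mul]
            exact mul_le_mul_of_nonneg_left (hterm i) hq0
      _ = _ := sum_card_inv_mul_const _
  -- Each normalized expectation is below one half, so some codebook has normalized errors with sum
  -- below one; both being nonnegative, each is below one.
  obtain ⟨x, hx⟩ : ∃ x, ε₁⁻¹ * cov x + ε₂⁻¹ * dec x < 1 := by
    refine exists_lt_of_expect_lt hσ.prob_nonneg hps ?_
    rw [expect_add, expect_const_mul, expect_const_mul]
    have h1 : ε₁⁻¹ * expect σ.prob cov < ε₁⁻¹ * (ε₁ / 2) :=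
      mul_lt_mul_of_pos_left hcovE (inv_pos.mpr hε₁)
    have h2 : ε₂⁻¹ * expect σ.prob dec < ε₂⁻¹ * (ε₂ / 2) :=
      mul_lt_mul_of_pos_left hdecE (inv_pos.mpr hε₂)
    have h3 : ε₁⁻¹ * (ε₁ / 2) = 1 / 2 := by field_simp
    have h4 : ε₂⁻¹ * (ε₂ / 2) = 1 / 2 := by field_simp
    linarith
  have hcx := hσ.traceNorm_codebook_le x (u := u) hv hθ
  choose Γ hΓ hΓS using fun s : K => exists_povm_of_tests (fun l : L => hS0 (x (s, l)))
    (fun l => hS1 (x (s, l))) hη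
  have hdx : ∑ i : K × L, q * ((1 - Γ i.1 i.2) * σ.state (x i)).trace.re ≤ dec x := by
    refine Finset.sum_le_sum fun i _ => mul_le_mul_of_nonneg_left ?_ hq0
    have h1 := trace_mul_re_mono (hΓS i.1 i.2) (hp (x i))
    have h2 : ∑ l, S (x (i.1, l)) + η • 1 - S (x (i.1, i.2)) =
        ∑ l ∈ Finset.univ.erase i.2, S (x (i.1, l)) + η • (1 : Matrix n n ℂ) := by
      rw [← Finset.add_sum_erase _ _ (Finset.mem_univ i.2)]
      abel
    rw [h2, add_mul, trace_add, Complex.add_re, smul_mul_assoc, smul_mul_assoc, trace_smul,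
      trace_smul, add_mul, trace_add, Finset.sum_mul, trace_sum, smul_mul_assoc, trace_smul,
      Matrix.one_mul, (hσ.isDensity (x i)).trace_eq_one] at h1
    simp only [nsmul_eq_mul, Complex.mul_re, Complex.add_re, Complex.re_sum] at h1
    refine h1.trans (le_of_eq ?_)
    simp
    ring
  have hc0 : 0 ≤ cov x := (traceNorm_nonneg ?_).trans hcx
  · have hd0 : 0 ≤ dec x := by
      refine le_trans (Finset.sum_nonneg fun i _ => mul_nonneg hq0 ?_) hdx
      exact trace_mul_re_nonneg (Matrix.le_iff.mp ((hΓ i.1).le_one i.2)) (hp (x i))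
    refine ⟨x, Γ, hΓ, hcx.trans ?_, hdx.trans ?_⟩
    · have : ε₁⁻¹ * cov x < 1 := by
        have := mul_nonneg (inv_pos.mpr hε₂).le hd0
        linarith
      rw [inv_mul_lt_iff₀ hε₁, mul_one] at this
      exact this.le
    · have : ε₂⁻¹ * dec x < 1 := by
        have := mul_nonneg (inv_pos.mpr hε₁).le hc0
        linarith
      rw [inv_mul_lt_iff₀ hε₂, mul_one] at this
      exact this.le
  · exact (posSemidef_sum_smul Finset.univ (fun _ => hq0) fun i => hp (x i)).1.sub hτ.posSemidef.1

end RandomCoding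

/-! ### Combining cover and cypher decoders; local randomness. -/

section Combination

variable {I O : Type*} [Fintype I] [DecidableEq I] [Fintype O] [DecidableEq O]

/-- For `ξ + ε ≥ 1 / 4` the promised error is at least one and any decoder serves; below that the
square root is at most one half, and `3 t ≤ 2 √t`. -/
theorem error_arithmetic {ε ξ ζ : ℝ} (hζ : 0 ≤ ζ) :
    1 ≤ ζ + 2 * √(ξ + ε) ∨ 3 * (ε + ξ) + ζ ≤ ζ + 2 * √(ξ + ε) := by
  by_cases h : 1 / 4 ≤ ξ + ε
  · left
    have : (1 / 2 : ℝ) ≤ √(ξ + ε) := by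
      rw [Real.le_sqrt' (by norm_num)]
      linarith
    linarith
  · right
    rcases le_or_gt 0 (ξ + ε) with h0 | h0
    · have h1 := Real.sq_sqrt h0
      have h2 := Real.sqrt_nonneg (ξ + ε)
      have h3 : √(ξ + ε) ≤ 1 / 2 := by
        rw [Real.sqrt_le_left (by norm_num)]
        linarith
      nlinarith
    · have := Real.sqrt_nonneg (ξ + ε)
      linarith

/-- A decoder for the cover message and decoders for the cypher message combine to a stego
protocol. -/
theorem hasKeyedStegoCode_of_decoders (T : Matrix I I ℂ →ₗ[ℂ] Matrix O O ℂ) {M Mc K : ℕ}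
    (hM : 0 < M) (hMc : 0 < Mc) (hK : 0 < K) {Λ : Fin M → Matrix O O ℂ} (hΛ : IsPOVM Λ)
    {ρc : Fin M → Matrix O O ℂ} {ε ξ ζ : ℝ} (hζ : 0 ≤ ζ)
    (hsucc : 1 - ε ≤ (M : ℝ)⁻¹ * ∑ w, (Λ w * ρc w).trace.re)
    (hρc : ∀ w, (ρc w).IsHermitian)
    {g : Fin K → Fin M × Fin Mc → Matrix I I ℂ} (hg : ∀ s p, IsDensity (g s p))
    (hTg : ∀ s p, IsDensity (T (g s p)))
    {Γ : Fin K → Fin M → Fin Mc → Matrix O O ℂ} (hΓ : ∀ s w, IsPOVM (Γ s w))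
    (hcov : ∀ w, traceNorm (∑ i : Fin K × Fin Mc,
      ((((K : ℝ) * Mc)⁻¹ : ℝ) : ℂ) • T (g i.1 (w, i.2)) - ρc w) ≤ ξ)
    (hdec : ∀ w, ∑ i : Fin K × Fin Mc,
      ((K : ℝ) * Mc)⁻¹ * ((1 - Γ i.1 w i.2) * T (g i.1 (w, i.2))).trace.re ≤ ζ / 2) :
    HasKeyedStegoCode T M Mc K (ζ + 2 * √(ξ + ε)) ξ ((M : ℂ)⁻¹ • ∑ w, ρc w) := by
  set q : ℝ := ((K : ℝ) * Mc)⁻¹ with hq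
  have hM' : (0 : ℝ) < M := by exact_mod_cast hM
  have hMc' : (0 : ℝ) < Mc := by exact_mod_cast hMc
  have hK' : (0 : ℝ) < K := by exact_mod_cast hK
  have hq0 : 0 ≤ q := by positivity
  choose R hR hRR using fun w => exists_sqrt (hΛ.posSemidef w)
  have hP : ∀ s w c, 0 ≤ Γ s w c := fun s w c => ((hΓ s w).posSemidef c).nonneg
  have hP1 : ∀ s w c, Γ s w c ≤ 1 := fun s w c => (hΓ s w).le_one c
  have hsum1 : ∑ _i : Fin K × Fin Mc, q * 1 = 1 := by
    rw [Finset.sum_const, Finset.card_univ, Fintype.card_prod, Fintype.card_fin, Fintype.card_fin,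
      nsmul_eq_mul, hq]
    push_cast
    field_simp
  -- The cover message is measured first through the square root `R` of its POVM element, then the
  -- cypher message; summing over cypher messages restores `Λ`.
  refine ⟨g, fun s p => R p.1 * Γ s p.1 p.2 * R p.1, ⟨hg, fun s => ⟨fun p =>
    (conj_nonneg (hP _ _ _) (hR _).1).posSemidef, ?_⟩, ?_⟩, ?_⟩
  · rw [Fintype.sum_prod_type]
    simp only [← Finset.sum_mul, ← Finset.mul_sum, (hΓ _ _).sum_eq_one, Matrix.mul_one, hRR,
      hΛ.sum_eq_one]
  · have hpos : ∀ s w c, 0 ≤ (R w * Γ s w c * R w * T (g s (w, c))).trace.re := fun s w c =>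
      trace_mul_re_nonneg (conj_nonneg (hP _ _ _) (hR _).1).posSemidef (hTg _ _).posSemidef
    have hre : ((Fintype.card (Fin K) : ℝ) * (Fintype.card (Fin M × Fin Mc) : ℝ))⁻¹ *
        ∑ s, ∑ p : Fin M × Fin Mc, (R p.1 * Γ s p.1 p.2 * R p.1 * T (g s p)).trace.re =
        (M : ℝ)⁻¹ * ∑ w, ∑ i : Fin K × Fin Mc,
          q * (R w * Γ i.1 w i.2 * R w * T (g i.1 (w, i.2))).trace.re := by
      simp only [Fintype.card_prod, Fintype.card_fin, Fintype.sum_prod_type, ← Finset.mul_sum]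
      rw [Finset.sum_comm, ← mul_assoc]
      congr 1
      rw [hq]
      push_cast
      rw [mul_inv, mul_inv, mul_inv]
      ring
    rw [hre]
    rcases error_arithmetic (ε := ε) (ξ := ξ) hζ with h | h
    · refine le_trans (by linarith) (mul_nonneg (by positivity) (Finset.sum_nonneg fun w _ =>
        Finset.sum_nonneg fun i _ => mul_nonneg hq0 (hpos _ _ _)))
    refine le_trans (by linarith : _ ≤ 1 - (3 * (ε + ξ) + ζ)) ?_
    have hw : ∀ w, 3 * (Λ w * ρc w).trace.re - 2 - 3 * ξ - ζ ≤ ∑ i : Fin K × Fin Mc,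
        q * (R w * Γ i.1 w i.2 * R w * T (g i.1 (w, i.2))).trace.re := by
      intro w
      have e1 : ∀ i : Fin K × Fin Mc, 1 - 3 * (1 - (Λ w * T (g i.1 (w, i.2))).trace.re) -
          2 * ((1 - Γ i.1 w i.2) * T (g i.1 (w, i.2))).trace.re ≤
          (R w * Γ i.1 w i.2 * R w * T (g i.1 (w, i.2))).trace.re := by
        intro i
        have := trace_mul_re_mono (one_sub_conj_le (hR w) (by rw [hRR]; exact hΛ.le_one w)
          (hP i.1 w i.2) (hP1 i.1 w i.2)) (hTg i.1 (w, i.2)).posSemidef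
        rw [hRR, add_mul, trace_add, smul_mul_assoc, smul_mul_assoc, trace_smul, trace_smul,
          sub_mul, trace_sub, sub_mul, trace_sub, Matrix.one_mul,
          (hTg i.1 (w, i.2)).trace_eq_one] at this
        simp at this
        linarith
      have e2 : ∑ i : Fin K × Fin Mc, q * (1 - 3 * (1 - (Λ w * T (g i.1 (w, i.2))).trace.re) -
          2 * ((1 - Γ i.1 w i.2) * T (g i.1 (w, i.2))).trace.re) =
          (∑ _i : Fin K × Fin Mc, q * 1) * (-2) +
          3 * (Λ w * ∑ i : Fin K × Fin Mc, (q : ℂ) • T (g i.1 (w, i.2))).trace.re -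
          2 * ∑ i : Fin K × Fin Mc, q * ((1 - Γ i.1 w i.2) * T (g i.1 (w, i.2))).trace.re := by
        rw [re_trace_sum_smul_mul, Finset.sum_mul, Finset.mul_sum, Finset.mul_sum,
          ← Finset.sum_add_distrib, ← Finset.sum_sub_distrib]
        exact Finset.sum_congr rfl fun i _ => by ring
      -- The covering property costs the cover decoder at most `ξ`.
      have e3 : (Λ w * ρc w).trace.re - ξ ≤
          (Λ w * ∑ i : Fin K × Fin Mc, (q : ℂ) • T (g i.1 (w, i.2))).trace.re := by
        have hX : (∑ i : Fin K × Fin Mc, (q : ℂ) • T (g i.1 (w, i.2)) - ρc w).IsHermitian :=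
          (posSemidef_sum_smul Finset.univ (fun _ => hq0) fun i : Fin K × Fin Mc =>
            (hTg i.1 (w, i.2)).posSemidef).1.sub (hρc w)
        have := trace_mul_re_le_traceNorm (L := -Λ w) hX (neg_le_neg (hΛ.le_one w))
          ((neg_nonpos.mpr (hΛ.posSemidef w).nonneg).trans PosSemidef.one.nonneg)
        rw [neg_mul, mul_sub, trace_neg, trace_sub, Complex.neg_re, Complex.sub_re] at this
        have := hcov w
        linarith
      have e4 := Finset.sum_le_sum fun (i : Fin K × Fin Mc) (_ : i ∈ Finset.univ) =>
        mul_le_mul_of_nonneg_left (e1 i) hq0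
      rw [e2, hsum1] at e4
      have := hdec w
      linarith
    calc 1 - (3 * (ε + ξ) + ζ) ≤ 3 * ((M : ℝ)⁻¹ * ∑ w, (Λ w * ρc w).trace.re) - 2 - 3 * ξ - ζ := by
          linarith
      _ = (M : ℝ)⁻¹ * ∑ w, (3 * (Λ w * ρc w).trace.re - 2 - 3 * ξ - ζ) := by
          simp only [Finset.sum_sub_distrib, Finset.sum_const, Finset.card_univ, Fintype.card_fin,
            nsmul_eq_mul, ← Finset.mul_sum]
          field_simp
      _ ≤ _ := mul_le_mul_of_nonneg_left (Finset.sum_le_sum fun w _ => hw w) (by positivity)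
  · have e : keyedInducedState T g - (M : ℂ)⁻¹ • ∑ w, ρc w = ∑ w, (((M : ℝ)⁻¹ : ℝ) : ℂ) •
        (∑ i : Fin K × Fin Mc, (q : ℂ) • T (g i.1 (w, i.2)) - ρc w) := by
      unfold keyedInducedState
      simp only [Fintype.card_prod, Fintype.card_fin, Fintype.sum_prod_type, smul_sub,
        Finset.sum_sub_distrib, Finset.smul_sum, Complex.ofReal_inv, Complex.ofReal_natCast]
      congr 1
      rw [Finset.sum_comm]
      refine Finset.sum_congr rfl fun w _ => Finset.sum_congr rfl fun s _ =>
        Finset.sum_congr rfl fun c _ => ?_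
      rw [smul_smul, hq]
      congr 1
      push_cast
      rw [mul_inv, mul_inv, mul_inv]
      ring
    rw [e]
    refine (traceNorm_sum_le Finset.univ (fun _ => by positivity) fun w =>
      (posSemidef_sum_smul Finset.univ (fun _ => hq0) fun i : Fin K × Fin Mc =>
            (hTg i.1 (w, i.2)).posSemidef).1.sub (hρc w)).trans ?_
    calc _ ≤ ∑ _w : Fin M, (M : ℝ)⁻¹ * ξ :=
          Finset.sum_le_sum fun w _ => mul_le_mul_of_nonneg_left (hcov w) (by positivity)
      _ = ξ := by
          rw [Finset.sum_const, Finset.card_univ, Fintype.card_fin, nsmul_eq_mul]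
          field_simp

theorem HasKeyedStegoCode.hasStegoCode {T : Matrix I I ℂ →ₗ[ℂ] Matrix O O ℂ} {M Mc : ℕ} {ε η : ℝ}
    {ρc : Matrix O O ℂ} (h : HasKeyedStegoCode T M Mc 1 ε η ρc) : HasStegoCode T M Mc ε η ρc := by
  obtain ⟨g, Γ, ⟨h1, h2, h3⟩, h4⟩ := h
  refine ⟨g 0, Γ 0, ⟨h1 0, h2 0, ?_⟩, ?_⟩
  · simpa using h3
  · simpa [keyedInducedState, inducedState] using h4

theorem isDensity_average {U : ℕ} (hU : 0 < U) {X : Fin U → Matrix I I ℂ}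
    (hX : ∀ j, IsDensity (X j)) : IsDensity (∑ j, (((U : ℝ)⁻¹ : ℝ) : ℂ) • X j) := by
  refine ⟨posSemidef_sum_smul _ (fun _ => by positivity) fun j => (hX j).posSemidef, ?_⟩
  simp only [trace_sum, trace_smul, (hX _).trace_eq_one, smul_eq_mul, mul_one, Finset.sum_const,
    Finset.card_univ, Fintype.card_fin, nsmul_eq_mul]
  have : (U : ℝ) * (U : ℝ)⁻¹ = 1 := mul_inv_cancel₀ (by positivity)
  exact_mod_cast this

/-- Random codebooks with local randomness `Fin U` at the encoder give a cypher code for each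
cover message. -/
theorem exists_cypher_code {Y : Type*} [Fintype Y] [DecidableEq Y]
    (T : Matrix I I ℂ →ₗ[ℂ] Matrix O O ℂ) {σ : CQ Y I} (hσ : σ.IsState)
    (hT : (σ.map T).IsState) {K Mc U : ℕ} (hK : 0 < K) (hMc : 0 < Mc) (hU : 0 < U)
    {u v u' v' θ η ξ ζ : ℝ} (hu : 0 ≤ u)
    (hv : 0 < v) (hu' : 0 ≤ u') (hv' : 0 < v') (hθ : 0 < θ) (hη : 0 < η) (hξ : 0 < ξ)
    (hζ : 0 < ζ)
    (hcov : 2 * ∑ y, σ.prob y * tailGt (T (σ.state y)) u + 3 / 2 * θ +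
      1 / (2 * (θ * v)) * (u / (K * (Mc * U))) + 1 / θ * tailLt (σ.map T).margA v < ξ / 2)
    (hdec : 6 * tailGt (σ.map T).margA u' + 4 * ∑ y, σ.prob y * tailLt (T (σ.state y)) v' +
      4 * ((Mc : ℝ) * U - 1) * (u' / v') + 4 * η < ζ / 2) :
    ∃ (g : Fin K → Fin Mc → Matrix I I ℂ) (Γ : Fin K → Fin Mc → Matrix O O ℂ),
      (∀ s c, IsDensity (g s c)) ∧ (∀ s c, IsDensity (T (g s c))) ∧ (∀ s, IsPOVM (Γ s)) ∧
      traceNorm (∑ i : Fin K × Fin Mc, ((((K : ℝ) * Mc)⁻¹ : ℝ) : ℂ) • T (g i.1 i.2) -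
        (σ.map T).margA) ≤ ξ ∧
      ∑ i : Fin K × Fin Mc,
        ((K : ℝ) * Mc)⁻¹ * ((1 - Γ i.1 i.2) * T (g i.1 i.2)).trace.re ≤ ζ := by
  have : NeZero K := ⟨hK.ne'⟩
  have : NeZero Mc := ⟨hMc.ne'⟩
  have : NeZero U := ⟨hU.ne'⟩
  obtain ⟨x, Γ, hΓ, h1, h2⟩ := hT.exists_codebook (K := Fin K) (L := Fin Mc × Fin U) hu hv hu' hv'
    hθ hη hξ hζ (by simpa [CQ.map] using hcov) (by simpa [CQ.map] using hdec)
  have hUr : (0 : ℝ) < U := by exact_mod_cast hU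
  have hMcr : (0 : ℝ) < Mc := by exact_mod_cast hMc
  have hKr : (0 : ℝ) < K := by exact_mod_cast hK
  set t : ℝ := (U : ℝ)⁻¹ with ht
  have ht0 : 0 ≤ t := by positivity
  have hq : ((Fintype.card (Fin K × Fin Mc × Fin U) : ℝ)⁻¹) = ((K : ℝ) * Mc)⁻¹ * t := by
    simp only [Fintype.card_prod, Fintype.card_fin]
    push_cast
    rw [ht, mul_inv, mul_inv, mul_inv]
    ring
  rw [hq] at h1 h2
  have hTg : ∀ s c, T (∑ j : Fin U, (t : ℂ) • σ.state (x (s, (c, j)))) =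
      ∑ j : Fin U, (t : ℂ) • T (σ.state (x (s, (c, j)))) := fun s c => by
    simp only [map_sum, map_smul]
  have hTd : ∀ y, IsDensity (T (σ.state y)) := hT.isDensity
  -- The local index is averaged at the encoder. The decoder identifies it along with the cypher
  -- message and then forgets it, which can only lower the error.
  refine ⟨fun s c => ∑ j : Fin U, (t : ℂ) • σ.state (x (s, (c, j))),
    fun s c => ∑ j, Γ s (c, j), fun s c => isDensity_average hU fun j => hσ.isDensity _, fun s c => ?_,
    fun s => ⟨fun c => posSemidef_sum _ fun j _ => (hΓ s).posSemidef _, ?_⟩, ?_, ?_⟩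
  · rw [hTg]
    exact isDensity_average hU fun j => hTd _
  · rw [← (hΓ s).sum_eq_one, Fintype.sum_prod_type]
  · convert h1 using 3
    simp only [hTg, Fintype.sum_prod_type, Finset.smul_sum, smul_smul, Complex.ofReal_mul]
    rfl
  · calc _ = ∑ i : Fin K × Fin Mc, ∑ j : Fin U, ((K : ℝ) * Mc)⁻¹ * t *
        ((1 - ∑ j, Γ i.1 (i.2, j)) * T (σ.state (x (i.1, (i.2, j))))).trace.re := by
          refine Finset.sum_congr rfl fun i _ => ?_
          rw [hTg, re_trace_sum_smul_mul, Finset.mul_sum]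
          exact Finset.sum_congr rfl fun j _ => by ring
      _ ≤ ∑ i : Fin K × Fin Mc, ∑ j : Fin U, ((K : ℝ) * Mc)⁻¹ * t *
        ((1 - Γ i.1 (i.2, j)) * T (σ.state (x (i.1, (i.2, j))))).trace.re := by
          refine Finset.sum_le_sum fun i _ => Finset.sum_le_sum fun j _ =>
            mul_le_mul_of_nonneg_left (trace_mul_re_mono ?_ (hTd _).posSemidef) (by positivity)
          refine sub_le_sub_left ?_ _
          exact Finset.single_le_sum (f := fun j => Γ i.1 (i.2, j))
            (fun j _ => ((hΓ i.1).posSemidef _).nonneg) (Finset.mem_univ j)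
      _ ≤ ζ := by
          refine le_of_eq_of_le ?_ h2
          simp only [Fintype.sum_prod_type]
          rfl

end Combination

/-! ### Binning eigenvectors for the noiseless channel. -/

section Bins

/-- A greedy assignment to bins of nearly equal weight. -/
theorem exists_bins {Y : Type*} [Fintype Y] [DecidableEq Y] {q : Y → ℝ} (hq : ∀ y, 0 ≤ q y)
    (hq1 : ∑ y, q y = 1) {N : ℕ} (hN : 0 < N) {u : ℝ} (hu : 0 ≤ u) :
    ∃ b : Y → Fin N, ∀ c, ∑ y, (if b y = c then q y else 0) ≤
      (N : ℝ)⁻¹ + u + ∑ y, if b y = c then (if u < q y then q y else 0) else 0 := by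
  have hNr : (0 : ℝ) < N := by exact_mod_cast hN
  suffices h : ∀ s : Finset Y, ∃ b : Y → Fin N, ∀ c, ∑ y ∈ s, (if b y = c then q y else 0) ≤
      (N : ℝ)⁻¹ + u + ∑ y ∈ s, if b y = c then (if u < q y then q y else 0) else 0 from h _
  intro s
  induction s using Finset.induction_on with
  | empty => exact ⟨fun _ => ⟨0, hN⟩, fun c => by simp; positivity⟩
  | insert a s ha ih =>
    obtain ⟨b, hb⟩ := ih
    -- A heavy element may go to any bin, since its weight is charged on both sides.
    by_cases hau : u < q a
    · refine ⟨b, fun c => ?_⟩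
      rw [Finset.sum_insert ha, Finset.sum_insert ha, if_pos hau]
      linarith [hb c]
    -- By averaging some bin has weight at most `1 / N` so far; a light element placed there raises
    -- it by at most `u`.
    · obtain ⟨c₀, -, hc₀⟩ : ∃ c ∈ (Finset.univ : Finset (Fin N)),
          ∑ y ∈ s, (if b y = c then q y else 0) ≤ (N : ℝ)⁻¹ := by
        refine Finset.exists_le_of_sum_le ⟨⟨0, hN⟩, Finset.mem_univ _⟩ ?_
        rw [Finset.sum_comm, Finset.sum_const, Finset.card_univ, Fintype.card_fin, nsmul_eq_mul,
          mul_inv_cancel₀ hNr.ne', ← hq1]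
        simp only [Finset.sum_ite_eq, Finset.mem_univ, if_true]
        exact Finset.sum_le_sum_of_subset_of_nonneg (Finset.subset_univ _) fun y _ _ => hq y
      have hne : ∀ y ∈ s, y ≠ a := fun y hy h => ha (h ▸ hy)
      have hs : ∀ c (F : Y → ℝ), ∑ y ∈ s, (if Function.update b a c₀ y = c then F y else 0) =
          ∑ y ∈ s, (if b y = c then F y else 0) := fun c F =>
        Finset.sum_congr rfl fun y hy => by rw [Function.update_of_ne (hne y hy)]
      refine ⟨Function.update b a c₀, fun c => ?_⟩
      rw [Finset.sum_insert ha, Finset.sum_insert ha, hs, hs, if_neg hau,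
        Function.update_self]
      by_cases hc : c₀ = c
      · subst hc
        have : 0 ≤ ∑ y ∈ s, if b y = c₀ then (if u < q y then q y else 0) else 0 :=
          Finset.sum_nonneg fun y _ => by
            have := hq y
            split_ifs <;> linarith
        simp only [if_true]
        linarith [not_lt.mp hau]
      · rw [if_neg hc, if_neg hc]
        linarith [hb c]

variable {O : Type*} [Fintype O] [DecidableEq O]

/-- A density operator is close to a uniform mixture of `N` perfectly distinguishable ones if most
of its eigenvalues are small compared to `1 / N`. -/
theorem exists_distinguishable_mixture {ρ : Matrix O O ℂ} (hρ : IsDensity ρ) {N : ℕ} (hN : 0 < N)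
    {u : ℝ} (hu : 0 ≤ u) :
    ∃ (g Γ : Fin N → Matrix O O ℂ), (∀ c, IsDensity (g c)) ∧ IsPOVM Γ ∧
      traceNorm (∑ c, (((N : ℝ)⁻¹ : ℝ) : ℂ) • g c - ρ) ≤ 2 * (N * u + tailGt ρ u) ∧
      ∑ c, (N : ℝ)⁻¹ * ((1 - Γ c) * g c).trace.re ≤ 2 * (N * u + tailGt ρ u) := by
  have hNr : (0 : ℝ) < N := by exact_mod_cast hN
  obtain ⟨V, q, hV, hq, rfl⟩ := exists_conjDiag_nonneg hρ.posSemidef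
  have hq1 : ∑ y, q y = 1 := by
    have := hρ.trace_eq_one
    rw [trace_conjDiag hV] at this
    exact_mod_cast this
  obtain ⟨b, hb⟩ := exists_bins hq hq1 hN hu
  set w : Fin N → ℝ := fun c => ∑ y, (if b y = c then q y else 0) with hw
  have hw0 : ∀ c, 0 ≤ w c := fun c => Finset.sum_nonneg fun y _ => by
    have := hq y
    split_ifs <;> linarith
  have hwle : ∀ y, q y ≤ w (b y) := fun y => by
    have := Finset.single_le_sum (f := fun z => if b z = b y then q z else 0)
      (fun z _ => by have := hq z; split_ifs <;> linarith) (Finset.mem_univ y)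
    simpa using this
  have hw1 : ∑ c, w c = 1 := by
    rw [hw, Finset.sum_comm, ← hq1]
    simp
  have htail : tailGt (conjDiag V q) u = ∑ y, if u < q y then q y else 0 := by
    unfold tailGt
    rw [cfc_conjDiag hV, trace_conjDiag hV, Complex.ofReal_re]
  set D := ∑ c, |(N : ℝ)⁻¹ - w c| with hD
  have hDle : D ≤ 2 * (N * u + tailGt (conjDiag V q) u) := by
    -- The signed deviations sum to zero, so bounding the excess of overfull bins controls the whole
    -- sum, with a factor two.
    have h1 : ∀ c, |(N : ℝ)⁻¹ - w c| ≤ ((N : ℝ)⁻¹ - w c) + 2 * (u + ∑ y, if b y = c then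
        (if u < q y then q y else 0) else 0) := by
      intro c
      have h0 : 0 ≤ ∑ y, if b y = c then (if u < q y then q y else 0) else 0 :=
        Finset.sum_nonneg fun y _ => by
          have := hq y
          split_ifs <;> linarith
      have := hb c
      change w c ≤ _ at this
      rcases abs_cases ((N : ℝ)⁻¹ - w c) with ⟨h, -⟩ | ⟨h, -⟩ <;> linarith
    calc D ≤ _ := Finset.sum_le_sum fun c _ => h1 c
      _ = _ := by
        rw [Finset.sum_add_distrib, Finset.sum_sub_distrib, hw1, ← Finset.mul_sum,
          Finset.sum_add_distrib, Finset.sum_comm, htail]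
        simp only [Finset.sum_const, Finset.card_univ, Fintype.card_fin, nsmul_eq_mul,
          Finset.sum_ite_eq, Finset.mem_univ, if_true]
        rw [mul_inv_cancel₀ hNr.ne']
        ring
  -- A bin of weight zero has no normalized state; the whole spectrum serves as a default.
  set G : Fin N → O → ℝ := fun c y => if w c = 0 then q y else if b y = c then q y / w c else 0
    with hG
  have hG0 : ∀ c y, 0 ≤ G c y := fun c y => by
    have := hq y
    have := hw0 c
    simp only [hG]
    split_ifs <;> positivity
  have hG1 : ∀ c, ∑ y, G c y = 1 := fun c => by
    by_cases h : w c = 0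
    · simpa [hG, h] using hq1
    · simp only [hG, h, if_false]
      have : ∀ y, (if b y = c then q y / w c else 0) = (if b y = c then q y else 0) / w c :=
        fun y => by split_ifs <;> simp
      simp only [this, ← Finset.sum_div]
      exact div_self h
  have hGq : ∀ y, q y = ∑ c, w c * G c y := fun y => by
    rw [Finset.sum_eq_single (b y)]
    · by_cases h : w (b y) = 0
      · rw [h, zero_mul]
        exact le_antisymm (h ▸ hwle y) (hq y)
      · simp only [hG, h, if_false, if_true]
        field_simp
    · intro c _ hc
      by_cases h : w c = 0
      · rw [h, zero_mul]
      · simp [hG, h, hc.symm]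
    · simp
  refine ⟨fun c => conjDiag V (G c), fun c => conjDiag V fun y => if b y = c then 1 else 0,
    fun c => ⟨conjDiag_posSemidef V (hG0 c), ?_⟩, ⟨fun c => conjDiag_posSemidef V fun y => ?_, ?_⟩,
    le_trans ?_ hDle, le_trans ?_ hDle⟩
  · rw [trace_conjDiag hV, hG1]; simp
  · split_ifs <;> norm_num
  · rw [← conjDiag_one hV]
    ext i j
    simp only [Matrix.sum_apply, conjDiag_apply]
    rw [Finset.sum_comm]
    refine Finset.sum_congr rfl fun l _ => ?_
    rw [← Finset.sum_mul, ← Finset.mul_sum]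
    simp [apply_ite Complex.ofReal]
  · have e : ∑ c, (((N : ℝ)⁻¹ : ℝ) : ℂ) • conjDiag V (G c) - conjDiag V q =
        conjDiag V fun y => ∑ c, ((N : ℝ)⁻¹ - w c) * G c y := by
      ext i j
      simp only [Matrix.sub_apply, Matrix.sum_apply, Matrix.smul_apply, conjDiag_apply, smul_eq_mul,
        Finset.mul_sum]
      rw [Finset.sum_comm, ← Finset.sum_sub_distrib]
      refine Finset.sum_congr rfl fun l _ => ?_
      rw [hGq l]
      push_cast
      simp only [Finset.mul_sum, Finset.sum_mul, ← Finset.sum_sub_distrib]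
      exact Finset.sum_congr rfl fun c _ => by ring
    rw [e, traceNorm_conjDiag hV]
    calc _ ≤ ∑ y, ∑ c, |(N : ℝ)⁻¹ - w c| * G c y := Finset.sum_le_sum fun y _ =>
          (Finset.abs_sum_le_sum_abs _ _).trans (le_of_eq (Finset.sum_congr rfl fun c _ => by
            rw [abs_mul, abs_of_nonneg (hG0 c y)]))
      _ = D := by
          rw [Finset.sum_comm]
          simp only [← Finset.mul_sum, hG1, mul_one, hD]
  · refine Finset.sum_le_sum fun c _ => ?_
    rw [sub_mul, Matrix.one_mul, trace_sub, conjDiag_mul hV, trace_conjDiag hV, trace_conjDiag hV,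
      hG1, Complex.sub_re, Complex.ofReal_re, Complex.ofReal_re]
    -- Bins of weight zero may fail completely, but each of them also contributes `1 / N` to `D`;
    -- all other bins are decoded without error.
    by_cases h : w c = 0
    · rw [h, sub_zero, abs_of_pos (by positivity)]
      have : 0 ≤ ∑ y, (if b y = c then 1 else 0) * G c y := Finset.sum_nonneg fun y _ =>
        mul_nonneg (by split_ifs <;> norm_num) (hG0 c y)
      have h2 : (0 : ℝ) < (N : ℝ)⁻¹ := by positivity
      nlinarith
    · have : ∑ y, (if b y = c then 1 else 0) * G c y = ∑ y, G c y :=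
        Finset.sum_congr rfl fun y _ => by
          simp only [hG, h, if_false]
          split_ifs <;> simp
      rw [this, hG1]
      simp

end Bins

/-! ### Uniform expansions and limits in the number of blocks. -/

section Asymptotics

open Filter Topology

theorem exists_uniform_log_bounds {ι : Type*} [Finite ι] {φ : ι → ℝ → ℝ} {D : ι → ℝ}
    (h : ∀ i, HasDerivAt (φ i) (D i) 0 ∧ φ i 0 = 1) {γ : ℝ} (hγ : 0 < γ) :
    ∃ s₀ : ℝ, 0 < s₀ ∧ ∀ a : ℝ, |a| < s₀ → ∀ i, 0 < φ i a ∧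
      |Real.log (φ i a) - a * D i| ≤ γ * |a| := by
  have := eventually_all.mpr fun i => eventually_log_bounds (h i).1 (h i).2 hγ
  obtain ⟨s₀, hs, h2⟩ := Metric.eventually_nhds_iff.mp this
  exact ⟨s₀, hs, fun a ha => h2 (by simpa using ha)⟩

theorem prod_log_bounds {r : ℕ} {φ D : Fin r → ℝ} {a γ : ℝ}
    (h : ∀ i, 0 < φ i ∧ |Real.log (φ i) - a * D i| ≤ γ * |a|) :
    0 < ∏ i, φ i ∧ |Real.log (∏ i, φ i) - a * ∑ i, D i| ≤ r * γ * |a| := by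
  refine ⟨Finset.prod_pos fun i _ => (h i).1, ?_⟩
  rw [Real.log_prod fun i _ => (h i).1.ne', Finset.mul_sum, ← Finset.sum_sub_distrib]
  refine (Finset.abs_sum_le_sum_abs _ _).trans ?_
  calc _ ≤ ∑ _i : Fin r, γ * |a| := Finset.sum_le_sum fun i _ => (h i).2
    _ = _ := by
      rw [Finset.sum_const, Finset.card_univ, Fintype.card_fin, nsmul_eq_mul, mul_assoc]

theorem le_exp_of_log_bound {z a H E : ℝ} (hz : 0 < z) (h : |Real.log z - a * H| ≤ E) :
    z ≤ Real.exp (a * H + E) := by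
  rw [← Real.log_le_iff_le_exp hz]
  linarith [le_abs_self (Real.log z - a * H)]

theorem eventually_exp_neg_lt {γ ε : ℝ} (hγ : 0 < γ) (hε : 0 < ε) :
    ∀ᶠ r : ℕ in atTop, Real.exp (-(r * γ)) < ε := by
  have h1 : Tendsto (fun r : ℕ => (r : ℝ) * γ) atTop atTop :=
    tendsto_natCast_atTop_atTop.atTop_mul_const hγ
  exact (Real.tendsto_exp_neg_atTop_nhds_zero.comp h1).eventually (gt_mem_nhds hε)

theorem eventually_log_le (α β : ℝ) {κ : ℝ} (hκ : 0 < κ) :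
    ∀ᶠ r : ℕ in atTop, α * Real.log (r + 1) + β ≤ κ * r := by
  have h0 : Tendsto (fun r : ℕ => (r : ℝ) + 1) atTop atTop :=
    tendsto_atTop_add_const_right _ _ tendsto_natCast_atTop_atTop
  have h1 := (Real.isLittleO_log_id_atTop.comp_tendsto h0).def
    (show 0 < κ / (2 * (|α| + 1)) by positivity)
  filter_upwards [h1, tendsto_natCast_atTop_atTop.eventually_ge_atTop ((β + κ / 2) / (κ / 2))]
    with r hr hr2
  have hr0 : (0 : ℝ) ≤ r := Nat.cast_nonneg r
  have hl : 0 ≤ Real.log ((r : ℝ) + 1) := Real.log_nonneg (by linarith)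
  simp only [Function.comp_apply, id, Real.norm_eq_abs, abs_of_nonneg hl,
    abs_of_nonneg (by linarith : (0 : ℝ) ≤ (r : ℝ) + 1)] at hr
  rw [div_le_iff₀ (by positivity)] at hr2
  have h3 : α * Real.log (r + 1) ≤ κ / 2 * (r + 1) := by
    calc _ ≤ (|α| + 1) * Real.log (r + 1) := by
          gcongr
          linarith [le_abs_self α]
      _ ≤ (|α| + 1) * (κ / (2 * (|α| + 1)) * (r + 1)) := by gcongr
      _ = _ := by field_simp
  linarith

end Asymptotics

/-! ### Tail and Rényi bounds for products from a finite family. -/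

section ProductBounds

variable {X B J : Type*} [Fintype X] [DecidableEq X] [Fintype B] [DecidableEq B]
  [Fintype J] [DecidableEq J] {k : ℕ}

theorem CQ.IsState.sum_tailGt_le {Y O : Type*} [Fintype Y] [DecidableEq Y] [Fintype O]
    [DecidableEq O] {σ : CQ Y O} (hσ : σ.IsState) {u s : ℝ} (hu : 0 < u) (hs : 0 ≤ s) :
    ∑ y, σ.prob y * tailGt (σ.state y) u ≤ u ^ (-s) * σ.condMoment s := by
  unfold CQ.condMoment
  rw [Finset.mul_sum]
  refine Finset.sum_le_sum fun y _ => ?_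
  rw [mul_left_comm]
  exact mul_le_mul_of_nonneg_left (tailGt_le (hσ.isDensity y).posSemidef hu hs) (hσ.prob_nonneg y)

theorem CQ.IsState.sum_tailLt_le {Y O : Type*} [Fintype Y] [DecidableEq Y] [Fintype O]
    [DecidableEq O] {σ : CQ Y O} (hσ : σ.IsState) {v s : ℝ} (hv : 0 < v) (hs : 0 ≤ s) :
    ∑ y, σ.prob y * tailLt (σ.state y) v ≤ v ^ s * σ.condMoment (-s) := by
  unfold CQ.condMoment
  rw [Finset.mul_sum]
  refine Finset.sum_le_sum fun y _ => ?_
  rw [mul_left_comm]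
  exact mul_le_mul_of_nonneg_left (tailLt_le (hσ.isDensity y).posSemidef hv hs) (hσ.prob_nonneg y)

/-- The threshold is kept `2 * E` away from the entropy: one `E` pays for the error of the
expansion, the other remains as the decay exponent. -/
theorem rpow_neg_mul_le {z s H E : ℝ} (hz : 0 < z) (hs : 0 < s)
    (h : |Real.log z - s * -H| ≤ E * |s|) :
    Real.exp (-(H - 2 * E)) ^ (-s) * z ≤ Real.exp (-(E * s)) := by
  have h1 := le_exp_of_log_bound hz h
  rw [abs_of_pos hs] at h1
  calc _ ≤ Real.exp (-(H - 2 * E)) ^ (-s) * Real.exp (s * -H + E * s) := by gcongr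
    _ = _ := by
      rw [← Real.exp_mul, ← Real.exp_add]
      congr 1
      ring

theorem rpow_mul_le {z s H E : ℝ} (hz : 0 < z) (hs : 0 < s)
    (h : |Real.log z - -s * -H| ≤ E * |-s|) :
    Real.exp (-(H + 2 * E)) ^ s * z ≤ Real.exp (-(E * s)) := by
  have h1 := le_exp_of_log_bound hz h
  rw [abs_neg, abs_of_pos hs] at h1
  calc _ ≤ Real.exp (-(H + 2 * E)) ^ s * Real.exp (-s * -H + E * s) := by gcongr
    _ = _ := by
      rw [← Real.exp_mul, ← Real.exp_add]
      congr 1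
      ring

/-- Exponentially small tails and first-order Rényi information bounds for products of states from
a finite family, with a uniform exponent. -/
theorem exists_exponent {τ : J → CQ X (Fin k → B)} (hτ : ∀ j, (τ j).IsState) {γ : ℝ} (hγ : 0 < γ) :
    ∃ s : ℝ, 0 < s ∧ s < 1 ∧ ∀ (r n : ℕ) (h : r * k = n) (d : ℕ) (e : Fin d ≃ (Fin r → X))
      (c : Fin r → J) (σ : CQ (Fin d) (Fin n → B)), σ = CQ.prod h e (fun i => τ (c i)) →
      ∀ H₁ H₂ : ℝ, H₁ = ∑ i, (τ (c i)).condEntropy → H₂ = ∑ i, natEntropy (τ (c i)).margA →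
      ∑ y, σ.prob y * tailGt (σ.state y) (Real.exp (-(H₁ - 2 * (r * γ)))) ≤
        Real.exp (-(r * γ * s)) ∧
      ∑ y, σ.prob y * tailLt (σ.state y) (Real.exp (-(H₁ + 2 * (r * γ)))) ≤
        Real.exp (-(r * γ * s)) ∧
      tailGt σ.margA (Real.exp (-(H₂ - 2 * (r * γ)))) ≤ Real.exp (-(r * γ * s)) ∧
      tailLt σ.margA (Real.exp (-(H₂ + 2 * (r * γ)))) ≤ Real.exp (-(r * γ * s)) ∧
      (H₂ - H₁ - r * γ) / Real.log 2 ≤ σ.renyiInfoJoint s ∧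
      σ.renyiInfoCond (-s) ≤ (H₂ - H₁ + r * γ) / Real.log 2 := by
  obtain ⟨s₁, hs₁, b₁⟩ := exists_uniform_log_bounds (fun j => (hτ j).hasDerivAt_condMoment) hγ
  obtain ⟨s₂, hs₂, b₂⟩ := exists_uniform_log_bounds (fun j => (hτ j).hasDerivAt_margMoment) hγ
  obtain ⟨s₃, hs₃, b₃⟩ := exists_uniform_log_bounds (fun j => (hτ j).hasDerivAt_sandwichMoment) hγ
  obtain ⟨s₄, hs₄, b₄⟩ := exists_uniform_log_bounds (fun j => (hτ j).hasDerivAt_petzMoment) hγ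
  -- One exponent inside all four radii serves both signs and all moments; it is fixed before the
  -- number of blocks.
  obtain ⟨s, hs, hlt⟩ : ∃ s : ℝ, 0 < s ∧ s < min (min (min s₁ s₂) (min s₃ s₄)) 1 :=
    exists_between (by simp [hs₁, hs₂, hs₃, hs₄])
  simp only [lt_min_iff] at hlt
  obtain ⟨⟨⟨l1, l2⟩, l3, l4⟩, l5⟩ := hlt
  have a1 : |s| = s := abs_of_pos hs
  have a2 : |-s| = s := by rw [abs_neg, a1]
  refine ⟨s, hs, l5, fun r n h d e c σ hσ H₁ H₂ hH₁ hH₂ => ?_⟩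
  have hst : ∀ i, (τ (c i)).IsState := fun i => hτ (c i)
  have hS : σ.IsState := hσ ▸ CQ.prod_isState h e hst
  have hlog2 : 0 < Real.log 2 := Real.log_pos (by norm_num)
  have c1 := prod_log_bounds fun i => b₁ s (by rwa [a1]) (c i)
  have c2 := prod_log_bounds fun i => b₁ (-s) (by rwa [a2]) (c i)
  have c3 := prod_log_bounds fun i => b₂ s (by rwa [a1]) (c i)
  have c4 := prod_log_bounds fun i => b₂ (-s) (by rwa [a2]) (c i)
  have c5 := prod_log_bounds fun i => b₃ s (by rwa [a1]) (c i)
  have c6 := prod_log_bounds fun i => b₄ (-s) (by rwa [a2]) (c i)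
  rw [← CQ.prod_condMoment h e hst, ← hσ, Finset.sum_neg_distrib, ← hH₁] at c1 c2
  rw [← CQ.prod_margMoment h e hst, ← hσ, Finset.sum_neg_distrib, ← hH₂] at c3 c4
  rw [← CQ.prod_sandwichMoment h e hst, ← hσ, Finset.sum_neg_distrib, Finset.sum_sub_distrib,
    ← hH₁, ← hH₂] at c5
  rw [← CQ.prod_petzMoment h e hst, ← hσ, Finset.sum_neg_distrib, Finset.sum_sub_distrib,
    ← hH₁, ← hH₂] at c6
  refine ⟨?_, ?_, ?_, ?_, ?_, ?_⟩
  · exact (hS.sum_tailGt_le (Real.exp_pos _) hs.le).trans (rpow_neg_mul_le c1.1 hs c1.2)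
  · exact (hS.sum_tailLt_le (Real.exp_pos _) hs.le).trans (rpow_mul_le c2.1 hs c2.2)
  · exact (tailGt_le hS.margA_isDensity.posSemidef (Real.exp_pos _) hs.le).trans
      (rpow_neg_mul_le c3.1 hs c3.2)
  · exact (tailLt_le hS.margA_isDensity.posSemidef (Real.exp_pos _) hs.le).trans
      (rpow_mul_le c4.1 hs c4.2)
  · rw [hS.renyiInfoJoint_eq hs.ne', Real.logb, neg_mul, ← mul_neg, ← neg_div, ← mul_div_assoc,
      div_le_div_iff_of_pos_right hlog2, one_div, inv_mul_eq_div, le_div_iff₀ hs]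
    have := (abs_le.mp c5.2).2
    rw [a1] at this
    linarith
  · rw [CQ.renyiInfoCond_eq (neg_lt_zero.mpr hs), Real.logb, ← mul_div_assoc,
      div_le_div_iff_of_pos_right hlog2, one_div, inv_neg, neg_neg, inv_mul_eq_div, div_le_iff₀ hs]
    have := (abs_le.mp c6.2).2
    rw [a2] at this
    linarith

/-- The noiseless analogue: density operators from a finite family. -/
theorem exists_exponent_density {ρ : J → Matrix (Fin k → B) (Fin k → B) ℂ}
    (hρ : ∀ j, IsDensity (ρ j)) {γ : ℝ} (hγ : 0 < γ) :
    ∃ s : ℝ, 0 < s ∧ s < 1 ∧ ∀ (r n : ℕ) (h : r * k = n) (c : Fin r → J) (H : ℝ),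
      H = ∑ i, natEntropy (ρ (c i)) →
      tailGt (blockTensor h fun i => ρ (c i)) (Real.exp (-(H - 2 * (r * γ)))) ≤
        Real.exp (-(r * γ * s)) ∧
      (H - r * γ) / Real.log 2 ≤ renyiEntropy s (blockTensor h fun i => ρ (c i)) := by
  have hd : ∀ j, HasDerivAt (fun a : ℝ => (suppPow (ρ j) (1 + a)).trace.re)
      (-natEntropy (ρ j)) 0 ∧ (suppPow (ρ j) (1 + 0)).trace.re = 1 := fun j =>
    ⟨by simpa using hasDerivAt_trace_suppPow (hρ j).posSemidef 1, by
      rw [add_zero, suppPow_one (hρ j).posSemidef, (hρ j).trace_eq_one, Complex.one_re]⟩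
  obtain ⟨s₀, hs₀, b⟩ := exists_uniform_log_bounds hd hγ
  obtain ⟨s, hs, hlt⟩ : ∃ s : ℝ, 0 < s ∧ s < min s₀ 1 := exists_between (by simp [hs₀])
  simp only [lt_min_iff] at hlt
  have a1 : |s| = s := abs_of_pos hs
  refine ⟨s, hs, hlt.2, fun r n h c H hH => ?_⟩
  have hp : ∀ i, (ρ (c i)).PosSemidef := fun i => (hρ (c i)).posSemidef
  have hlog2 : 0 < Real.log 2 := Real.log_pos (by norm_num)
  have c1 := prod_log_bounds fun i => b s (by rw [a1]; exact hlt.1) (c i)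
  have e : ∏ i, (suppPow (ρ (c i)) (1 + s)).trace.re =
      (suppPow (blockTensor h fun i => ρ (c i)) (1 + s)).trace.re := by
    rw [suppPow_blockTensor h hp, trace_blockTensor, re_prod_of_nonneg]
    exact fun i => (suppPow_posSemidef (hp i) _).trace_nonneg
  rw [e, Finset.sum_neg_distrib, ← hH] at c1
  constructor
  · exact (tailGt_le (blockTensor_posSemidef h hp) (Real.exp_pos _) hs.le).trans
      (rpow_neg_mul_le c1.1 hs c1.2)
  · unfold renyiEntropy
    rw [matPow_eq_suppPow _ (by linarith : s + 1 ≠ 0), add_comm s 1, Real.logb, neg_mul, ← mul_neg,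
      ← neg_div, ← mul_div_assoc,
      div_le_div_iff_of_pos_right hlog2, one_div, inv_mul_eq_div, le_div_iff₀ hs]
    have := (abs_le.mp c1.2).2
    rw [a1] at this
    linarith

end ProductBounds

/-! ### Thresholds for long block sequences. -/

section Rates

variable {I O J X A B : Type*} [Fintype I] [DecidableEq I] [Fintype O] [DecidableEq O]
  [Fintype A] [DecidableEq A] [Fintype B] [DecidableEq B]
  [Fintype X] [DecidableEq X] [Fintype J] [DecidableEq J] {k : ℕ}

theorem exists_cypher_code_of_tails {Y : Type*} [Fintype Y] [DecidableEq Y]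
    (T : Matrix I I ℂ →ₗ[ℂ] Matrix O O ℂ) {σ : CQ Y I} (hσ : σ.IsState)
    (hT : (σ.map T).IsState) {K Mc : ℕ} (hMc : 0 < Mc) {H₁ H₂ x t q ζ ξ : ℝ}
    (hξ : 0 < ξ) (hζ : 0 < ζ) (ht : t + 5 * x ≤ H₂ - H₁) (hK : Real.exp (10 * x) ≤ K)
    (hMt : (Mc : ℝ) ≤ Real.exp t + 1) (hqx : Real.exp (-x) ≤ q)
    (h1 : ∑ y, σ.prob y * tailGt (T (σ.state y)) (Real.exp (-(H₁ - 2 * x))) ≤ q)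
    (h2 : ∑ y, σ.prob y * tailLt (T (σ.state y)) (Real.exp (-(H₁ + 2 * x))) ≤ q)
    (h3 : tailGt (σ.map T).margA (Real.exp (-(H₂ - 2 * x))) ≤ q)
    (h4 : tailLt (σ.map T).margA (Real.exp (-(H₂ + 2 * x))) ≤ q)
    (hqξ : (2 + 9 / ξ) * q < ξ / 4) (hqζ : 144 * q < ζ) :
    ∃ (g : Fin K → Fin Mc → Matrix I I ℂ) (Γ : Fin K → Fin Mc → Matrix O O ℂ),
      (∀ s c, IsDensity (g s c)) ∧ (∀ s c, IsDensity (T (g s c))) ∧ (∀ s, IsPOVM (Γ s)) ∧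
      traceNorm (∑ i : Fin K × Fin Mc, ((((K : ℝ) * Mc)⁻¹ : ℝ) : ℂ) • T (g i.1 i.2) -
        (σ.map T).margA) ≤ ξ ∧
      ∑ i : Fin K × Fin Mc,
        ((K : ℝ) * Mc)⁻¹ * ((1 - Γ i.1 i.2) * T (g i.1 i.2)).trace.re ≤ ζ / 2 := by
  have hMc' : (0 : ℝ) < Mc := by exact_mod_cast hMc
  have hK' : (0 : ℝ) < K := (Real.exp_pos _).trans_le hK
  set E : ℝ := Real.exp (H₂ - H₁ - 5 * x) with hE
  have hE0 : 0 < E := Real.exp_pos _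
  -- The dummy messages fill the cypher messages up to about `exp (H₂ - H₁ - 5 x)`: packing
  -- tolerates `H₂ - H₁ - 4 x`, covering needs `H₂ - H₁ + 4 x`, and a key of size `exp (10 x)`
  -- passes from one to the other with a margin `x` on each side.
  set U : ℕ := ⌈E / Mc⌉₊ with hU
  have hU0 : 0 < U := Nat.ceil_pos.2 (by positivity)
  have hU1 : E ≤ Mc * U := by
    have := Nat.le_ceil (E / Mc)
    rwa [div_le_iff₀' hMc'] at this
  have hU2 : (Mc : ℝ) * U - 1 ≤ 2 * E := by
    have := (Nat.ceil_lt_add_one (by positivity : 0 ≤ E / Mc)).le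
    have h := mul_le_mul_of_nonneg_left this hMc'.le
    rw [mul_add, mul_div_cancel₀ _ hMc'.ne'] at h
    have : Real.exp t ≤ E := Real.exp_le_exp.2 (by linarith)
    linarith
  refine exists_cypher_code T hσ hT (by exact_mod_cast hK') hMc hU0 (U := U)
    (u := Real.exp (-(H₁ - 2 * x))) (v := Real.exp (-(H₂ + 2 * x)))
    (u' := Real.exp (-(H₂ - 2 * x))) (v' := Real.exp (-(H₁ + 2 * x))) (θ := ξ / 6) (η := ζ / 32)
    (Real.exp_pos _).le (Real.exp_pos _) (Real.exp_pos _).le (Real.exp_pos _) (by positivity)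
    (by positivity) hξ (by positivity) ?_ ?_
  · have hq : 1 / (2 * (ξ / 6 * Real.exp (-(H₂ + 2 * x)))) *
        (Real.exp (-(H₁ - 2 * x)) / (K * (Mc * U))) ≤ 3 / ξ * q := by
      have e : 1 / (2 * (ξ / 6 * Real.exp (-(H₂ + 2 * x)))) *
          (Real.exp (-(H₁ - 2 * x)) / (K * (Mc * U))) =
          3 / ξ * (Real.exp (H₂ - H₁ + 4 * x) / (K * (Mc * U))) := by
        have : Real.exp (H₂ - H₁ + 4 * x) =
            Real.exp (-(H₁ - 2 * x)) / Real.exp (-(H₂ + 2 * x)) := by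
          rw [← Real.exp_sub]; congr 1; ring
        rw [this]
        have := Real.exp_pos (-(H₂ + 2 * x))
        have hUr : (0 : ℝ) < U := by exact_mod_cast hU0
        field_simp
        norm_num
      rw [e]
      refine mul_le_mul_of_nonneg_left (le_trans ?_ hqx) (by positivity)
      rw [div_le_iff₀ (by positivity)]
      calc Real.exp (H₂ - H₁ + 4 * x) = Real.exp (-x) * (Real.exp (10 * x) * E) := by
            rw [hE, ← Real.exp_add, ← Real.exp_add]; congr 1; ring
        _ ≤ _ := by gcongr
    have hq' : 1 / (ξ / 6) * tailLt (σ.map T).margA (Real.exp (-(H₂ + 2 * x))) ≤ 6 / ξ * q := by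
      rw [one_div_div]
      exact mul_le_mul_of_nonneg_left h4 (by positivity)
    have e : (2 + 9 / ξ) * q = 2 * q + 3 / ξ * q + 6 / ξ * q := by ring
    linarith
  · have hq : 4 * ((Mc : ℝ) * U - 1) * (Real.exp (-(H₂ - 2 * x)) / Real.exp (-(H₁ + 2 * x))) ≤
        8 * q := by
      calc _ ≤ 4 * (2 * E) * (Real.exp (-(H₂ - 2 * x)) / Real.exp (-(H₁ + 2 * x))) := by gcongr
        _ = 8 * Real.exp (-x) := by
          have : Real.exp (-x) = E * (Real.exp (-(H₂ - 2 * x)) / Real.exp (-(H₁ + 2 * x))) := by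
            rw [hE, ← Real.exp_sub, ← Real.exp_add]; congr 1; ring
          rw [this]; ring
        _ ≤ _ := by linarith
    linarith

theorem exists_distinguishable_mixture_of_tail {ρ : Matrix O O ℂ} (hρ : IsDensity ρ)
    {H x t q ζ : ℝ} (ht : t + 8 * x ≤ H) (hqx : Real.exp (-(6 * x)) ≤ q)
    (h1 : tailGt ρ (Real.exp (-(H - 2 * x))) ≤ q) (hζ : 0 < ζ) (hqζ : 12 * q < ζ) :
    ∃ (g Γ : Fin ⌈Real.exp t⌉₊ → Matrix O O ℂ), (∀ c, IsDensity (g c)) ∧ IsPOVM Γ ∧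
      traceNorm (∑ c, (((⌈Real.exp t⌉₊ : ℝ)⁻¹ : ℝ) : ℂ) • g c - ρ) ≤ ζ ∧
      ∑ c, (⌈Real.exp t⌉₊ : ℝ)⁻¹ * ((1 - Γ c) * g c).trace.re ≤ ζ / 2 := by
  rcases le_or_gt t 0 with h0 | h0
  -- For a nonpositive rate a single cypher message suffices, and the cover output itself is sent.
  · have e : ⌈Real.exp t⌉₊ = 1 := by
      rw [Nat.ceil_eq_iff one_ne_zero]
      simp [Real.exp_pos, h0]
    rw [e]
    refine ⟨fun _ => ρ, fun _ => 1, fun _ => hρ, ⟨fun _ => PosSemidef.one, by simp⟩, ?_, ?_⟩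
    · simpa [traceNorm] using hζ.le
    · simpa using (half_pos hζ).le
  · have hN : 0 < ⌈Real.exp t⌉₊ := Nat.ceil_pos.2 (Real.exp_pos _)
    obtain ⟨g, Γ, hg, hΓ, a, b⟩ := exists_distinguishable_mixture hρ hN
      (Real.exp_pos (-(H - 2 * x))).le
    have : (⌈Real.exp t⌉₊ : ℝ) * Real.exp (-(H - 2 * x)) ≤ 2 * q := by
      have h2 : (⌈Real.exp t⌉₊ : ℝ) ≤ 2 * Real.exp t := by
        have := (Nat.ceil_lt_add_one (Real.exp_pos t).le).le
        have := Real.one_le_exp h0.le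
        linarith
      calc _ ≤ 2 * Real.exp t * Real.exp (-(H - 2 * x)) := by gcongr
        _ = 2 * Real.exp (t + -(H - 2 * x)) := by rw [Real.exp_add]; ring
        _ ≤ 2 * Real.exp (-(6 * x)) := by gcongr; linarith
        _ ≤ _ := by linarith
    exact ⟨g, Γ, hg, hΓ, by linarith, by linarith⟩

/-- Independent blocks over a noiseless channel: the rate bound and the code for one cover
message. -/
theorem exists_noiseless_threshold {ρ : J → Matrix (Fin k → B) (Fin k → B) ℂ}
    (hρ : ∀ j, IsDensity (ρ j)) {ζ δ R : ℝ} (hζ : 0 < ζ) (hδ : 0 < δ)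
    (hR : ∀ j, R ≤ entropy (ρ j)) :
    ∃ m : ℕ, ∀ (r n : ℕ) (h : r * k = n) (c : Fin r → J), m ≤ r →
      ((r * (R - δ) : ℝ) : EReal) ≤ (⨆ a ∈ Set.Ioo (0 : ℝ) 1,
        ((renyiEntropy a (blockTensor h fun i => ρ (c i)) - 4 / a * Real.logb 2 (2 / ζ) : ℝ) :
          EReal)) ∧
      ∃ (g Γ : Fin ⌈Real.exp (r * (R - δ) * Real.log 2)⌉₊ →
          Matrix (Fin n → B) (Fin n → B) ℂ),
        (∀ c, IsDensity (g c)) ∧ IsPOVM Γ ∧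
        traceNorm (∑ c, (((⌈Real.exp (r * (R - δ) * Real.log 2)⌉₊ : ℝ)⁻¹ : ℝ) : ℂ) • g c -
          blockTensor h fun i => ρ (c i)) ≤ ζ ∧
        ∑ c, (⌈Real.exp (r * (R - δ) * Real.log 2)⌉₊ : ℝ)⁻¹ * ((1 - Γ c) * g c).trace.re ≤
          ζ / 2 := by
  have hlog2 : 0 < Real.log 2 := Real.log_pos (by norm_num)
  -- The eight margins `r * γ` demanded by the binning step together cost exactly `δ` bits per
  -- block.
  obtain ⟨γ, hγ⟩ : ∃ γ, γ = δ * Real.log 2 / 8 := ⟨_, rfl⟩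
  have hγ0 : 0 < γ := by rw [hγ]; positivity
  obtain ⟨s, hs0, hs1, hs⟩ := exists_exponent_density (k := k) hρ hγ0
  obtain ⟨m, hm⟩ := Filter.eventually_atTop.1
    ((eventually_exp_neg_lt (mul_pos hγ0 hs0) (by positivity : 0 < ζ / 12)).and
      (eventually_log_le 0 (4 / s * Real.logb 2 (2 / ζ)) (half_pos hδ)))
  refine ⟨m, fun r n h c hr => ?_⟩
  obtain ⟨hq, hl⟩ := hm r hr
  obtain ⟨h1, h2⟩ := hs r n h c _ rfl
  set H := ∑ i, natEntropy (ρ (c i)) with hH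
  have hHR : r * R * Real.log 2 ≤ H := by
    have : ∀ i ∈ Finset.univ, R * Real.log 2 ≤ natEntropy (ρ (c i)) := fun i _ => by
      rw [← le_div_iff₀ hlog2]; exact hR (c i)
    have := Finset.card_nsmul_le_sum _ _ _ this
    rw [Finset.card_univ, Fintype.card_fin, nsmul_eq_mul, ← mul_assoc] at this
    exact this
  have hr0 : (0 : ℝ) ≤ r := r.cast_nonneg
  constructor
  · refine le_trans ?_ (le_iSup₂ (α := EReal) s ⟨hs0, hs1⟩)
    rw [EReal.coe_le_coe_iff]
    rw [zero_mul, zero_add] at hl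
    refine le_trans ?_ (sub_le_sub h2 hl)
    have : r * R - r * (δ / 8) ≤ (H - r * γ) / Real.log 2 := by
      rw [le_div_iff₀ hlog2, hγ]
      linarith
    have : 0 ≤ r * δ := by positivity
    linarith
  · refine exists_distinguishable_mixture_of_tail (IsDensity.blockTensor h fun i => hρ (c i))
      (x := r * γ) (q := Real.exp (-(r * (γ * s)))) (H := H) ?_ ?_ ?_ hζ (by linarith)
    · rw [hγ]; linarith
    · refine Real.exp_le_exp.2 (neg_le_neg ?_)
      nlinarith [mul_nonneg hr0 hγ0.le]
    · rwa [← mul_assoc (r : ℝ) γ s]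

theorem logb_natCast_le_of_le_pow {ν r C : ℕ} (h : ν ≤ (r + 1) ^ C) :
    Real.logb 2 ν ≤ C * Real.logb 2 (r + 1) := by
  rcases ν.eq_zero_or_pos with rfl | h0
  · simpa using mul_nonneg C.cast_nonneg
      (Real.logb_nonneg (by norm_num : (1 : ℝ) < 2) (by simp : (1 : ℝ) ≤ r + 1))
  · rw [← Real.logb_pow]
    exact Real.logb_le_logb_of_le (by norm_num) (by exact_mod_cast h0) (by exact_mod_cast h)

/-- Independent blocks over a noisy channel: the rate bounds and the keyed code for one cover
message. -/
theorem exists_noisy_threshold {𝓝 : Matrix A A ℂ →ₗ[ℂ] Matrix B B ℂ} (h𝓝 : IsChannel 𝓝)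
    {σ : J → CQ X (Fin k → A)} (hσ : ∀ j, (σ j).IsState) {ζ ξ δ R : ℝ} (hζ : 0 < ζ) (hξ : 0 < ξ)
    (hδ : 0 < δ) (hR : ∀ j, R - δ / 4 ≤ ((σ j).map (tensorPow k 𝓝)).mutualInfo) :
    ∃ m : ℕ, ∀ (r n : ℕ) (h : r * k = n) (d : ℕ) (e : Fin d ≃ (Fin r → X)) (c : Fin r → J)
      (S : CQ (Fin d) (Fin n → A)), S = CQ.prod h e (fun i => σ (c i)) → m ≤ r →
      ((r * (R - δ) : ℝ) : EReal) ≤ cypherBitsAt ζ (S.map (tensorPow n 𝓝)) ∧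
      ((⨅ a ∈ Set.Iio (0 : ℝ), (((S.map (tensorPow n 𝓝)).renyiInfoCond a +
          Real.logb 2 (numEigenvalues (S.map (tensorPow n 𝓝)).margA)
          + (2 - 2 / a) * Real.logb 2 (12 / ξ) : ℝ) : EReal)) -
        cypherBitsAt ζ (S.map (tensorPow n 𝓝)) + 1) ≤ ((δ * r : ℝ) : EReal) ∧
      Real.logb 2 ⌈Real.exp (r * (δ * Real.log 2 / 2))⌉₊ ≤ δ * r ∧
      ∃ (g : Fin ⌈Real.exp (r * (δ * Real.log 2 / 2))⌉₊ →
          Fin ⌈Real.exp (r * (R - δ) * Real.log 2)⌉₊ → Matrix (Fin n → A) (Fin n → A) ℂ)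
        (Γ : Fin ⌈Real.exp (r * (δ * Real.log 2 / 2))⌉₊ →
          Fin ⌈Real.exp (r * (R - δ) * Real.log 2)⌉₊ → Matrix (Fin n → B) (Fin n → B) ℂ),
        (∀ s c, IsDensity (g s c)) ∧ (∀ s c, IsDensity (tensorPow n 𝓝 (g s c))) ∧
        (∀ s, IsPOVM (Γ s)) ∧
        traceNorm (∑ i : Fin _ × Fin _,
          ((((⌈Real.exp (r * (δ * Real.log 2 / 2))⌉₊ : ℝ) *
            ⌈Real.exp (r * (R - δ) * Real.log 2)⌉₊)⁻¹ : ℝ) : ℂ) •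
              tensorPow n 𝓝 (g i.1 i.2) - (S.map (tensorPow n 𝓝)).margA) ≤ ξ ∧
        ∑ i : Fin _ × Fin _, ((⌈Real.exp (r * (δ * Real.log 2 / 2))⌉₊ : ℝ) *
            ⌈Real.exp (r * (R - δ) * Real.log 2)⌉₊)⁻¹ *
          ((1 - Γ i.1 i.2) * tensorPow n 𝓝 (g i.1 i.2)).trace.re ≤ ζ / 2 := by
  have hlog2 : 0 < Real.log 2 := Real.log_pos (by norm_num)
  -- Ten margins `γ` make up the key exponent `δ * Real.log 2 / 2`; the remainder of `δ` absorbs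
  -- rounding.
  obtain ⟨γ, hγ⟩ : ∃ γ, γ = δ * Real.log 2 / 20 := ⟨_, rfl⟩
  have hγ0 : 0 < γ := by rw [hγ]; positivity
  set τ : J → CQ X (Fin k → B) := fun j => (σ j).map (tensorPow k 𝓝) with hτdef
  have hτ : ∀ j, (τ j).IsState := fun j =>
    ⟨(hσ j).prob_nonneg, (hσ j).prob_sum, fun x => h𝓝.tensorPow_isDensity k ((hσ j).isDensity x)⟩
  obtain ⟨s, hs0, hs1, hs⟩ := exists_exponent hτ hγ0
  set C : ℕ := Fintype.card (J × X × (Fin k → B)) with hC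
  set C' : ℕ := Fintype.card (J × (Fin k → B)) with hC'
  -- For large `r` the tails are small enough for both error budgets, the eigenvalue counts and the
  -- constants depending on `s`, `ζ`, `ξ` fit into one further `γ` per block, and one bit for
  -- rounding fits into `δ / 2`.
  obtain ⟨m, hm⟩ := Filter.eventually_atTop.1
    ((((eventually_exp_neg_lt (mul_pos hγ0 hs0) (by positivity : 0 < ζ / 144)).and
      (eventually_exp_neg_lt (mul_pos hγ0 hs0) (by positivity : 0 < ξ / 4 / (2 + 9 / ξ)))).and
      ((eventually_log_le (1 / s * (C / Real.log 2)) (4 / s * Real.logb 2 (12 / ζ))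
        (div_pos hγ0 hlog2)).and
      (eventually_log_le (C' / Real.log 2) ((2 + 2 / s) * Real.logb 2 (12 / ξ))
        (div_pos hγ0 hlog2)))).and (eventually_log_le 0 1 (half_pos hδ)))
  refine ⟨m, fun r n h d e c S hS hr => ?_⟩
  obtain ⟨⟨⟨hq1, hq2⟩, hl1, hl2⟩, hl3⟩ := hm r hr
  rw [zero_mul, zero_add] at hl3
  have hmap : S.map (tensorPow n 𝓝) = CQ.prod h e fun i => τ (c i) := by rw [hS, CQ.map_prod]
  obtain ⟨h1, h2, h3, h4, h5, h6⟩ := hs r n h d e c _ hmap _ _ rfl rfl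
  set H₁ := ∑ i, (τ (c i)).condEntropy with hH₁
  set H₂ := ∑ i, natEntropy (τ (c i)).margA with hH₂
  have hr0 : (0 : ℝ) ≤ r := r.cast_nonneg
  have hI : r * (R - δ / 4) * Real.log 2 ≤ H₂ - H₁ := by
    have : ∀ i ∈ Finset.univ, (R - δ / 4) * Real.log 2 ≤
        natEntropy (τ (c i)).margA - (τ (c i)).condEntropy := fun i _ => by
      rw [← le_div_iff₀ hlog2, ← (hτ (c i)).mutualInfo_eq]; exact hR (c i)
    have := Finset.card_nsmul_le_sum _ _ _ this
    rw [Finset.card_univ, Fintype.card_fin, nsmul_eq_mul, ← mul_assoc,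
      Finset.sum_sub_distrib] at this
    exact this
  have hν1 : Real.logb 2 (numEigenvalues ((S.map (tensorPow n 𝓝)).margX ⊗ₖ
      (S.map (tensorPow n 𝓝)).margA)) ≤ C * Real.logb 2 (r + 1) := by
    rw [hmap]
    exact logb_natCast_le_of_le_pow (CQ.prod_numEigenvalues_joint_le h e hτ c)
  have hν2 : Real.logb 2 (numEigenvalues (S.map (tensorPow n 𝓝)).margA) ≤
      C' * Real.logb 2 (r + 1) := by
    rw [hmap]
    exact logb_natCast_le_of_le_pow (CQ.prod_numEigenvalues_margA_le h e hτ c)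
  set ρ := S.map (tensorPow n 𝓝) with hρ
  have hcyp : (((H₂ - H₁ - 2 * (r * γ)) / Real.log 2 : ℝ) : EReal) ≤ cypherBitsAt ζ ρ := by
    refine le_trans ?_ (le_iSup₂ (α := EReal) s ⟨hs0, hs1⟩)
    rw [EReal.coe_le_coe_iff]
    have a1 := mul_le_mul_of_nonneg_left hν1 (by positivity : 0 ≤ 1 / s)
    have a2 : 1 / s * (C * Real.logb 2 (r + 1)) =
        1 / s * (C / Real.log 2) * Real.log (r + 1) := by
      rw [Real.logb]; ring
    have a3 : (H₂ - H₁ - 2 * (r * γ)) / Real.log 2 =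
        (H₂ - H₁ - r * γ) / Real.log 2 - γ / Real.log 2 * r := by ring
    linarith
  have hkey : (⨅ a ∈ Set.Iio (0 : ℝ), ((ρ.renyiInfoCond a +
          Real.logb 2 (numEigenvalues ρ.margA)
          + (2 - 2 / a) * Real.logb 2 (12 / ξ) : ℝ) : EReal)) ≤
      (((H₂ - H₁ + 2 * (r * γ)) / Real.log 2 : ℝ) : EReal) := by
    -- The key bound is evaluated at `-s`, the cypher bound at `s`; both equal the mutual
    -- information to first order, so it cancels in the difference.
    refine (iInf₂_le (α := EReal) (-s) (by simpa using hs0)).trans ?_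
    rw [EReal.coe_le_coe_iff]
    have a2 : C' * Real.logb 2 (r + 1) = C' / Real.log 2 * Real.log (r + 1) := by
      rw [Real.logb]; ring
    have a3 : (H₂ - H₁ + 2 * (r * γ)) / Real.log 2 =
        (H₂ - H₁ + r * γ) / Real.log 2 + γ / Real.log 2 * r := by ring
    have a4 : (2 - 2 / -s) = 2 + 2 / s := by ring
    rw [a4]
    linarith
  have hγr : r * γ / Real.log 2 = δ * r / 20 := by
    rw [hγ]; field_simp
  refine ⟨le_trans ?_ hcyp, ?_, ?_, ?_⟩
  · rw [EReal.coe_le_coe_iff, le_div_iff₀ hlog2, hγ]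
    have : 0 ≤ r * δ * Real.log 2 := by positivity
    linarith
  · refine (add_le_add_left (EReal.sub_le_sub hkey hcyp) 1).trans ?_
    rw [← EReal.coe_sub, ← EReal.coe_one, ← EReal.coe_add, EReal.coe_le_coe_iff, ← sub_div]
    have : (H₂ - H₁ + 2 * (r * γ) - (H₂ - H₁ - 2 * (r * γ))) / Real.log 2 =
        4 * (r * γ / Real.log 2) := by ring
    rw [this, hγr]
    have : 0 ≤ δ * r := by positivity
    linarith
  · have h1 : (⌈Real.exp (r * (δ * Real.log 2 / 2))⌉₊ : ℝ) ≤
        2 * Real.exp (r * (δ * Real.log 2 / 2)) := by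
      have := (Nat.ceil_lt_add_one (Real.exp_pos (r * (δ * Real.log 2 / 2))).le).le
      have := Real.one_le_exp (by positivity : 0 ≤ r * (δ * Real.log 2 / 2))
      linarith
    have h0 : (0 : ℝ) < ⌈Real.exp (r * (δ * Real.log 2 / 2))⌉₊ := by
      exact_mod_cast Nat.ceil_pos.2 (Real.exp_pos _)
    refine (Real.logb_le_logb_of_le (by norm_num) h0 h1).trans ?_
    rw [Real.logb, div_le_iff₀ hlog2, Real.log_mul two_ne_zero (Real.exp_pos _).ne', Real.log_exp]
    have := mul_le_mul_of_nonneg_right hl3 hlog2.le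
    linarith
  · have hρS : ρ.IsState := by rw [hmap]; exact CQ.prod_isState h e fun i => hτ (c i)
    have hSS : S.IsState := by rw [hS]; exact CQ.prod_isState h e fun i => hσ (c i)
    rw [mul_assoc (r : ℝ) γ s] at h1 h2 h3 h4
    rw [lt_div_iff₀' (by positivity)] at hq2
    refine exists_cypher_code_of_tails (tensorPow n 𝓝) hSS hρS (Nat.ceil_pos.2 (Real.exp_pos _))
      (x := r * γ) (t := r * (R - δ) * Real.log 2) hξ hζ ?_ ?_
      (Nat.ceil_lt_add_one (Real.exp_pos _).le).le ?_ h1 h2 h3 h4 hq2 (by linarith)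
    · rw [hγ]
      have : 0 ≤ r * δ * Real.log 2 := by positivity
      linarith
    · refine le_trans (le_of_eq ?_) (Nat.le_ceil _)
      rw [hγ]; congr 1; ring
    · refine Real.exp_le_exp.2 (neg_le_neg ?_)
      exact mul_le_mul_of_nonneg_left (mul_le_of_le_one_right hγ0.le hs1.le) hr0

/-- Cq states on different finite alphabets, moved to a common one. -/
noncomputable def CQ.pad {D : J → ℕ} (σ : ∀ j, CQ (Fin (D j)) A) (j : J) : CQ (Σ j, Fin (D j)) A where
  prob p := if p.1 = j then (σ p.1).prob p.2 else 0
  state p := (σ p.1).state p.2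

section Pad

variable {D : J → ℕ} (σ : ∀ j, CQ (Fin (D j)) A) (j : J)

/-- Foreign letters have probability zero, so averages over letters do not see the padding;
entropies and marginals follow. -/
theorem CQ.pad_sum {E : Type*} [AddCommMonoid E] [Module ℝ E] (F : (Σ j, Fin (D j)) → E) :
    ∑ p, (CQ.pad σ j).prob p • F p = ∑ x, (σ j).prob x • F ⟨j, x⟩ := by
  rw [Fintype.sum_sigma, Finset.sum_eq_single j]
  · simp [CQ.pad]
  · intro b _ hb
    simp [CQ.pad, hb]
  · simp

variable {σ j}

theorem CQ.pad_isState (hσ : ∀ j, (σ j).IsState) : (CQ.pad σ j).IsState where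
  prob_nonneg p := by
    unfold CQ.pad
    dsimp only
    split_ifs
    exacts [(hσ _).prob_nonneg _, le_rfl]
  prob_sum := by
    simpa [(hσ j).prob_sum] using CQ.pad_sum σ j fun _ => (1 : ℝ)
  isDensity p := (hσ _).isDensity _

theorem CQ.pad_map_margA (T : Matrix A A ℂ →ₗ[ℂ] Matrix B B ℂ) :
    ((CQ.pad σ j).map T).margA = ((σ j).map T).margA :=
  CQ.pad_sum σ j fun p => T ((σ p.1).state p.2)

theorem CQ.pad_map_mutualInfo {T : Matrix A A ℂ →ₗ[ℂ] Matrix B B ℂ} (hσ : ∀ j, (σ j).IsState)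
    (hT : ∀ j x, IsDensity (T ((σ j).state x))) :
    ((CQ.pad σ j).map T).mutualInfo = ((σ j).map T).mutualInfo := by
  have h1 : ((CQ.pad σ j).map T).IsState :=
    ⟨(CQ.pad_isState hσ).prob_nonneg, (CQ.pad_isState hσ).prob_sum, fun p => hT p.1 p.2⟩
  have h2 : ((σ j).map T).IsState := ⟨(hσ j).prob_nonneg, (hσ j).prob_sum, fun p => hT j p⟩
  rw [h1.mutualInfo_eq, h2.mutualInfo_eq, CQ.pad_map_margA]
  congr 2
  exact CQ.pad_sum σ j fun p => natEntropy (T ((σ p.1).state p.2))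

end Pad

theorem exists_lt_mutualInfo (T : Matrix A A ℂ →ₗ[ℂ] Matrix B B ℂ) {ρ : Matrix A A ℂ}
    (hρ : IsDensity ρ) {x : ℝ} (hx : x < supInfo T (T ρ)) :
    ∃ (d : ℕ) (σ : CQ (Fin d) A), σ.IsState ∧ (σ.map T).margA = T ρ ∧ x < (σ.map T).mutualInfo := by
  obtain ⟨_, ⟨d, σ, h1, h2, rfl⟩, h3⟩ := exists_lt_of_lt_csSup (by
    -- The ensemble with the single letter `ρ` is admissible; nonemptiness alone yields an element
    -- above any number below the supremum.
    refine ⟨_, 1, ⟨fun _ => 1, fun _ => ρ⟩, ⟨by simp, by simp, fun _ => hρ⟩, ?_, rfl⟩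
    simp [CQ.map, CQ.margA]) hx
  exact ⟨d, σ, h1, h2, h3⟩

theorem le_logb_ceil_exp (t : ℝ) : t ≤ Real.logb 2 ⌈Real.exp (t * Real.log 2)⌉₊ := by
  rw [Real.logb, le_div_iff₀ (Real.log_pos (by norm_num)), Real.le_log_iff_exp_le]
  · exact Nat.le_ceil _
  · exact_mod_cast Nat.ceil_pos.2 (Real.exp_pos _)

end Rates
end QuantumStego

/-! ### The main theorem. -/

theorem mainTheorem5
    {A B : Type*} [Fintype A] [DecidableEq A] [Fintype B] [DecidableEq B]
    (𝓜 : Matrix A A ℂ →ₗ[ℂ] Matrix A A ℂ) (h𝓜 : QuantumStego.IsChannel 𝓜)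
    (𝓝 : Matrix A A ℂ →ₗ[ℂ] Matrix B B ℂ) (h𝓝 : QuantumStego.IsChannel 𝓝)
    (k ℓ : ℕ) (hk : 0 < k) (hℓ : 0 < ℓ)
    (P : Fin ℓ → Matrix (Fin k → A) (Fin k → A) ℂ)
    (hP : ∀ j, QuantumStego.IsDensity (P j)) :
    -- noiseless channel: the true channel is `idA`
    (∀ idA : Matrix A A ℂ →ₗ[ℂ] Matrix A A ℂ, idA = LinearMap.id →
      ∀ ζ δ : ℝ, 0 < ζ → 0 < δ → ∃ m : ℕ,
      ∀ (n M : ℕ) (ε : ℝ)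
        (f : Fin M → Matrix (Fin n → A) (Fin n → A) ℂ)
        (Λ : Fin M → Matrix (Fin n → A) (Fin n → A) ℂ),
        m ≤ n / k → 0 < M →
        QuantumStego.HasProductStructure P f →
        QuantumStego.IsCode
          (QuantumStego.tensorPow n idA ∘ₗ QuantumStego.tensorPow n 𝓜) ε f Λ →
        -- the rate expression of the stego protocol
        (((n / k : ℝ) * (QuantumStego.minOutputEntropy 𝓜 P - δ) : ℝ) : EReal) ≤
          QuantumStego.cypherBitsNoiseless ζ (fun w =>
            QuantumStego.tensorPow n idA (QuantumStego.tensorPow n 𝓜 (f w))) ∧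
        -- existence of the stego protocol
        ∃ Mc : ℕ, 0 < Mc ∧
          (n / k : ℝ) * (QuantumStego.minOutputEntropy 𝓜 P - δ) ≤ Real.logb 2 Mc ∧
          QuantumStego.HasStegoCode (QuantumStego.tensorPow n idA) M Mc
            (ζ + 2 * √(ζ + ε)) ζ
            (QuantumStego.inducedState
              (QuantumStego.tensorPow n idA ∘ₗ QuantumStego.tensorPow n 𝓜) f)) ∧
    -- noisy channel: the true channel is `𝓝`
    (∀ ζ ξ δ : ℝ, 0 < ζ → ζ < 1 → 0 < ξ → ξ < 1 → 0 < δ → ∃ m : ℕ,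
      ∀ (n M : ℕ) (ε : ℝ)
        (f : Fin M → Matrix (Fin n → A) (Fin n → A) ℂ)
        (Λ : Fin M → Matrix (Fin n → B) (Fin n → B) ℂ),
        m ≤ n / k → 0 < M →
        QuantumStego.HasProductStructure P f →
        QuantumStego.IsCode
          (QuantumStego.tensorPow n 𝓝 ∘ₗ QuantumStego.tensorPow n 𝓜) ε f Λ →
        -- the rate expressions of the stego protocol, for suitable cq states
        (∃ (d : ℕ) (σ : Fin M → QuantumStego.CQ (Fin d) (Fin n → A)),
          (∀ w, (σ w).IsState ∧
            ((σ w).map (QuantumStego.tensorPow n 𝓝)).margA =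
              QuantumStego.tensorPow n 𝓝 (QuantumStego.tensorPow n 𝓜 (f w))) ∧
          (((n / k : ℝ) * (QuantumStego.infSupInfo 𝓜 𝓝 P - δ) : ℝ) : EReal) ≤
            QuantumStego.cypherBitsNoisy ζ
              (fun w => (σ w).map (QuantumStego.tensorPow n 𝓝)) ∧
          QuantumStego.keyBitsNoisy ζ ξ (fun w => (σ w).map (QuantumStego.tensorPow n 𝓝)) ≤
            ((δ * n : ℝ) : EReal)) ∧
        -- existence of the stego protocol
        ∃ Mc K : ℕ, 0 < Mc ∧ 0 < K ∧
          (n / k : ℝ) * (QuantumStego.infSupInfo 𝓜 𝓝 P - δ) ≤ Real.logb 2 Mc ∧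
          Real.logb 2 K ≤ δ * n ∧
          QuantumStego.HasKeyedStegoCode (QuantumStego.tensorPow n 𝓝) M Mc K
            (ζ + 2 * √(ξ + ε)) ξ
            (QuantumStego.inducedState
              (QuantumStego.tensorPow n 𝓝 ∘ₗ QuantumStego.tensorPow n 𝓜) f)) := by
  open QuantumStego in
  have hk' : (k : ℝ) ≠ 0 := by exact_mod_cast hk.ne'
  have h𝓜P : ∀ j, IsDensity (tensorPow k 𝓜 (P j)) := fun j => h𝓜.tensorPow_isDensity k (hP j)
  constructor
  · rintro idA rfl ζ δ hζ hδ
    obtain ⟨m, hm⟩ := exists_noiseless_threshold h𝓜P hζ hδ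
      (R := minOutputEntropy 𝓜 P) fun j => ciInf_le (Set.finite_range _).bddBelow j
    refine ⟨m, fun n M ε f Λ hn hM ⟨r, h, hf⟩ hcode => ?_⟩
    choose c hc using hf
    rw [← h, Nat.mul_div_cancel _ hk] at hn
    have hnk : (n / k : ℝ) = r := by rw [← h, Nat.cast_mul, mul_div_cancel_right₀ _ hk']
    have hout : ∀ w, tensorPow n LinearMap.id (tensorPow n 𝓜 (f w)) =
        blockTensor h fun i => tensorPow k 𝓜 (P (c w i)) := fun w => by
      rw [tensorPow_id, hc, tensorPow_blockTensor]
    have hm' := fun w => hm r n h (c w) hn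
    rw [hnk]
    refine ⟨le_iInf fun w => ?_, ⌈Real.exp (r * (minOutputEntropy 𝓜 P - δ) * Real.log 2)⌉₊,
      Nat.ceil_pos.2 (Real.exp_pos _), le_logb_ceil_exp _, HasKeyedStegoCode.hasStegoCode ?_⟩
    · simp only [hout]
      exact (hm' w).1
    · choose g Γ hg hΓ hcov hdec using fun w => (hm' w).2
      have hsucc := hcode.success
      simp only [Fintype.card_fin] at hsucc
      simp only [inducedState, Fintype.card_fin]
      -- A key set with one element, with covering error `ξ = ζ`.
      refine hasKeyedStegoCode_of_decoders _ hM (Nat.ceil_pos.2 (Real.exp_pos _)) one_pos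
        hcode.isPOVM hζ.le hsucc (fun w => ?_) (g := fun _ p => g p.1 p.2)
        (fun _ p => hg p.1 p.2) (fun _ p => ?_) (Γ := fun _ w => Γ w) (fun _ w => hΓ w)
        (fun w => ?_) (fun w => ?_)
      · rw [LinearMap.comp_apply, hout]
        exact (IsDensity.blockTensor h fun i => h𝓜P _).posSemidef.1
      · rw [tensorPow_id]
        exact hg p.1 p.2
      · simpa [Fintype.sum_prod_type, tensorPow_id, LinearMap.comp_apply, hc,
          tensorPow_blockTensor] using hcov w
      · simpa [Fintype.sum_prod_type, tensorPow_id] using hdec w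
  · intro ζ ξ δ hζ _ hξ _ hδ
    -- An ensemble within `δ / 4` of the supremum for each of the finitely many block types; the
    -- supremum need not be attained.
    choose D σ hσ hσm hσI using fun j => exists_lt_mutualInfo (tensorPow k 𝓝) (h𝓜P j)
      (sub_lt_self _ (by positivity : 0 < δ / 4))
    have hpad : ∀ j, (CQ.pad σ j).IsState := fun j => CQ.pad_isState hσ
    obtain ⟨m, hm⟩ := exists_noisy_threshold h𝓝 hpad hζ hξ hδ (R := infSupInfo 𝓜 𝓝 P) fun j => by
      rw [CQ.pad_map_mutualInfo hσ fun j x => h𝓝.tensorPow_isDensity k ((hσ j).isDensity x)]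
      exact le_trans (sub_le_sub_right (ciInf_le (Set.finite_range _).bddBelow j) _) (hσI j).le
    refine ⟨m, fun n M ε f Λ hn hM ⟨r, h, hf⟩ hcode => ?_⟩
    choose c hc using hf
    rw [← h, Nat.mul_div_cancel _ hk] at hn
    have hnk : (n / k : ℝ) = r := by rw [← h, Nat.cast_mul, mul_div_cancel_right₀ _ hk']
    have hδn : δ * r ≤ δ * n := by
      refine mul_le_mul_of_nonneg_left ?_ hδ.le
      exact_mod_cast h ▸ Nat.le_mul_of_pos_right r hk
    -- Words of letters are enumerated so that the product alphabet has the required form `Fin d`,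
    -- the same for all cover messages.
    have e : Fin (Fintype.card (Fin r → Σ j, Fin (D j))) ≃ (Fin r → Σ j, Fin (D j)) :=
      (Fintype.equivFin _).symm
    set S := fun w => CQ.prod h e fun i => CQ.pad σ (c w i) with hS
    have hSm : ∀ w, ((S w).map (tensorPow n 𝓝)).margA =
        tensorPow n 𝓝 (tensorPow n 𝓜 (f w)) := fun w => by
      rw [hS, CQ.map_prod, CQ.prod_margA, hc, tensorPow_blockTensor, tensorPow_blockTensor]
      simp only [CQ.pad_map_margA, hσm]
    have hm' := fun w => hm r n h _ e (c w) (S w) rfl hn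
    rw [hnk]
    refine ⟨⟨_, S, fun w => ⟨CQ.prod_isState h e fun i => hpad _, hSm w⟩,
      le_iInf fun w => (hm' w).1, iSup_le fun w => (hm' w).2.1.trans ?_⟩,
      ⌈Real.exp (r * (infSupInfo 𝓜 𝓝 P - δ) * Real.log 2)⌉₊,
      ⌈Real.exp (r * (δ * Real.log 2 / 2))⌉₊, Nat.ceil_pos.2 (Real.exp_pos _),
      Nat.ceil_pos.2 (Real.exp_pos _), le_logb_ceil_exp _, (hm' ⟨0, hM⟩).2.2.1.trans hδn, ?_⟩
    · exact_mod_cast hδn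
    · choose g Γ hg hTg hΓ hcov hdec using fun w => (hm' w).2.2.2
      have hsucc := hcode.success
      simp only [Fintype.card_fin] at hsucc
      simp only [inducedState, Fintype.card_fin]
      refine hasKeyedStegoCode_of_decoders _ hM (Nat.ceil_pos.2 (Real.exp_pos _))
        (Nat.ceil_pos.2 (Real.exp_pos _)) hcode.isPOVM hζ.le hsucc (fun w => ?_)
        (g := fun s p => g p.1 s p.2) (fun s p => hg p.1 s p.2) (fun s p => hTg p.1 s p.2)
        (Γ := fun s w => Γ w s) (fun s w => hΓ w s) (fun w => ?_) hdec
      · exact (h𝓝.tensorPow_isDensity n (h𝓜.tensorPow_isDensity n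
          (hcode.isDensity w))).posSemidef.1
      · rw [LinearMap.comp_apply, ← hSm]
        exact hcov w
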